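/- Let $d\ge 2$ and let $K\in\mathbb R^{d\times d}$ be symmetric positive definite. Put $$f_{\infty,K}(x)=\frac{\det(K)^{-1/2}}{(2\pi)^{d/2}}\exp\Big(-\frac{x^TK^{-1}x}{2}\Big),\qquad \mathcal H=L^2(\mathbb R^d,f_{\infty,K}^{-1}\,dx)\ \text{(real-valued)},\qquad V_0=\operatorname{span}\{f_{\infty,K}\}\subset\mathcal H .$$ For real $d\times d$ matrices $C,D$ with $D$ symmetric positive semi-definite, let $-L_{C,D}f=\operatorname{div}(D\nabla f+Cxf)$, and let $e^{-L_{C,D}t}$, $t\ge0$, denote the propagator on $\mathcal H$ of the Fokker–Planck equation $\partial_tf=-L_{C,D}f$, i.e. the bounded operators mapping $f_0\in\mathcal H$ to the value at time $t$ of the unique (distributional) solution in $C([0,\infty);\mathcal H)$ with initial value $f_0$. Let $$\mathcal I(K)=\{(C,D):\ D \text{ symmetric positive semi-definite},\ \operatorname{Tr}D\le d,\ L_{C,D}f_{\infty,K}=0\}.$$ Write $\sigma$ for the spectrum, $\rho(C)=\min\{\operatorname{Re}\lambda:\lambda\in\sigma(C)\}$ for the spectral gap, $\|A\|_{\mathcal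 F}=\sqrt{\operatorname{Tr}(A^TA)}$, $\kappa(K)=\|K\|\,\|K^{-1}\|$ for the condition number (spectral norm), and $\lambda_{opt}=\max\sigma(K^{-1})$. Then $$\lambda_{opt}=\max\{\rho(C):(C,D)\in\mathcal I(K)\},$$ and for every $c>1$ there is a pair $(C_{opt},D_{opt})\in\mathcal I(K)$, with $D_{opt}$ of rank one, such that the propagator $e^{-L_{C_{opt},D_{opt}}t}$ exists, maps the orthogonal complement $V_0^\perp$ (in $\mathcal H$) into itself for all $t\ge0$, and the following hold. (a) $\ \|e^{-L_{C_{opt},D_{opt}}t}\|_{\mathcal B(V_0^\perp)}\le c\,e^{-\lambda_{opt}t}$ for all $t\ge0$. (b) $\ \|D_{opt}\|_{\mathcal F}=d$ and $$\|C_{opt}\|_{\mathcal F}\le\lambda_{opt}\Big[d+\sqrt{\kappa(K)}\,\frac{2\pi c^2}{\sqrt3\,(c^2-1)}\,\sqrt d\,(d-1)\Big].$$ -/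

import Mathlib

open MeasureTheory
open scoped ContDiff

namespace FokkerPlanck

noncomputable section

/-- The space `ℝ^d` with its Euclidean norm. -/
abbrev E (d : ℕ) : Type := EuclideanSpace ℝ (Fin d)

/-- Real `d × d` matrices. -/
abbrev Mat (d : ℕ) : Type := Matrix (Fin d) (Fin d) ℝ

/-- The matrix `A` as a (continuous) linear operator `x ↦ A x` on Euclidean space. -/
def act {d : ℕ} (A : Mat d) : E d →L[ℝ] E d := Matrix.toEuclideanCLM (n := Fin d) (𝕜 := ℝ) A

/-- The divergence `∑ i, ∂_i F_i` of a vector field. -/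
def div {d : ℕ} (F : E d → E d) (x : E d) : ℝ :=
  ∑ i, (fderiv ℝ F x (EuclideanSpace.single i 1)) i

/-- The centred Gaussian density with covariance matrix `K`. -/
def fInf {d : ℕ} (K : Mat d) (x : E d) : ℝ :=
  K.det ^ (-(1 / 2 : ℝ)) / (2 * Real.pi) ^ ((d : ℝ) / 2) *
    Real.exp (-(inner ℝ x (act K⁻¹ x)) / 2)

/-- The Fokker-Planck operator `L_{C,D} f = - div (D ∇f + C x f)`, for `f` of class `C²`. -/
def fpOp {d : ℕ} (C D : Mat d) (f : E d → ℝ) (x : E d) : ℝ :=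
  - div (fun y => act D (gradient f y) + f y • act C y) x

/-- The formal adjoint, in `L²(dx)`, of `-L_{C,D}` for symmetric `D`:
`φ ↦ div (D ∇φ) - ⟨C x, ∇φ⟩`. -/
def fpAdjoint {d : ℕ} (C D : Mat d) (φ : E d → ℝ) (x : E d) : ℝ :=
  div (fun y => act D (gradient φ y)) x - inner ℝ (act C x) (gradient φ x)

/-- The admissible pairs `(C, D)`: `D` is symmetric positive semi-definite with trace at most `d`,
and the Gaussian density with covariance `K` is a steady state. -/
def admissible {d : ℕ} (K : Mat d) : Set (Mat d × Mat d) :=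
  {p | p.2.PosSemidef ∧ p.2.trace ≤ (d : ℝ) ∧ ∀ x, fpOp p.1 p.2 (fInf K) x = 0}

/-- The measure `f_∞(x)⁻¹ dx`. -/
def weight {d : ℕ} (K : Mat d) : Measure (E d) :=
  (volume : Measure (E d)).withDensity (fun x => ENNReal.ofReal (fInf K x)⁻¹)

/-- The real Hilbert space `L²(ℝ^d, f_∞⁻¹)`. -/
abbrev H {d : ℕ} (K : Mat d) : Type := Lp ℝ 2 (weight K)

/-- The span of `f_∞` in the Hilbert space (the spanning set consists of the class of `f_∞`). -/
def V0 {d : ℕ} (K : Mat d) : Submodule ℝ (H K) :=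
  Submodule.span ℝ {g : H K | (g : E d → ℝ) =ᵐ[weight K] fInf K}

/-- `f ∈ C([0,∞); H)` is a solution, with initial value `f₀`, of
`∂_t f = div (D ∇f + C x f)` on `(0,∞) × ℝ^d`, the equation being understood in the sense of
distributions in the variable `x`. -/
structure IsSolution {d : ℕ} (K C D : Mat d) (f₀ : H K) (f : ℝ → H K) : Prop where
  continuousOn : ContinuousOn f (Set.Ici 0)
  initial : f 0 = f₀
  equation : ∀ φ : E d → ℝ, ContDiff ℝ ∞ φ → HasCompactSupport φ → ∀ t : ℝ, 0 < t →
    HasDerivAt (fun s : ℝ => ∫ x, (f s : E d → ℝ) x * φ x)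
      (∫ x, (f t : E d → ℝ) x * fpAdjoint C D φ x) t

/-- `S` is the propagator `t ↦ e^{-L_{C,D} t}`, `t ≥ 0`, on the Hilbert space: the bounded operators
that map each initial value to the value at time `t` of the unique solution in `C([0,∞); H)`.
Values of `S` at negative times are irrelevant. -/
def IsPropagator {d : ℕ} (K C D : Mat d) (S : ℝ → H K →L[ℝ] H K) : Prop :=
  ∀ f₀ : H K, IsSolution K C D f₀ (fun t => S t f₀) ∧
    ∀ g : ℝ → H K, IsSolution K C D f₀ g → ∀ t : ℝ, 0 ≤ t → g t = S t f₀

/-- `max σ(K⁻¹)`, for `K` symmetric positive definite. -/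
def lamOpt {d : ℕ} (K : Mat d) : ℝ := sSup (spectrum ℝ K⁻¹)

/-- The spectral gap `ρ(C) = min {Re λ : λ ∈ σ(C)}`, with `σ(C)` the complex spectrum. -/
def spectralGap {d : ℕ} (C : Mat d) : ℝ :=
  sInf (Complex.re '' spectrum ℂ (C.map Complex.ofReal))

/-- The Frobenius norm. -/
def frobNorm {d : ℕ} (A : Mat d) : ℝ := Real.sqrt (A.transpose * A).trace

/-- The (spectral) condition number `‖K‖ ‖K⁻¹‖` of an invertible matrix. -/
def condNumber {d : ℕ} (K : Mat d) : ℝ := ‖act K‖ * ‖act K⁻¹‖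

end

end FokkerPlanck

/-!
# Optimal decay for Fokker-Planck equations with a given Gaussian steady state

**Spectral gap.** Evaluating `L_{C,D} f_∞ = 0` at the origin gives `Tr C = Tr (D K⁻¹)`
(`trace_eq_of_mem_admissible`). The mean of the real parts of the eigenvalues of `C` is therefore
at most `λ_opt Tr D / d ≤ λ_opt` (`spectralGap_le_lamOpt`).

**Optimal matrices.** Write `K = P Pᵀ`, where a Householder reflection is used to make
`P (1, …, 1)` an eigenvector of `K⁻¹` for `λ_opt` (`exists_factor_oneVec`). Put
`D = λ_opt P 1 1ᵀ Pᵀ` and `C = λ_opt P (1 1ᵀ + J) P⁻¹` with `J` skew-symmetric. Then `D` has rank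
one and trace `d`, and `C K + K Cᵀ = 2 D`, which makes `f_∞` a steady state. For
`J_jk = (q_j + q_k) / (q_k - q_j)` and `Q = diag q`, the matrix `1 1ᵀ + J` also solves the
Lyapunov equation `Aᵀ Q + Q A = 2 Q` (`inner_ones_add_skew`). All eigenvalues of `C` therefore have
real part `λ_opt`, and the flow of the drift decays exactly like `e^{-λ_opt t}` in a norm which is
equivalent to that of `K` with constant `c`, if `q` takes values in `[1, c²]`. Equidistant values
keep the entries of `J` small, of size `|j - k|⁻¹`, and `∑ 1 / n² = π² / 6` gives the bound on the
Frobenius norm of `C` (`frobNorm_skew_nodes_le`, `frobNorm_drift_le`).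

**From the drift to the propagator.** The waves `e^{⟨k, K k⟩ / 2} cos (⟨k, x⟩ - θ) f_∞(x)` are total
in the Hilbert space, and their inner products are combinations of `cosh ⟨k, K l⟩` and
`sinh ⟨k, K l⟩` (`inner_wave_wave`). Comparing the power series termwise with the Schur product
theorem shows that a linear map `B` on wave vectors which contracts the quadratic form of `K` by
`r²`, with `r ≤ 1`, induces a bounded operator that contracts `V₀ᗮ` by `r`: the second quantisation
of `B` (`norm_sq_secondQuant_le`). The Fokker-Planck propagator is the second quantisation of the
flow of `-K⁻¹ C K` (`propagator`), so that the decay of this flow transfers to `V₀ᗮ` with the same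
constant.

**Existence and uniqueness.** In Fourier variables the equation is of first order, and
`cosTransform_propagator` is its solution by characteristics. A test function is a superposition of
trigonometric functions, by Fourier inversion, which gives existence (`isSolution_propagator`).
Conversely, every distributional solution may be tested against trigonometric functions, by a
cut-off argument, and its pairing with a wave is constant along the characteristics, which gives
uniqueness (`isPropagator_propagator`).
-/

namespace FokkerPlanck

/-! ### Matrices as operators -/

section

variable {d : ℕ}

theorem act_mul (A B : Mat d) (x : E d) : act (A * B) x = act A (act B x) := by
  simp [act]

theorem act_one (x : E d) : act (1 : Mat d) x = x := by
  simp [act]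

theorem act_add (A B : Mat d) (x : E d) : act (A + B) x = act A x + act B x := by
  simp [act]

theorem act_sub (A B : Mat d) (x : E d) : act (A - B) x = act A x - act B x := by
  simp [act]

theorem act_smul (r : ℝ) (A : Mat d) (x : E d) : act (r • A) x = r • act A x := by
  simp [act]

theorem act_apply (A : Mat d) (x : E d) (i : Fin d) : act A x i = ∑ j, A i j * x j := by
  simp [act, Matrix.mulVec, dotProduct]

theorem adjoint_act (A : Mat d) : ContinuousLinearMap.adjoint (act A) = act A.transpose := by
  have h : star (act A) = act (star A) :=
    (map_star (Matrix.toEuclideanCLM (n := Fin d) (𝕜 := ℝ)) A).symm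
  rw [ContinuousLinearMap.star_eq_adjoint] at h
  rw [h, Matrix.star_eq_conjTranspose, Matrix.conjTranspose_eq_transpose_of_trivial]

theorem inner_act_left (A : Mat d) (x y : E d) :
    inner ℝ (act A x) y = inner ℝ x (act A.transpose y) := by
  rw [← adjoint_act, ContinuousLinearMap.adjoint_inner_right]

theorem inner_act_right (A : Mat d) (x y : E d) :
    inner ℝ x (act A y) = inner ℝ (act A.transpose x) y := by
  rw [inner_act_left, Matrix.transpose_transpose]

theorem transpose_eq_of_posDef {K : Mat d} (hK : K.PosDef) : K.transpose = K := by
  have := hK.isHermitian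
  rwa [Matrix.IsHermitian, Matrix.conjTranspose_eq_transpose_of_trivial] at this

theorem transpose_eq_of_posSemidef {K : Mat d} (hK : K.PosSemidef) : K.transpose = K := by
  have := hK.isHermitian
  rwa [Matrix.IsHermitian, Matrix.conjTranspose_eq_transpose_of_trivial] at this

theorem inner_act_nonneg {D : Mat d} (hD : D.PosSemidef) (x : E d) : 0 ≤ inner ℝ x (act D x) := by
  have h := hD.dotProduct_mulVec_nonneg x.ofLp
  have e : inner ℝ x (act D x) = star x.ofLp ⬝ᵥ (D.mulVec x.ofLp) := by
    simp only [PiLp.inner_apply, act_apply, dotProduct, Matrix.mulVec, star_trivial]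
    simp [mul_comm]
  rw [e]; exact h

open scoped MatrixOrder Matrix.Norms.L2Operator in
theorem exists_eq_transpose_mul_self {D : Mat d} (hD : D.PosSemidef) :
    ∃ B : Mat d, D = B.transpose * B := by
  obtain ⟨B, hB⟩ := (CStarAlgebra.nonneg_iff_eq_star_mul_self (A := Mat d)).mp hD.nonneg
  rw [Matrix.star_eq_conjTranspose, Matrix.conjTranspose_eq_transpose_of_trivial] at hB
  exact ⟨B, hB⟩

theorem exists_factor {K : Mat d} (hK : K.PosDef) :
    ∃ P : Mat d, K = P * P.transpose ∧ IsUnit P.det := by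
  obtain ⟨B, hB⟩ := exists_eq_transpose_mul_self hK.posSemidef
  refine ⟨B.transpose, by simpa using hB, ?_⟩
  have h := hK.det_pos
  rw [hB, Matrix.det_mul, Matrix.det_transpose] at h
  rw [Matrix.det_transpose]
  exact isUnit_iff_ne_zero.mpr fun h0 => by simp [h0] at h

theorem inner_act_mul_transpose (P : Mat d) (x y : E d) :
    inner ℝ x (act (P * P.transpose) y) = inner ℝ (act P.transpose x) (act P.transpose y) := by
  rw [act_mul, inner_act_right]

theorem inner_act_self_mul_transpose (P : Mat d) (x : E d) :
    inner ℝ x (act (P * P.transpose) x) = ‖act P.transpose x‖ ^ 2 := by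
  rw [inner_act_mul_transpose, real_inner_self_eq_norm_sq]

theorem act_inv_act {P : Mat d} (hP : IsUnit P.det) (x : E d) : act P⁻¹ (act P x) = x := by
  rw [← act_mul, Matrix.nonsing_inv_mul _ hP, act_one]

theorem act_act_inv {P : Mat d} (hP : IsUnit P.det) (x : E d) : act P (act P⁻¹ x) = x := by
  rw [← act_mul, Matrix.mul_nonsing_inv _ hP, act_one]

theorem isUnit_det_of_posDef {K : Mat d} (hK : K.PosDef) : IsUnit K.det :=
  isUnit_iff_ne_zero.mpr hK.det_pos.ne'

theorem act_det (P : Mat d) : (act P).det = P.det := by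
  rw [ContinuousLinearMap.det, act, Matrix.coe_toEuclideanCLM_eq_toEuclideanLin,
    Matrix.toEuclideanLin_eq_toLin_orthonormal, LinearMap.det_toLin]

/-- Under the substitution `x = P y`, with `K = P Pᵀ`, the Gaussian density becomes the standard
one. -/
theorem fInf_act {K P : Mat d} (hKP : K = P * P.transpose) (hP : IsUnit P.det) (y : E d) :
    |P.det| * fInf K (act P y) =
      (2 * Real.pi) ^ (-((d : ℝ) / 2)) * Real.exp (-‖y‖ ^ 2 / 2) := by
  have h1 : inner ℝ (act P y) (act K⁻¹ (act P y)) = ‖y‖ ^ 2 := by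
    have : K⁻¹ = P⁻¹.transpose * P⁻¹.transpose.transpose := by
      rw [hKP, Matrix.mul_inv_rev, Matrix.transpose_transpose, Matrix.transpose_nonsing_inv]
    rw [this, inner_act_self_mul_transpose, Matrix.transpose_transpose, act_inv_act hP]
  have h2 : K.det = |P.det| ^ 2 := by
    rw [hKP, Matrix.det_mul, Matrix.det_transpose, sq_abs, sq]
  have h3 : 0 < |P.det| := abs_pos.mpr hP.ne_zero
  have h4 : K.det ^ (-(1 / 2 : ℝ)) = |P.det|⁻¹ := by
    rw [h2, ← Real.rpow_natCast, ← Real.rpow_mul h3.le]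
    norm_num
    rw [Real.rpow_neg_one]
  rw [fInf, h1, h4, Real.rpow_neg (by positivity)]
  field_simp

end

/-! ### Gaussian integrals -/

section

variable {d : ℕ} {K : Mat d}

theorem fInf_pos (hK : K.PosDef) (x : E d) : 0 < fInf K x := by
  have := hK.det_pos
  rw [fInf]; positivity

theorem continuous_fInf (K : Mat d) : Continuous (fInf K) := by
  unfold fInf; fun_prop

/-- The density is bounded by a multiple of an isotropic Gaussian. -/
theorem exists_fInf_le (hK : K.PosDef) :
    ∃ A a : ℝ, 0 < a ∧ ∀ x, fInf K x ≤ A * Real.exp (-a * ‖x‖ ^ 2) := by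
  obtain ⟨P, hKP, hP⟩ := exists_factor hK
  have h3 : 0 < |P.det| := abs_pos.mpr hP.ne_zero
  refine ⟨|P.det|⁻¹ * (2 * Real.pi) ^ (-((d : ℝ) / 2)), (2 * (‖act P‖ ^ 2 + 1))⁻¹, by positivity,
    fun x => ?_⟩
  have h := fInf_act hKP hP (act P⁻¹ x)
  rw [act_act_inv hP] at h
  have h1 : fInf K x = |P.det|⁻¹ * (2 * Real.pi) ^ (-((d : ℝ) / 2)) *
      Real.exp (-‖act P⁻¹ x‖ ^ 2 / 2) := by
    rw [mul_assoc, ← h]; field_simp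
  rw [h1]
  have h2 : ‖x‖ ^ 2 ≤ (‖act P‖ ^ 2 + 1) * ‖act P⁻¹ x‖ ^ 2 := by
    have := (act P).le_opNorm (act P⁻¹ x)
    rw [act_act_inv hP] at this
    calc ‖x‖ ^ 2 ≤ (‖act P‖ * ‖act P⁻¹ x‖) ^ 2 := by gcongr
      _ ≤ _ := by rw [mul_pow]; gcongr; linarith
  gcongr
  rw [neg_mul, neg_div, neg_le_neg_iff, mul_inv, mul_assoc, inv_mul_le_iff₀ (by norm_num),
    inv_mul_le_iff₀ (by positivity)]
  linarith

theorem integrable_exp_neg_mul_norm_sq {a : ℝ} (ha : 0 < a) :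
    Integrable (fun x : E d => Real.exp (-a * ‖x‖ ^ 2)) := by
  have h := (GaussianFourier.integrable_cexp_neg_mul_sq_norm_add (V := E d) (b := (a : ℂ))
    (by simpa using ha) 0 0).norm
  refine h.congr (Filter.Eventually.of_forall fun x => ?_)
  simp only [Complex.norm_exp]
  congr 1
  simp
  left
  norm_cast

/-- All functions with at most quadratic growth are integrable against the Gaussian. -/
theorem integrable_quadratic_mul_fInf (hK : K.PosDef) :
    Integrable (fun x : E d => (1 + ‖x‖) ^ 2 * fInf K x) := by
  obtain ⟨A, a, ha, h⟩ := exists_fInf_le hK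
  refine Integrable.mono' ((integrable_exp_neg_mul_norm_sq (d := d) (half_pos ha)).const_mul
    ((2 + 4 / a) * A)) ?_ (Filter.Eventually.of_forall fun x => ?_)
  · have := continuous_fInf K
    exact Continuous.aestronglyMeasurable (by fun_prop)
  · have hf := fInf_pos hK x
    rw [Real.norm_of_nonneg (by positivity)]
    have h1 : (1 + ‖x‖) ^ 2 ≤ (2 + 4 / a) * Real.exp (a / 2 * ‖x‖ ^ 2) := by
      have e1 := Real.add_one_le_exp (a / 2 * ‖x‖ ^ 2)
      have e2 : (1 + ‖x‖) ^ 2 ≤ 2 + 2 * ‖x‖ ^ 2 := by nlinarith [sq_nonneg (1 - ‖x‖)]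
      have e3 : 2 + 2 * ‖x‖ ^ 2 ≤ (2 + 4 / a) * (a / 2 * ‖x‖ ^ 2 + 1) := by
        have : (2 + 4 / a) * (a / 2 * ‖x‖ ^ 2 + 1) =
          2 + 2 * ‖x‖ ^ 2 + (a * ‖x‖ ^ 2 + 4 / a) := by field_simp; ring
        have : 0 ≤ a * ‖x‖ ^ 2 + 4 / a := by positivity
        linarith
      calc _ ≤ _ := e2
        _ ≤ _ := e3
        _ ≤ _ := by gcongr
    have hA : 0 ≤ A := by
      have := hf.le.trans (h x)
      exact nonneg_of_mul_nonneg_left this (Real.exp_pos _)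
    calc (1 + ‖x‖) ^ 2 * fInf K x
        ≤ ((2 + 4 / a) * Real.exp (a / 2 * ‖x‖ ^ 2)) * (A * Real.exp (-a * ‖x‖ ^ 2)) := by
          gcongr; exact h x
      _ = (2 + 4 / a) * A * (Real.exp (a / 2 * ‖x‖ ^ 2) * Real.exp (-a * ‖x‖ ^ 2)) := by ring
      _ = _ := by rw [← Real.exp_add]; congr 2; ring

theorem integrable_fInf (hK : K.PosDef) : Integrable (fInf K) := by
  refine (integrable_quadratic_mul_fInf hK).mono' (continuous_fInf K).aestronglyMeasurable
    (Filter.Eventually.of_forall fun x => ?_)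
  have hf := fInf_pos hK x
  rw [Real.norm_of_nonneg hf.le]
  have : 1 ≤ (1 + ‖x‖) ^ 2 := by nlinarith [norm_nonneg x]
  nlinarith

/-- The characteristic function of the Gaussian with covariance `K`. -/
theorem integral_cexp_mul_fInf (hK : K.PosDef) (k : E d) :
    ∫ x, Complex.exp (Complex.I * (inner ℝ k x : ℝ)) * (fInf K x : ℂ) =
      Real.exp (-(inner ℝ k (act K k)) / 2) := by
  obtain ⟨P, hKP, hP⟩ := exists_factor hK
  have hsub := integral_image_eq_integral_abs_det_fderiv_smul volume (s := Set.univ)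
    (f := act P) (f' := fun _ => act P) MeasurableSet.univ
    (fun x _ => (act P).hasFDerivAt.hasFDerivWithinAt)
    (Function.LeftInverse.injective (act_inv_act hP)).injOn
    (fun x => Complex.exp (Complex.I * (inner ℝ k x : ℝ)) * (fInf K x : ℂ))
  have himg : act P '' Set.univ = Set.univ := by
    rw [Set.image_univ, Set.range_eq_univ]
    exact Function.RightInverse.surjective (act_act_inv hP)
  rw [himg, setIntegral_univ, setIntegral_univ] at hsub
  rw [hsub]
  have hint : ∀ y : E d, |(act P).det| • (Complex.exp (Complex.I * (inner ℝ k (act P y) : ℝ)) *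
      (fInf K (act P y) : ℂ)) = (((2 * Real.pi) ^ (-((d : ℝ) / 2)) : ℝ) : ℂ) *
      Complex.exp (-((1 / 2 : ℝ) : ℂ) * ‖y‖ ^ 2 +
        Complex.I * (inner ℝ (act P.transpose k) y : ℝ)) := by
    intro y
    have h := congrArg (fun r : ℝ => (r : ℂ)) (fInf_act hKP hP y)
    push_cast at h
    rw [act_det, inner_act_right, Complex.real_smul, mul_left_comm, h, Complex.exp_add]
    push_cast
    ring_nf
  simp_rw [hint]
  rw [integral_const_mul, GaussianFourier.integral_cexp_neg_mul_sq_norm_add (by norm_num),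
    finrank_euclideanSpace, Fintype.card_fin, hKP, inner_act_self_mul_transpose]
  have hpi : ((Real.pi : ℂ) / ((1 / 2 : ℝ) : ℂ)) ^ ((d : ℂ) / 2) =
      (((2 * Real.pi) ^ ((d : ℝ) / 2) : ℝ) : ℂ) := by
    rw [Complex.ofReal_cpow (by positivity)]
    push_cast
    congr 1
    ring
  rw [hpi, ← mul_assoc, ← Complex.ofReal_mul, ← Real.rpow_add (by positivity)]
  simp
  congr 1
  ring

/-- The trigonometric test functions `x ↦ cos (⟨k, x⟩ - θ)`. -/
noncomputable def trig (k : E d) (θ : ℝ) (x : E d) : ℝ := Real.cos (inner ℝ k x - θ)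

theorem continuous_trig (k : E d) (θ : ℝ) : Continuous (trig k θ) := by
  unfold trig; fun_prop

theorem abs_trig_le_one (k : E d) (θ : ℝ) (x : E d) : |trig k θ x| ≤ 1 := Real.abs_cos_le_one _

theorem integral_trig_mul_fInf (hK : K.PosDef) (k : E d) (θ : ℝ) :
    ∫ x, trig k θ x * fInf K x = Real.exp (-(inner ℝ k (act K k)) / 2) * Real.cos θ := by
  have hint : Integrable (fun x : E d =>
      Complex.exp (Complex.I * (inner ℝ k x : ℝ)) * (fInf K x : ℂ)) := by
    refine (integrable_fInf hK).mono' ?_ (Filter.Eventually.of_forall fun x => ?_)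
    · have := continuous_fInf K
      exact Continuous.aestronglyMeasurable (by fun_prop)
    · rw [norm_mul, mul_comm Complex.I, Complex.norm_exp_ofReal_mul_I, one_mul, Complex.norm_real,
        Real.norm_of_nonneg (fInf_pos hK x).le]
  have h1 : ∀ x : E d, trig k θ x * fInf K x = RCLike.re (Complex.exp (-(Complex.I * θ)) *
      (Complex.exp (Complex.I * (inner ℝ k x : ℝ)) * (fInf K x : ℂ))) := by
    intro x
    rw [← mul_assoc, ← Complex.exp_add]
    have : -(Complex.I * (θ : ℂ)) + Complex.I * ((inner ℝ k x : ℝ) : ℂ) =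
      ((inner ℝ k x - θ : ℝ) : ℂ) * Complex.I := by push_cast; ring
    rw [this]
    simp only [RCLike.re_eq_complex_re, Complex.re_mul_ofReal, Complex.exp_ofReal_mul_I_re, trig]
  simp_rw [h1]
  rw [integral_re (hint.const_mul _), integral_const_mul, integral_cexp_mul_fInf hK]
  have : -(Complex.I * (θ : ℂ)) = ((-θ : ℝ) : ℂ) * Complex.I := by push_cast; ring
  rw [this]
  simp only [RCLike.re_eq_complex_re, Complex.re_mul_ofReal, Complex.exp_ofReal_mul_I_re,
    Real.cos_neg]
  ring

end

/-! ### Test functions in the weighted Hilbert space -/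

section

variable {d : ℕ} {K : Mat d}

theorem measurable_ofReal_inv_fInf (K : Mat d) :
    Measurable (fun x : E d => ENNReal.ofReal (fInf K x)⁻¹) :=
  (continuous_fInf K).measurable.inv.ennreal_ofReal

theorem volume_absolutelyContinuous_weight (hK : K.PosDef) :
    (volume : Measure (E d)) ≪ weight K :=
  withDensity_absolutelyContinuous' (measurable_ofReal_inv_fInf K).aemeasurable
    (Filter.Eventually.of_forall fun x => by
      simpa using fInf_pos hK x)

theorem weight_absolutelyContinuous_volume : weight K ≪ (volume : Measure (E d)) :=
  withDensity_absolutelyContinuous _ _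

theorem integrable_weight_iff (hK : K.PosDef) {g : E d → ℝ} :
    Integrable g (weight K) ↔ Integrable (fun x => (fInf K x)⁻¹ * g x) := by
  rw [weight, integrable_withDensity_iff_integrable_smul' (measurable_ofReal_inv_fInf K)
    (Filter.Eventually.of_forall fun x => ENNReal.ofReal_lt_top)]
  have : ∀ x : E d, (ENNReal.ofReal (fInf K x)⁻¹).toReal = (fInf K x)⁻¹ := fun x =>
    ENNReal.toReal_ofReal (inv_nonneg.mpr (fInf_pos hK x).le)
  simp only [this, smul_eq_mul]

theorem integral_weight (hK : K.PosDef) (g : E d → ℝ) :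
    ∫ x, g x ∂weight K = ∫ x, (fInf K x)⁻¹ * g x := by
  rw [weight, integral_withDensity_eq_integral_toReal_smul (measurable_ofReal_inv_fInf K)
    (Filter.Eventually.of_forall fun x => ENNReal.ofReal_lt_top)]
  have : ∀ x : E d, (ENNReal.ofReal (fInf K x)⁻¹).toReal = (fInf K x)⁻¹ := fun x =>
    ENNReal.toReal_ofReal (inv_nonneg.mpr (fInf_pos hK x).le)
  simp only [this, smul_eq_mul]

/-- Continuous functions of at most linear growth, with an explicit constant. -/
def LinearGrowth (M : ℝ) (ψ : E d → ℝ) : Prop :=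
  Continuous ψ ∧ ∀ x, |ψ x| ≤ M * (1 + ‖x‖)

theorem LinearGrowth.mono {M M' : ℝ} {ψ : E d → ℝ} (h : LinearGrowth M ψ) (hM : M ≤ M') :
    LinearGrowth M' ψ :=
  ⟨h.1, fun x => (h.2 x).trans (by gcongr)⟩

theorem linearGrowth_of_bounded {M : ℝ} {ψ : E d → ℝ} (hc : Continuous ψ) (h : ∀ x, |ψ x| ≤ M) :
    LinearGrowth M ψ := by
  refine ⟨hc, fun x => (h x).trans ?_⟩
  have hM : 0 ≤ M := (abs_nonneg _).trans (h x)
  nlinarith [norm_nonneg x]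

theorem linearGrowth_trig (k : E d) (θ : ℝ) : LinearGrowth 1 (trig k θ) :=
  linearGrowth_of_bounded (continuous_trig k θ) (abs_trig_le_one k θ)

theorem LinearGrowth.nonneg {M : ℝ} {ψ : E d → ℝ} (h : LinearGrowth M ψ) : 0 ≤ M := by
  have := (abs_nonneg _).trans (h.2 0)
  simpa using this

theorem LinearGrowth.integrable_mul {M N : ℝ} {ψ χ : E d → ℝ} (hK : K.PosDef)
    (hψ : LinearGrowth M ψ) (hχ : LinearGrowth N χ) :
    Integrable (fun x => ψ x * χ x * fInf K x) := by
  refine ((integrable_quadratic_mul_fInf hK).const_mul (M * N)).mono'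
    ((hψ.1.mul hχ.1).mul (continuous_fInf K)).aestronglyMeasurable
    (Filter.Eventually.of_forall fun x => ?_)
  have hf := fInf_pos hK x
  rw [norm_mul, norm_mul, Real.norm_eq_abs, Real.norm_eq_abs, Real.norm_of_nonneg hf.le]
  have hM := hψ.nonneg
  calc |ψ x| * |χ x| * fInf K x ≤ (M * (1 + ‖x‖)) * (N * (1 + ‖x‖)) * fInf K x := by
        gcongr
        · exact hψ.2 x
        · exact hχ.2 x
    _ = _ := by ring

theorem LinearGrowth.memLp {M : ℝ} {ψ : E d → ℝ} (hK : K.PosDef) (hψ : LinearGrowth M ψ) :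
    MemLp (fun x => ψ x * fInf K x) 2 (weight K) := by
  have hc : Continuous fun x => ψ x * fInf K x := hψ.1.mul (continuous_fInf K)
  rw [memLp_two_iff_integrable_sq hc.aestronglyMeasurable, integrable_weight_iff hK]
  refine (hψ.integrable_mul hK hψ).congr (Filter.Eventually.of_forall fun x => ?_)
  have hf := (fInf_pos hK x).ne'
  field_simp

open Classical in
/-- The element `ψ f_∞` of the Hilbert space, for a test function `ψ`; it represents the functional
`f ↦ ∫ f ψ dx`. The value is zero if `ψ f_∞` is not square integrable. -/
noncomputable def lift (K : Mat d) (ψ : E d → ℝ) : H K :=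
  if h : MemLp (fun x => ψ x * fInf K x) 2 (weight K) then h.toLp _ else 0

theorem LinearGrowth.coeFn_lift {M : ℝ} {ψ : E d → ℝ} (hK : K.PosDef) (hψ : LinearGrowth M ψ) :
    (lift K ψ : E d → ℝ) =ᵐ[weight K] fun x => ψ x * fInf K x := by
  rw [lift, dif_pos (hψ.memLp hK)]
  exact MemLp.coeFn_toLp _

theorem LinearGrowth.integrable {M : ℝ} {ψ : E d → ℝ} (hK : K.PosDef) (hψ : LinearGrowth M ψ)
    (f : H K) : Integrable (fun x => (f : E d → ℝ) x * ψ x) := by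
  have h := (integrable_weight_iff hK).mp ((Lp.memLp f).integrable_mul (hψ.memLp hK))
  refine h.congr (Filter.Eventually.of_forall fun x => ?_)
  have hf := (fInf_pos hK x).ne'
  simp only [Pi.mul_apply]
  field_simp

theorem LinearGrowth.inner_lift {M : ℝ} {ψ : E d → ℝ} (hK : K.PosDef) (hψ : LinearGrowth M ψ)
    (f : H K) : inner ℝ (lift K ψ) f = ∫ x, (f : E d → ℝ) x * ψ x := by
  rw [L2.inner_def]
  have h : (fun x => inner ℝ ((lift K ψ : E d → ℝ) x) ((f : E d → ℝ) x)) =ᵐ[weight K]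
      fun x => (f : E d → ℝ) x * (ψ x * fInf K x) := by
    filter_upwards [hψ.coeFn_lift hK] with x hx
    rw [hx]; simp
  rw [integral_congr_ae h, integral_weight hK]
  refine integral_congr_ae (Filter.Eventually.of_forall fun x => ?_)
  have hf := (fInf_pos hK x).ne'
  simp only []
  field_simp

theorem LinearGrowth.inner_lift_lift {M N : ℝ} {ψ χ : E d → ℝ} (hK : K.PosDef)
    (hψ : LinearGrowth M ψ) (hχ : LinearGrowth N χ) :
    inner ℝ (lift K ψ) (lift K χ) = ∫ x, ψ x * χ x * fInf K x := by
  rw [hψ.inner_lift hK]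
  refine integral_congr_ae ?_
  filter_upwards [(volume_absolutelyContinuous_weight hK).ae_eq (hχ.coeFn_lift hK)] with x hx
  rw [hx]; ring

/-- The square root of `∫ (1 + |x|)² f_∞ dx`. -/
noncomputable def momentConst (K : Mat d) : ℝ := Real.sqrt (∫ x, (1 + ‖x‖) ^ 2 * fInf K x)

theorem momentConst_nonneg (K : Mat d) : 0 ≤ momentConst K := Real.sqrt_nonneg _

/-- The functional `f ↦ ∫ f ψ dx` is bounded, uniformly over test functions with the same linear
growth constant. -/
theorem LinearGrowth.norm_lift_le {M : ℝ} {ψ : E d → ℝ} (hK : K.PosDef) (hψ : LinearGrowth M ψ) :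
    ‖lift K ψ‖ ≤ M * momentConst K := by
  have h0 : 0 ≤ ∫ x : E d, (1 + ‖x‖) ^ 2 * fInf K x :=
    integral_nonneg fun x => mul_nonneg (sq_nonneg _) (fInf_pos hK x).le
  refine le_of_sq_le_sq ?_ (mul_nonneg hψ.nonneg (momentConst_nonneg K))
  rw [← real_inner_self_eq_norm_sq, hψ.inner_lift_lift hK hψ, mul_pow, momentConst,
    Real.sq_sqrt h0, ← integral_const_mul]
  refine integral_mono (hψ.integrable_mul hK hψ)
    ((integrable_quadratic_mul_fInf hK).const_mul _) fun x => ?_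
  have hf := fInf_pos hK x
  have := hψ.2 x
  calc ψ x * ψ x * fInf K x = |ψ x| ^ 2 * fInf K x := by rw [sq_abs]; ring
    _ ≤ (M * (1 + ‖x‖)) ^ 2 * fInf K x := by gcongr
    _ = _ := by ring

theorem LinearGrowth.abs_integral_le {M : ℝ} {ψ : E d → ℝ} (hK : K.PosDef)
    (hψ : LinearGrowth M ψ) (f : H K) :
    |∫ x, (f : E d → ℝ) x * ψ x| ≤ M * momentConst K * ‖f‖ := by
  rw [← hψ.inner_lift hK]
  exact (abs_real_inner_le_norm _ _).trans (by gcongr; exact hψ.norm_lift_le hK)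

/-- The Fourier transform is injective on `L¹`: a function all of whose cosine transforms with
arbitrary phase vanish is zero almost everywhere. -/
theorem ae_eq_zero_of_integral_trig_eq_zero {f : E d → ℝ} (hf : Integrable f)
    (h : ∀ k θ, ∫ x, f x * trig k θ x = 0) : f =ᵐ[volume] 0 := by
  -- the positive and negative parts of `f` are densities of finite measures with the same
  -- characteristic function
  have hfin := isFiniteMeasure_withDensity_ofReal hf.2
  have hfin' := isFiniteMeasure_withDensity_ofReal hf.neg.2
  have key : (volume : Measure (E d)).withDensity (fun x => ENNReal.ofReal (f x)) =
      volume.withDensity (fun x => ENNReal.ofReal ((-f) x)) := by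
    refine Measure.ext_of_charFun (funext fun t => ?_)
    have hexp : ∀ g : E d → ℝ, Integrable g → Integrable fun x =>
        ((ENNReal.ofReal (g x)).toReal) • Complex.exp ((inner ℝ x t : ℝ) * Complex.I) := by
      intro g hg
      have hc : Continuous fun x : E d => Complex.exp ((inner ℝ x t : ℝ) * Complex.I) := by
        fun_prop
      refine hg.pos_part.mono' ?_ (Filter.Eventually.of_forall fun x => ?_)
      · have hm : AEStronglyMeasurable (fun x => (ENNReal.ofReal (g x)).toReal) volume :=
          hg.1.aemeasurable.ennreal_ofReal.ennreal_toReal.aestronglyMeasurable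
        exact hm.smul hc.aestronglyMeasurable
      · rw [norm_smul, Complex.norm_exp_ofReal_mul_I, mul_one, ENNReal.toReal_ofReal',
          Real.norm_of_nonneg (le_max_right _ _)]
    have hcf : ∀ g : E d → ℝ, Integrable g →
        charFun (volume.withDensity (fun x => ENNReal.ofReal (g x))) t =
        ∫ x, ((ENNReal.ofReal (g x)).toReal) • Complex.exp ((inner ℝ x t : ℝ) * Complex.I) := by
      intro g hg
      rw [charFun_apply, integral_withDensity_eq_integral_toReal_smul₀
        hg.1.aemeasurable.ennreal_ofReal
        (Filter.Eventually.of_forall fun x => ENNReal.ofReal_lt_top)]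
    rw [hcf f hf, hcf (-f) hf.neg, ← sub_eq_zero, ← integral_sub (hexp f hf) (hexp _ hf.neg)]
    have hpt : ∀ x, (ENNReal.ofReal (f x)).toReal • Complex.exp ((inner ℝ x t : ℝ) * Complex.I) -
        (ENNReal.ofReal ((-f) x)).toReal • Complex.exp ((inner ℝ x t : ℝ) * Complex.I) =
        ((f x * trig t 0 x : ℝ) : ℂ) + ((f x * trig t (Real.pi / 2) x : ℝ) : ℂ) * Complex.I := by
      intro x
      rw [← sub_smul, ENNReal.toReal_ofReal', ENNReal.toReal_ofReal', Pi.neg_apply,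
        max_zero_sub_max_neg_zero_eq_self, Complex.exp_mul_I, Complex.real_smul, trig, trig,
        Real.cos_sub_pi_div_two, real_inner_comm t x]
      push_cast
      simp
      ring
    have ht : ∀ θ, Integrable fun x => f x * trig t θ x := fun θ =>
      hf.mul_bdd (c := 1) (continuous_trig t θ).aestronglyMeasurable
        (Filter.Eventually.of_forall (abs_trig_le_one t θ))
    simp_rw [hpt]
    rw [integral_add (ht 0).ofReal ((ht _).ofReal.mul_const _), integral_mul_const,
      integral_complex_ofReal, integral_complex_ofReal, h, h]
    simp
  have hae := (withDensity_eq_iff_of_sigmaFinite hf.1.aemeasurable.ennreal_ofReal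
    hf.neg.1.aemeasurable.ennreal_ofReal).mp key
  filter_upwards [hae] with x hx
  have hx' := congrArg ENNReal.toReal hx
  rw [ENNReal.toReal_ofReal', ENNReal.toReal_ofReal', Pi.neg_apply, ← sub_eq_zero,
    max_zero_sub_max_neg_zero_eq_self] at hx'
  exact hx'

/-- The functions `trig k θ · f_∞` are total in the Hilbert space. -/
theorem eq_zero_of_integral_trig_eq_zero (hK : K.PosDef) {f : H K}
    (h : ∀ k θ, ∫ x, (f : E d → ℝ) x * trig k θ x = 0) : f = 0 := by
  have h1 : Integrable (f : E d → ℝ) := by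
    have := (linearGrowth_of_bounded (M := 1) (ψ := fun _ : E d => (1 : ℝ)) continuous_const
      (by simp)).integrable hK f
    simpa using this
  rw [Lp.eq_zero_iff_ae_eq_zero]
  exact weight_absolutelyContinuous_volume.ae_eq (ae_eq_zero_of_integral_trig_eq_zero h1 h)

end

/-! ### Waves and second quantisation -/

section

section Kernels

open Matrix

variable {ι : Type*}

/-- Positive semi-definite kernels on a possibly infinite set are closed under entrywise limits of
sums. -/
theorem posSemidef_of_hasSum {A : ℕ → Matrix ι ι ℝ} {B : Matrix ι ι ℝ}
    (hA : ∀ n, (A n).PosSemidef) (hB : ∀ i j, HasSum (fun n => A n i j) (B i j)) :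
    B.PosSemidef := by
  refine ⟨?_, fun x => ?_⟩
  · ext i j
    refine (hB j i).unique (((hB i j).congr_fun fun n => ?_))
    exact (hA n).isHermitian.apply i j
  · have h : HasSum (fun n => x.sum fun i xi => x.sum fun j xj => star xi * A n i j * xj)
        (x.sum fun i xi => x.sum fun j xj => star xi * B i j * xj) :=
      hasSum_sum fun i _ => hasSum_sum fun j _ => ((hB i j).mul_left _).mul_right _
    exact h.nonneg fun n => (hA n).2 x

/-- The kernel `(i, j) ↦ u i * u j`. -/
theorem posSemidef_mul_self (u : ι → ℝ) : (Matrix.of fun i j => u i * u j).PosSemidef := by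
  refine ⟨by ext i j; simp [mul_comm], fun x => ?_⟩
  have : (x.sum fun i xi => x.sum fun j xj =>
      star xi * (Matrix.of fun i j => u i * u j) i j * xj) = (x.sum fun i xi => xi * u i) ^ 2 := by
    rw [sq, Finsupp.sum, Finsupp.sum, Finset.sum_mul_sum]
    refine Finset.sum_congr rfl fun i _ => Finset.sum_congr rfl fun j _ => ?_
    simp; ring
  rw [this]; positivity

theorem _root_.Matrix.PosSemidef.of_eq {p q : ι → ι → ℝ} (hp : (Matrix.of p).PosSemidef)
    (h : ∀ i j, p i j = q i j) : (Matrix.of q).PosSemidef := by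
  have : p = q := funext fun i => funext fun j => h i j
  rwa [← this]

/-- The Schur product theorem for kernels. -/
theorem posSemidef_mul {p q : ι → ι → ℝ} (hp : (Matrix.of p).PosSemidef)
    (hq : (Matrix.of q).PosSemidef) : (Matrix.of fun i j => p i j * q i j).PosSemidef :=
  hp.hadamard hq

theorem posSemidef_const_mul {p : ι → ι → ℝ} (hp : (Matrix.of p).PosSemidef) {a : ℝ}
    (ha : 0 ≤ a) : (Matrix.of fun i j => a * p i j).PosSemidef :=
  hp.smul ha

theorem posSemidef_add {p q : ι → ι → ℝ} (hp : (Matrix.of p).PosSemidef)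
    (hq : (Matrix.of q).PosSemidef) : (Matrix.of fun i j => p i j + q i j).PosSemidef :=
  hp.add hq

theorem posSemidef_zero : (Matrix.of fun _ _ : ι => (0 : ℝ)).PosSemidef :=
  Matrix.PosSemidef.zero

theorem posSemidef_pow {p : ι → ι → ℝ} (hp : (Matrix.of p).PosSemidef) (n : ℕ) :
    (Matrix.of fun i j => p i j ^ n).PosSemidef := by
  induction n with
  | zero => simpa using posSemidef_mul_self (fun _ : ι => (1 : ℝ))
  | succ n ih => exact (posSemidef_mul ih hp).of_eq fun i j => (pow_succ _ _).symm

theorem posSemidef_pow_sub_pow {p p' : ι → ι → ℝ} (hp : (Matrix.of p).PosSemidef)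
    (hp' : (Matrix.of p').PosSemidef) (h : (Matrix.of fun i j => p i j - p' i j).PosSemidef)
    (n : ℕ) : (Matrix.of fun i j => p i j ^ n - p' i j ^ n).PosSemidef := by
  induction n with
  | zero => exact posSemidef_zero.of_eq fun i j => by simp
  | succ n ih =>
    exact (posSemidef_add (posSemidef_mul ih hp) (posSemidef_mul (posSemidef_pow hp' n) h)).of_eq
      fun i j => by ring

/-- Termwise comparison in the exponential series: the `n`-th powers of a kernel `p'` dominated by
`r² p` are dominated by `r^{2n} pⁿ`, hence by `r² pⁿ` as soon as `n ≥ 1`. -/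
theorem posSemidef_mul_pow_sub_pow {p p' : ι → ι → ℝ} {r : ℝ} (h0 : 0 ≤ r) (h1 : r ≤ 1)
    (hp : (Matrix.of p).PosSemidef) (hp' : (Matrix.of p').PosSemidef)
    (h : (Matrix.of fun i j => r ^ 2 * p i j - p' i j).PosSemidef) {n : ℕ} (hn : n ≠ 0) :
    (Matrix.of fun i j => r ^ 2 * p i j ^ n - p' i j ^ n).PosSemidef := by
  have e2 := posSemidef_pow_sub_pow (posSemidef_const_mul hp (sq_nonneg r)) hp' h n
  have hr : 0 ≤ r ^ 2 - (r ^ 2) ^ n := by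
    have : (r ^ 2) ^ n ≤ r ^ 2 := pow_le_of_le_one (sq_nonneg r) (pow_le_one₀ h0 h1) hn
    linarith
  exact (posSemidef_add e2 (posSemidef_const_mul (posSemidef_pow hp n) hr)).of_eq
    fun i j => by ring

/-- Comparison of the Gram kernels of waves before (`p`) and after (`p'`) transforming the wave
vectors. Only the constant term of the `cosh` series is not contracted by `r²`, which the summand
with the factor `1 - r²` compensates. -/
theorem posSemidef_cosh_sinh {p p' : ι → ι → ℝ} {r : ℝ} (h0 : 0 ≤ r) (h1 : r ≤ 1)
    (hp : (Matrix.of p).PosSemidef) (hp' : (Matrix.of p').PosSemidef)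
    (h : (Matrix.of fun i j => r ^ 2 * p i j - p' i j).PosSemidef) (u v : ι → ℝ) :
    (Matrix.of fun i j =>
      r ^ 2 * (Real.cosh (p i j) * (u i * u j) + Real.sinh (p i j) * (v i * v j)) +
        (1 - r ^ 2) * (u i * u j) -
      (Real.cosh (p' i j) * (u i * u j) + Real.sinh (p' i j) * (v i * v j))).PosSemidef := by
  have even : (Matrix.of fun i j => (r ^ 2 * Real.cosh (p i j) - Real.cosh (p' i j) +
      (1 - r ^ 2)) * (u i * u j)).PosSemidef := by
    refine posSemidef_of_hasSum (A := fun n => Matrix.of fun i j =>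
      ((r ^ 2 * (p i j ^ (2 * n) / (2 * n).factorial) - p' i j ^ (2 * n) / (2 * n).factorial) +
        if n = 0 then (1 - r ^ 2) else 0) * (u i * u j)) (fun n => ?_) fun i j => ?_
    · rcases Nat.eq_zero_or_pos n with rfl | hn
      · exact posSemidef_zero.of_eq fun i j => by simp
      · exact (posSemidef_mul (posSemidef_const_mul
          (posSemidef_mul_pow_sub_pow h0 h1 hp hp' h (n := 2 * n) (by omega))
          (a := ((2 * n).factorial : ℝ)⁻¹) (by positivity)) (posSemidef_mul_self u)).of_eq
          fun i j => by simp only [hn.ne', if_false]; ring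
    · exact ((((Real.hasSum_cosh _).mul_left _).sub (Real.hasSum_cosh _)).add
        (hasSum_ite_eq 0 _)).mul_right _
  have odd : (Matrix.of fun i j => (r ^ 2 * Real.sinh (p i j) - Real.sinh (p' i j)) *
      (v i * v j)).PosSemidef := by
    refine posSemidef_of_hasSum (A := fun n => Matrix.of fun i j =>
      (r ^ 2 * (p i j ^ (2 * n + 1) / (2 * n + 1).factorial) -
        p' i j ^ (2 * n + 1) / (2 * n + 1).factorial) * (v i * v j)) (fun n => ?_) fun i j => ?_
    · exact (posSemidef_mul (posSemidef_const_mul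
        (posSemidef_mul_pow_sub_pow h0 h1 hp hp' h (n := 2 * n + 1) (by omega))
        (a := ((2 * n + 1).factorial : ℝ)⁻¹) (by positivity)) (posSemidef_mul_self v)).of_eq
        fun i j => by ring
    · exact (((Real.hasSum_sinh _).mul_left _).sub (Real.hasSum_sinh _)).mul_right _
  exact (posSemidef_add even odd).of_eq fun i j => by ring

theorem posSemidef_inner {V : Type*} [NormedAddCommGroup V] [InnerProductSpace ℝ V]
    (T : V →L[ℝ] V) (hT : ∀ x y, inner ℝ x (T y) = inner ℝ y (T x))
    (hpos : ∀ x, 0 ≤ inner ℝ x (T x)) (a : ι → V) :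
    (Matrix.of fun i j => inner ℝ (a i) (T (a j))).PosSemidef := by
  refine ⟨by ext i j; simp [hT (a i) (a j)], fun x => ?_⟩
  refine (hpos (x.sum fun i xi => xi • a i)).trans_eq ?_
  simp only [Finsupp.sum, map_sum, sum_inner, inner_sum, map_smul, real_inner_smul_left,
    real_inner_smul_right]
  refine Finset.sum_congr rfl fun i _ => Finset.sum_congr rfl fun j _ => ?_
  simp only [star_trivial, Matrix.of_apply, hT (a i) (a j)]
  ring

end Kernels

variable {d : ℕ} {K : Mat d}

/-- The multiple of `cos (⟨k, x⟩ - θ) f_∞(x)` whose Gram matrix is the Fock space kernel of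
`inner_wave_wave`. -/
noncomputable def wave (K : Mat d) (k : E d) (θ : ℝ) : H K :=
  Real.exp (inner ℝ k (act K k) / 2) • lift K (trig k θ)

theorem trig_mul_trig (k l : E d) (θ η : ℝ) (x : E d) :
    trig k θ x * trig l η x =
      (1 / 2) * trig (k - l) (θ - η) x + (1 / 2) * trig (k + l) (θ + η) x := by
  have e1 : inner ℝ (k - l) x - (θ - η) = (inner ℝ k x - θ) - (inner ℝ l x - η) := by
    rw [inner_sub_left]; ring
  have e2 : inner ℝ (k + l) x - (θ + η) = (inner ℝ k x - θ) + (inner ℝ l x - η) := by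
    rw [inner_add_left]; ring
  rw [trig, trig, trig, trig, e1, e2, Real.cos_sub (_ - _), Real.cos_add (_ - _)]
  ring

theorem inner_act_symm (hK : K.PosDef) (k l : E d) :
    inner ℝ k (act K l) = inner ℝ l (act K k) := by
  rw [inner_act_right, transpose_eq_of_posDef hK, real_inner_comm]

/-- The inner product of two waves depends on their wave vectors only through `⟨k, K l⟩`, and is a
power series in this number with nonnegative kernels as coefficients. -/
theorem inner_wave_wave (hK : K.PosDef) (k l : E d) (θ η : ℝ) :
    inner ℝ (wave K k θ) (wave K l η) =
      Real.cosh (inner ℝ k (act K l)) * (Real.cos θ * Real.cos η) +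
        Real.sinh (inner ℝ k (act K l)) * (Real.sin θ * Real.sin η) := by
  have hint : ∀ (k : E d) (θ : ℝ), Integrable fun x => trig k θ x * fInf K x := fun k θ => by
    simpa using (linearGrowth_trig k θ).integrable_mul hK
      (linearGrowth_of_bounded (M := 1) (ψ := fun _ : E d => (1 : ℝ)) continuous_const (by simp))
  rw [wave, wave, real_inner_smul_left, real_inner_smul_right,
    (linearGrowth_trig k θ).inner_lift_lift hK (linearGrowth_trig l η)]
  simp_rw [trig_mul_trig, add_mul, mul_assoc]
  rw [integral_add ((hint _ _).const_mul _) ((hint _ _).const_mul _), integral_const_mul,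
    integral_const_mul, integral_trig_mul_fInf hK, integral_trig_mul_fInf hK]
  have e1 : inner ℝ (k - l) (act K (k - l)) = inner ℝ k (act K k) + inner ℝ l (act K l) -
      2 * inner ℝ k (act K l) := by
    rw [map_sub, inner_sub_left, inner_sub_right, inner_sub_right, inner_act_symm hK l k]; ring
  have e2 : inner ℝ (k + l) (act K (k + l)) = inner ℝ k (act K k) + inner ℝ l (act K l) +
      2 * inner ℝ k (act K l) := by
    rw [map_add, inner_add_left, inner_add_right, inner_add_right, inner_act_symm hK l k]; ring
  rw [e1, e2]
  set a := inner ℝ k (act K k)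
  set b := inner ℝ l (act K l)
  set c := inner ℝ k (act K l)
  have x1 : Real.exp (-(a + b - 2 * c) / 2) =
      (Real.exp (a / 2))⁻¹ * (Real.exp (b / 2))⁻¹ * Real.exp c := by
    rw [← Real.exp_neg, ← Real.exp_neg, ← Real.exp_add, ← Real.exp_add]; congr 1; ring
  have x2 : Real.exp (-(a + b + 2 * c) / 2) =
      (Real.exp (a / 2))⁻¹ * (Real.exp (b / 2))⁻¹ * Real.exp (-c) := by
    rw [← Real.exp_neg, ← Real.exp_neg, ← Real.exp_add, ← Real.exp_add]; congr 1; ring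
  rw [x1, x2, Real.cosh_eq, Real.sinh_eq, Real.cos_sub, Real.cos_add]
  have := (Real.exp_pos (a / 2)).ne'
  have := (Real.exp_pos (b / 2)).ne'
  field_simp
  ring

theorem inner_wave (hK : K.PosDef) (k : E d) (θ : ℝ) (f : H K) :
    inner ℝ (wave K k θ) f =
      Real.exp (inner ℝ k (act K k) / 2) * ∫ x, (f : E d → ℝ) x * trig k θ x := by
  rw [wave, real_inner_smul_left, (linearGrowth_trig k θ).inner_lift hK]

/-- The linear map sending a finitely supported family of coefficients to the corresponding
combination of waves with wave vectors transformed by `B`. -/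
noncomputable def waveComb (K : Mat d) (B : E d →L[ℝ] E d) : ((E d × ℝ) →₀ ℝ) →ₗ[ℝ] H K :=
  Finsupp.linearCombination ℝ fun p : E d × ℝ => wave K (B p.1) p.2

theorem denseRange_waveComb (hK : K.PosDef) :
    DenseRange (waveComb K (ContinuousLinearMap.id ℝ (E d))) := by
  have h : (LinearMap.range (waveComb K (ContinuousLinearMap.id ℝ (E d)))).topologicalClosure =
      ⊤ := by
    rw [Submodule.topologicalClosure_eq_top_iff, Submodule.eq_bot_iff]
    intro f hf
    refine eq_zero_of_integral_trig_eq_zero hK fun k θ => ?_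
    have h1 := (Submodule.mem_orthogonal _ f).mp hf (wave K k θ)
      ⟨Finsupp.single (k, θ) 1, by simp [waveComb]⟩
    rw [inner_wave hK] at h1
    exact (mul_eq_zero.mp h1).resolve_left (Real.exp_pos _).ne'
  exact Submodule.dense_iff_topologicalClosure_eq_top.mpr h

theorem norm_sq_waveComb (hK : K.PosDef) (B : E d →L[ℝ] E d) (h : (E d × ℝ) →₀ ℝ) :
    ‖waveComb K B h‖ ^ 2 = h.sum fun i xi => h.sum fun j xj => xi *
      (Real.cosh (inner ℝ (B i.1) (act K (B j.1))) * (Real.cos i.2 * Real.cos j.2) +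
        Real.sinh (inner ℝ (B i.1) (act K (B j.1))) * (Real.sin i.2 * Real.sin j.2)) * xj := by
  rw [← real_inner_self_eq_norm_sq, waveComb, Finsupp.linearCombination_apply]
  simp only [Finsupp.sum, sum_inner, inner_sum, real_inner_smul_left,
    real_inner_smul_right, inner_wave_wave hK]
  rw [Finset.sum_comm]
  refine Finset.sum_congr rfl fun i _ => Finset.sum_congr rfl fun j _ => ?_
  ring

theorem inner_wave_zero_waveComb (hK : K.PosDef) (B : E d →L[ℝ] E d) (h : (E d × ℝ) →₀ ℝ) :
    inner ℝ (wave K 0 0) (waveComb K B h) = h.sum fun i xi => xi * Real.cos i.2 := by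
  rw [waveComb, Finsupp.linearCombination_apply]
  simp only [Finsupp.sum, inner_sum, real_inner_smul_right, inner_wave_wave hK]
  simp

/-- If `B` contracts the quadratic form of `K` by `r²`, replacing all wave vectors `k` by `B k`
contracts the part orthogonal to the steady state `wave K 0 0` by `r`. -/
theorem norm_sq_waveComb_le (hK : K.PosDef) {B : E d →L[ℝ] E d} {r : ℝ} (h0 : 0 ≤ r) (h1 : r ≤ 1)
    (hB : ∀ k, inner ℝ (B k) (act K (B k)) ≤ r ^ 2 * inner ℝ k (act K k))
    (h : (E d × ℝ) →₀ ℝ) :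
    ‖waveComb K B h‖ ^ 2 ≤ r ^ 2 * ‖waveComb K (ContinuousLinearMap.id ℝ (E d)) h‖ ^ 2 +
      (1 - r ^ 2) *
        inner ℝ (wave K 0 0) (waveComb K (ContinuousLinearMap.id ℝ (E d)) h) ^ 2 := by
  have p1 := posSemidef_inner (act K) (inner_act_symm hK) (inner_act_nonneg hK.posSemidef)
    (fun i : E d × ℝ => i.1)
  have p2 := posSemidef_inner (act K) (inner_act_symm hK) (inner_act_nonneg hK.posSemidef)
    (fun i : E d × ℝ => B i.1)
  have p3 := posSemidef_inner (r ^ 2 • act K - (ContinuousLinearMap.adjoint B) ∘L act K ∘L B)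
    (fun x y => by
      simp [inner_sub_right, real_inner_smul_right, ContinuousLinearMap.adjoint_inner_right,
        inner_act_symm hK x y, inner_act_symm hK (B x) (B y)])
    (fun x => by
      simpa [inner_sub_right, real_inner_smul_right, ContinuousLinearMap.adjoint_inner_right]
        using hB x)
    (fun i : E d × ℝ => i.1)
  have key := (posSemidef_cosh_sinh h0 h1 p1 p2 (by
    refine p3.of_eq fun i j => ?_
    simp [inner_sub_right, real_inner_smul_right, ContinuousLinearMap.adjoint_inner_right])
    (fun i => Real.cos i.2) (fun i => Real.sin i.2)).2 h
  rw [norm_sq_waveComb hK, norm_sq_waveComb hK, inner_wave_zero_waveComb hK]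
  refine sub_nonneg.mp (key.trans_eq ?_)
  simp only [Finsupp.sum]
  rw [sq (∑ i ∈ h.support, h i * Real.cos i.2), Finset.sum_mul_sum]
  simp only [Finset.mul_sum, ← Finset.sum_add_distrib, ← Finset.sum_sub_distrib]
  refine Finset.sum_congr rfl fun i _ => Finset.sum_congr rfl fun j _ => ?_
  simp
  ring

theorem norm_waveComb_le (hK : K.PosDef) {B : E d →L[ℝ] E d}
    (hB : ∀ k, inner ℝ (B k) (act K (B k)) ≤ inner ℝ k (act K k)) (h : (E d × ℝ) →₀ ℝ) :
    ‖waveComb K B h‖ ≤ 1 * ‖waveComb K (ContinuousLinearMap.id ℝ (E d)) h‖ := by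
  have := norm_sq_waveComb_le hK zero_le_one le_rfl (B := B) (by simpa using hB) h
  rw [one_mul]
  exact le_of_sq_le_sq (by simpa using this) (norm_nonneg _)

/-- The second quantisation of `B`: the bounded operator mapping the wave with wave vector `k` to
the wave with wave vector `B k`. It is only meaningful if `B` is a contraction for the quadratic
form of `K`. -/
noncomputable def secondQuant (K : Mat d) (B : E d →L[ℝ] E d) : H K →L[ℝ] H K :=
  (waveComb K B).extendOfNorm (waveComb K (ContinuousLinearMap.id ℝ (E d)))

theorem secondQuant_waveComb (hK : K.PosDef) {B : E d →L[ℝ] E d}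
    (hB : ∀ k, inner ℝ (B k) (act K (B k)) ≤ inner ℝ k (act K k)) (h : (E d × ℝ) →₀ ℝ) :
    secondQuant K B (waveComb K (ContinuousLinearMap.id ℝ (E d)) h) = waveComb K B h :=
  LinearMap.extendOfNorm_eq (denseRange_waveComb hK) ⟨1, norm_waveComb_le hK hB⟩ h

theorem norm_secondQuant_le (hK : K.PosDef) {B : E d →L[ℝ] E d}
    (hB : ∀ k, inner ℝ (B k) (act K (B k)) ≤ inner ℝ k (act K k)) (f : H K) :
    ‖secondQuant K B f‖ ≤ ‖f‖ := by
  have := LinearMap.norm_extendOfNorm_apply_le (denseRange_waveComb hK) 1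
    (norm_waveComb_le hK hB) f
  rwa [one_mul] at this

/-- If `B` contracts the quadratic form of `K` by the factor `r²`, then its second quantisation
contracts the orthogonal complement of the steady state by the factor `r`. -/
theorem norm_sq_secondQuant_le (hK : K.PosDef) {B : E d →L[ℝ] E d} {r : ℝ} (h0 : 0 ≤ r)
    (h1 : r ≤ 1) (hB : ∀ k, inner ℝ (B k) (act K (B k)) ≤ r ^ 2 * inner ℝ k (act K k))
    (f : H K) :
    ‖secondQuant K B f‖ ^ 2 ≤ r ^ 2 * ‖f‖ ^ 2 + (1 - r ^ 2) * inner ℝ (wave K 0 0) f ^ 2 := by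
  have hB' : ∀ k, inner ℝ (B k) (act K (B k)) ≤ inner ℝ k (act K k) := fun k =>
    (hB k).trans (mul_le_of_le_one_left (inner_act_nonneg hK.posSemidef k) (pow_le_one₀ h0 h1))
  refine (denseRange_waveComb hK).induction_on (p := fun f => ‖secondQuant K B f‖ ^ 2 ≤
    r ^ 2 * ‖f‖ ^ 2 + (1 - r ^ 2) * inner ℝ (wave K 0 0) f ^ 2) f
    (isClosed_le (by fun_prop) (by fun_prop)) fun h => ?_
  rw [secondQuant_waveComb hK hB']
  exact norm_sq_waveComb_le hK h0 h1 hB h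

/-- The adjoint of the second quantisation of `B` is the second quantisation of the adjoint `B'` of
`B` for the inner product given by `K`. -/
theorem inner_secondQuant_wave (hK : K.PosDef) {B B' : E d →L[ℝ] E d}
    (hB : ∀ k, inner ℝ (B k) (act K (B k)) ≤ inner ℝ k (act K k))
    (hBB' : ∀ k l, inner ℝ (B k) (act K l) = inner ℝ k (act K (B' l))) (f : H K) (l : E d) (θ : ℝ) :
    inner ℝ (wave K l θ) (secondQuant K B f) = inner ℝ (wave K (B' l) θ) f := by
  refine (denseRange_waveComb hK).induction_on (p := fun f =>
    inner ℝ (wave K l θ) (secondQuant K B f) = inner ℝ (wave K (B' l) θ) f) f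
    (isClosed_eq (by fun_prop) (by fun_prop)) fun h => ?_
  rw [secondQuant_waveComb hK hB, waveComb, waveComb, Finsupp.linearCombination_apply,
    Finsupp.linearCombination_apply]
  simp only [Finsupp.sum, inner_sum, real_inner_smul_right, inner_wave_wave hK]
  refine Finset.sum_congr rfl fun i _ => ?_
  rw [inner_act_symm hK l, hBB', inner_act_symm hK (B' l)]
  simp

end

/-! ### The propagator -/

section

variable {d : ℕ} {K C D : Mat d}

section OperatorFlow

variable {V : Type*} [NormedAddCommGroup V] [InnerProductSpace ℝ V]

/-- The flow `e^{tT}` of a bounded operator. -/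
noncomputable def opFlow (T : V →L[ℝ] V) (t : ℝ) : V →L[ℝ] V := NormedSpace.exp (t • T)

theorem opFlow_zero (T : V →L[ℝ] V) (k : V) : opFlow T 0 k = k := by
  simp [opFlow, NormedSpace.exp_zero]

theorem hasDerivAt_opFlow [CompleteSpace V] (T : V →L[ℝ] V) (k : V) (t : ℝ) :
    HasDerivAt (fun s => opFlow T s k) (T (opFlow T t k)) t := by
  have h := hasDerivAt_exp_smul_const' (𝕂 := ℝ) T t
  exact h.clm_apply (hasDerivAt_const t k) |>.congr_deriv (by simp [opFlow])

theorem apply_opFlow (T : V →L[ℝ] V) (t : ℝ) (k : V) : T (opFlow T t k) = opFlow T t (T k) := by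
  have h : Commute T (NormedSpace.exp (t • T)) :=
    ((Commute.refl T).smul_right t).exp_right
  exact congrArg (fun S : V →L[ℝ] V => S k) h.eq

/-- If the adjoint of `T` is conjugate to `S` by `A`, then so are the flows. -/
theorem inner_opFlow [CompleteSpace V] {T S A A' : V →L[ℝ] V} (hA : ∀ x, A (A' x) = x)
    (hA' : ∀ x, A' (A x) = x)
    (hT : ContinuousLinearMap.adjoint T = A ∘L S ∘L A') (t : ℝ) (k l : V) :
    inner ℝ (opFlow T t k) (A l) = inner ℝ k (A (opFlow S t l)) := by
  let +nondep : NormedAlgebra ℚ (V →L[ℝ] V) := NormedAlgebra.restrictScalars ℚ ℝ (V →L[ℝ] V)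
  let U : (V →L[ℝ] V)ˣ := ⟨A, A', ContinuousLinearMap.ext hA, ContinuousLinearMap.ext hA'⟩
  have h1 : star (opFlow T t) =
      (U : V →L[ℝ] V) * opFlow S t * ((U⁻¹ : (V →L[ℝ] V)ˣ) : V →L[ℝ] V) := by
    rw [opFlow, opFlow, NormedSpace.star_exp, ← NormedSpace.exp_units_conj]
    congr 1
    rw [star_smul, ContinuousLinearMap.star_eq_adjoint, hT, star_trivial,
      mul_smul_comm, smul_mul_assoc]
    rfl
  rw [← ContinuousLinearMap.adjoint_inner_right, ← ContinuousLinearMap.star_eq_adjoint, h1]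
  congr 1
  change A (opFlow S t (A' (A l))) = _
  rw [hA']

end OperatorFlow

/-- The linear flow `e^{tN}` on `ℝ^d`. -/
noncomputable def flow (N : Mat d) (t : ℝ) : E d →L[ℝ] E d := opFlow (act N) t

theorem flow_zero (N : Mat d) (k : E d) : flow N 0 k = k := opFlow_zero _ k

theorem hasDerivAt_flow (N : Mat d) (k : E d) (t : ℝ) :
    HasDerivAt (fun s => flow N s k) (act N (flow N t k)) t := hasDerivAt_opFlow _ k t

theorem act_flow (N : Mat d) (t : ℝ) (k : E d) : act N (flow N t k) = flow N t (act N k) :=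
  apply_opFlow _ t k

theorem continuous_flow (N : Mat d) (k : E d) : Continuous fun t => flow N t k :=
  continuous_iff_continuousAt.mpr fun t => (hasDerivAt_flow N k t).continuousAt

theorem transpose_neg_conj (hK : K.PosDef) (C : Mat d) :
    (-(K⁻¹ * C * K)).transpose = K * (-C.transpose) * K⁻¹ := by
  rw [Matrix.transpose_neg, Matrix.transpose_mul, Matrix.transpose_mul,
    transpose_eq_of_posDef hK, Matrix.transpose_nonsing_inv, transpose_eq_of_posDef hK]
  simp [Matrix.mul_assoc]

/-- Conjugation by `K` turns the flow of `K⁻¹ C K` into the adjoint of the flow of `Cᵀ`, for the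
inner product given by `K`. -/
theorem inner_flow_conj (hK : K.PosDef) (C : Mat d) (t : ℝ) (k l : E d) :
    inner ℝ (flow (-(K⁻¹ * C * K)) t k) (act K l) =
      inner ℝ k (act K (flow (-C.transpose) t l)) := by
  have hdet := isUnit_det_of_posDef hK
  refine inner_opFlow (A' := act K⁻¹) (act_act_inv hdet) (act_inv_act hdet) ?_ t k l
  ext1 x
  rw [adjoint_act, transpose_neg_conj hK, act_mul, act_mul]
  rfl

theorem hasDerivAt_inner_flow {R : Mat d} (hR : R.transpose = R) (N : Mat d) (k : E d) (t : ℝ) :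
    HasDerivAt (fun s => inner ℝ (flow N s k) (act R (flow N s k)))
      (2 * inner ℝ (act N (flow N t k)) (act R (flow N t k))) t := by
  have h := hasDerivAt_flow N k t
  have h2 := ((act R).hasFDerivAt (x := flow N t k)).comp_hasDerivAt t h
  refine (h.inner ℝ h2).congr_deriv ?_
  rw [inner_act_right R (flow N t k), hR]
  simp only [Function.comp_apply]
  rw [real_inner_comm]
  ring

/-- The steady state condition `C K + K Cᵀ = 2 D`, as an identity of quadratic forms. -/
theorem inner_lyapunov (hK : K.PosDef) (hCD : C * K + K * C.transpose = (2 : ℝ) • D) (y : E d) :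
    inner ℝ y (act K (act C.transpose y)) = inner ℝ y (act D y) := by
  have h := congrArg (fun A : Mat d => inner ℝ y (act A y)) hCD
  simp only [act_add, act_smul, inner_add_right, real_inner_smul_right, act_mul] at h
  have h2 : inner ℝ y (act C (act K y)) = inner ℝ y (act K (act C.transpose y)) := by
    rw [inner_act_right C, inner_act_right K (act C.transpose y), inner_act_symm hK,
      inner_act_right, transpose_eq_of_posDef hK]
  linarith

theorem inner_conj_act (hK : K.PosDef) (hCD : C * K + K * C.transpose = (2 : ℝ) • D) (y : E d) :
    inner ℝ (act (-(K⁻¹ * C * K)) y) (act K y) = -inner ℝ y (act D y) := by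
  have hdet := isUnit_det_of_posDef hK
  rw [← inner_lyapunov hK hCD, inner_act_left (-(K⁻¹ * C * K))]
  rw [transpose_neg_conj hK, act_mul, act_inv_act hdet, act_mul, ← inner_neg_right, ← map_neg]
  congr 2
  simp [act]

/-- Positivity of `D` makes the flow of `-K⁻¹ C K` contract the quadratic form of `K`. -/
theorem inner_flow_le (hK : K.PosDef) (hD : D.PosSemidef)
    (hCD : C * K + K * C.transpose = (2 : ℝ) • D) {t : ℝ} (ht : 0 ≤ t) (k : E d) :
    inner ℝ (flow (-(K⁻¹ * C * K)) t k) (act K (flow (-(K⁻¹ * C * K)) t k)) ≤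
      inner ℝ k (act K k) := by
  have hd := hasDerivAt_inner_flow (transpose_eq_of_posDef hK) (-(K⁻¹ * C * K)) k
  have hanti : Antitone fun s => inner ℝ (flow (-(K⁻¹ * C * K)) s k)
      (act K (flow (-(K⁻¹ * C * K)) s k)) := by
    refine antitone_of_deriv_nonpos (fun s => (hd s).differentiableAt) fun s => ?_
    rw [(hd s).deriv, inner_conj_act hK hCD]
    have := inner_act_nonneg hD (flow (-(K⁻¹ * C * K)) s k)
    linarith
  simpa [flow_zero] using hanti ht

/-- If the part of `N` that is symmetric for the quadratic form of `R` is `-μ` times the identity,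
this form is multiplied by `e^{-2μt}` along the flow of `N`. -/
theorem inner_flow_eq {R N : Mat d} {μ : ℝ} (hR : R.transpose = R)
    (h : ∀ y, inner ℝ (act N y) (act R y) = -μ * inner ℝ y (act R y)) (t : ℝ) (k : E d) :
    inner ℝ (flow N t k) (act R (flow N t k)) =
      Real.exp (-2 * μ * t) * inner ℝ k (act R k) := by
  have hd := hasDerivAt_inner_flow hR N k
  have hd2 : ∀ s, HasDerivAt (fun s => Real.exp (2 * μ * s) *
      inner ℝ (flow N s k) (act R (flow N s k))) 0 s := by
    intro s
    have h1 : HasDerivAt (fun s => Real.exp (2 * μ * s)) (Real.exp (2 * μ * s) * (2 * μ)) s :=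
      ((hasDerivAt_id s).const_mul (2 * μ)).exp.congr_deriv (by simp)
    refine (h1.mul (hd s)).congr_deriv ?_
    rw [h]; ring
  have hc := is_const_of_deriv_eq_zero (fun s => (hd2 s).differentiableAt)
    (fun s => (hd2 s).deriv) t 0
  simp only [flow_zero, mul_zero, Real.exp_zero, one_mul] at hc
  rw [← hc, ← mul_assoc, ← Real.exp_add]
  simp

theorem linearGrowth_norm : LinearGrowth 1 (fun x : E d => ‖x‖) :=
  ⟨continuous_norm, fun x => by rw [abs_norm]; linarith⟩

theorem linearGrowth_inner_mul_sin (k m : E d) (θ : ℝ) :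
    LinearGrowth ‖m‖ (fun x => inner ℝ m x * Real.sin (inner ℝ k x - θ)) := by
  refine ⟨by fun_prop, fun x => ?_⟩
  rw [abs_mul]
  calc _ ≤ (‖m‖ * ‖x‖) * 1 := by
        gcongr
        · exact abs_real_inner_le_norm _ _
        · exact Real.abs_sin_le_one _
    _ ≤ _ := by nlinarith [norm_nonneg m]

/-- The cosine transform `∫ f(x) cos (⟨k, x⟩ - θ) dx`. -/
noncomputable def cosTransform (f : H K) (θ : ℝ) (k : E d) : ℝ :=
  ∫ x, (f : E d → ℝ) x * trig k θ x

/-- The derivative of the cosine transform in the wave vector. -/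
noncomputable def cosTransformDeriv (f : H K) (θ : ℝ) (k : E d) : E d →L[ℝ] ℝ :=
  ∫ x, (-((f : E d → ℝ) x * Real.sin (inner ℝ k x - θ))) • innerSL ℝ x

theorem integrable_deriv_aux (hK : K.PosDef) (f : H K) (θ : ℝ) (k : E d) :
    Integrable fun x : E d => (-((f : E d → ℝ) x * Real.sin (inner ℝ k x - θ))) • innerSL ℝ x := by
  refine (linearGrowth_norm.integrable hK f).norm.mono' ?_ (Filter.Eventually.of_forall fun x => ?_)
  · have hc : Continuous fun x : E d => Real.sin (inner ℝ k x - θ) := by fun_prop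
    have hf : AEStronglyMeasurable (f : E d → ℝ) volume :=
      (Lp.aestronglyMeasurable f).mono_ac (volume_absolutelyContinuous_weight hK)
    exact (hf.mul hc.aestronglyMeasurable).neg.smul (innerSL ℝ).continuous.aestronglyMeasurable
  · rw [norm_smul, norm_neg, norm_mul, norm_mul, innerSL_apply_norm, norm_norm]
    have := Real.abs_sin_le_one (inner ℝ k x - θ)
    rw [Real.norm_eq_abs (Real.sin _)]
    gcongr
    exact mul_le_of_le_one_right (norm_nonneg _) this

theorem cosTransformDeriv_apply (hK : K.PosDef) (f : H K) (θ : ℝ) (k m : E d) :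
    cosTransformDeriv f θ k m =
      -∫ x, (f : E d → ℝ) x * (inner ℝ m x * Real.sin (inner ℝ k x - θ)) := by
  rw [cosTransformDeriv, ContinuousLinearMap.integral_apply (integrable_deriv_aux hK f θ k),
    ← integral_neg]
  refine integral_congr_ae (Filter.Eventually.of_forall fun x => ?_)
  simp [real_inner_comm m x]
  ring

theorem hasFDerivAt_cosTransform (hK : K.PosDef) (f : H K) (θ : ℝ) (k : E d) :
    HasFDerivAt (cosTransform f θ) (cosTransformDeriv f θ k) k := by
  refine hasFDerivAt_integral_of_dominated_of_fderiv_le (s := Set.univ)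
    (bound := fun x => ‖(f : E d → ℝ) x * ‖x‖‖)
    (F' := fun k x => (-((f : E d → ℝ) x * Real.sin (inner ℝ k x - θ))) • innerSL ℝ x)
    Filter.univ_mem
    (Filter.Eventually.of_forall fun k => ((linearGrowth_trig k θ).integrable hK f).1)
    ((linearGrowth_trig k θ).integrable hK f) (integrable_deriv_aux hK f θ k).1
    (Filter.Eventually.of_forall fun x k _ => ?_) (linearGrowth_norm.integrable hK f).norm
    (Filter.Eventually.of_forall fun x k _ => ?_)
  · rw [norm_smul, norm_neg, norm_mul, norm_mul, innerSL_apply_norm, norm_norm]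
    have := Real.abs_sin_le_one (inner ℝ k x - θ)
    rw [Real.norm_eq_abs (Real.sin _)]
    gcongr
    exact mul_le_of_le_one_right (norm_nonneg _) this
  · have h1 : HasFDerivAt (fun k : E d => inner ℝ k x - θ) (innerSL ℝ x) k := by
      have := ((innerSL ℝ x).hasFDerivAt (x := k)).sub_const θ
      refine this.congr_of_eventuallyEq (Filter.Eventually.of_forall fun k => ?_)
      simp [real_inner_comm]
    have h2 := (h1.cos.const_mul ((f : E d → ℝ) x))
    refine h2.congr_fderiv ?_
    rw [smul_smul]
    congr 1
    ring

/-- The formal adjoint of `-L_{C,D}` applied to a trigonometric test function. -/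
noncomputable def trigAdjoint (C D : Mat d) (θ : ℝ) (k x : E d) : ℝ :=
  -inner ℝ k (act D k) * trig k θ x + inner ℝ (act C.transpose k) x * Real.sin (inner ℝ k x - θ)

theorem linearGrowth_trigAdjoint (C D : Mat d) (θ : ℝ) (k : E d) :
    LinearGrowth ((‖act D‖ + ‖act C.transpose‖) * (1 + ‖k‖) ^ 2) (trigAdjoint C D θ k) := by
  refine ⟨by unfold trigAdjoint trig; fun_prop, fun x => ?_⟩
  have e1 : |inner ℝ k (act D k)| ≤ ‖act D‖ * ‖k‖ ^ 2 := by
    calc _ ≤ ‖k‖ * ‖act D k‖ := abs_real_inner_le_norm _ _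
      _ ≤ ‖k‖ * (‖act D‖ * ‖k‖) := by gcongr; exact (act D).le_opNorm k
      _ = _ := by ring
  have e2 := (linearGrowth_inner_mul_sin k (act C.transpose k) θ).2 x
  have e3 : ‖act C.transpose k‖ ≤ ‖act C.transpose‖ * ‖k‖ := (act C.transpose).le_opNorm k
  have e4 := abs_trig_le_one k θ x
  have hk := norm_nonneg k
  have hx := norm_nonneg x
  have h1 : ‖k‖ ^ 2 ≤ (1 + ‖k‖) ^ 2 := by nlinarith
  have h2 : ‖k‖ ≤ (1 + ‖k‖) ^ 2 := by nlinarith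
  calc |trigAdjoint C D θ k x| ≤ |-inner ℝ k (act D k) * trig k θ x| +
        |inner ℝ (act C.transpose k) x * Real.sin (inner ℝ k x - θ)| := abs_add_le _ _
    _ ≤ (‖act D‖ * (1 + ‖k‖) ^ 2) * (1 + ‖x‖) +
        (‖act C.transpose‖ * (1 + ‖k‖) ^ 2) * (1 + ‖x‖) := by
      refine add_le_add ?_ (e2.trans ?_)
      · rw [abs_mul, abs_neg]
        refine mul_le_mul ?_ (e4.trans (by linarith)) (abs_nonneg _) (by positivity)
        exact e1.trans (by gcongr)
      · gcongr
        exact e3.trans (by gcongr)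
    _ = _ := by ring

theorem integral_mul_trigAdjoint (hK : K.PosDef) (f : H K) (C D : Mat d) (θ : ℝ) (k : E d) :
    ∫ x, (f : E d → ℝ) x * trigAdjoint C D θ k x =
      -inner ℝ k (act D k) * cosTransform f θ k -
        cosTransformDeriv f θ k (act C.transpose k) := by
  rw [cosTransformDeriv_apply hK, sub_neg_eq_add, cosTransform, ← integral_const_mul,
    ← integral_add (((linearGrowth_trig k θ).integrable hK f).const_mul _)
      ((linearGrowth_inner_mul_sin k _ θ).integrable hK f)]
  refine integral_congr_ae (Filter.Eventually.of_forall fun x => ?_)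
  simp only [trigAdjoint]
  ring

/-- Continuity follows from that of the Gram kernel `inner_wave_wave`. -/
theorem continuous_wave (hK : K.PosDef) (θ : ℝ) : Continuous fun k => wave K k θ := by
  refine continuous_iff_continuousAt.mpr fun k => ?_
  rw [ContinuousAt, tendsto_iff_norm_sub_tendsto_zero]
  have h : ∀ l, ‖wave K l θ - wave K k θ‖ = Real.sqrt (inner ℝ (wave K l θ) (wave K l θ) -
      2 * inner ℝ (wave K l θ) (wave K k θ) + inner ℝ (wave K k θ) (wave K k θ)) := by
    intro l
    rw [real_inner_self_eq_norm_sq, real_inner_self_eq_norm_sq, ← norm_sub_sq_real,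
      Real.sqrt_sq (norm_nonneg _)]
  simp_rw [h, inner_wave_wave hK]
  have hc : Continuous fun l : E d => Real.sqrt (Real.cosh (inner ℝ l (act K l)) *
      (Real.cos θ * Real.cos θ) + Real.sinh (inner ℝ l (act K l)) * (Real.sin θ * Real.sin θ) -
      2 * (Real.cosh (inner ℝ l (act K k)) * (Real.cos θ * Real.cos θ) +
        Real.sinh (inner ℝ l (act K k)) * (Real.sin θ * Real.sin θ)) +
      (Real.cosh (inner ℝ k (act K k)) * (Real.cos θ * Real.cos θ) +
        Real.sinh (inner ℝ k (act K k)) * (Real.sin θ * Real.sin θ))) := by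
    have := Real.continuous_cosh
    have := Real.continuous_sinh
    fun_prop
  have ht := hc.tendsto k
  convert ht using 2
  symm
  rw [Real.sqrt_eq_zero']
  apply le_of_eq
  ring

/-- The Fokker-Planck propagator: the second quantisation of the flow of `-K⁻¹ C K`. -/
noncomputable def propagator (K C : Mat d) (t : ℝ) : H K →L[ℝ] H K :=
  secondQuant K (flow (-(K⁻¹ * C * K)) t)

/-- Uniform boundedness of the propagator reduces strong continuity to the dense set of
combinations of waves. -/
theorem continuousOn_propagator (hK : K.PosDef) (hD : D.PosSemidef)
    (hCD : C * K + K * C.transpose = (2 : ℝ) • D) (f : H K) :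
    ContinuousOn (fun t => propagator K C t f) (Set.Ici 0) := by
  refine continuousOn_of_uniform_approx_of_continuousOn fun u hu => ?_
  obtain ⟨ε, hε, hu⟩ := Metric.mem_uniformity_dist.mp hu
  obtain ⟨h, hh⟩ := (denseRange_waveComb hK).exists_dist_lt f hε
  refine ⟨fun t => propagator K C t (waveComb K (ContinuousLinearMap.id ℝ (E d)) h), ?_,
    fun t ht => hu ?_⟩
  · have : ContinuousOn (fun t => waveComb K (flow (-(K⁻¹ * C * K)) t) h) (Set.Ici 0) := by
      simp only [waveComb, Finsupp.linearCombination_apply, Finsupp.sum]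
      refine Continuous.continuousOn (continuous_finsetSum _ fun i _ => ?_)
      have hw : Continuous fun t => wave K (flow (-(K⁻¹ * C * K)) t i.1) i.2 :=
        (continuous_wave hK i.2).comp (continuous_flow _ i.1)
      exact hw.const_smul (h i)
    exact this.congr fun t ht => secondQuant_waveComb hK (inner_flow_le hK hD hCD ht) h
  · rw [dist_eq_norm, ← map_sub]
    refine (norm_secondQuant_le hK (inner_flow_le hK hD hCD ht) _).trans_lt ?_
    rwa [← dist_eq_norm]

theorem propagator_zero (hK : K.PosDef) (C : Mat d) (f : H K) : propagator K C 0 f = f := by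
  refine (denseRange_waveComb hK).induction_on (p := fun f => propagator K C 0 f = f) f
    (isClosed_eq (by fun_prop) (by fun_prop)) fun h => ?_
  rw [propagator, secondQuant_waveComb hK fun k => by rw [flow_zero]]
  simp [waveComb, flow_zero]

/-- The Fourier transform of a solution, transported along the characteristics `k ↦ e^{-tCᵀ} k`. -/
theorem cosTransform_propagator (hK : K.PosDef) (hD : D.PosSemidef)
    (hCD : C * K + K * C.transpose = (2 : ℝ) • D) {t : ℝ} (ht : 0 ≤ t) (f : H K) (θ : ℝ)
    (k : E d) :
    cosTransform (propagator K C t f) θ k =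
      Real.exp (inner ℝ (flow (-C.transpose) t k) (act K (flow (-C.transpose) t k)) / 2 -
        inner ℝ k (act K k) / 2) * cosTransform f θ (flow (-C.transpose) t k) := by
  have h := inner_secondQuant_wave hK (inner_flow_le hK hD hCD ht) (inner_flow_conj hK C t) f k θ
  rw [inner_wave hK, inner_wave hK] at h
  rw [Real.exp_sub, div_mul_eq_mul_div, eq_div_iff (Real.exp_pos _).ne', mul_comm]
  exact h

/-- The propagator solves the Fokker-Planck equation tested against trigonometric functions. -/
theorem hasDerivAt_cosTransform_propagator (hK : K.PosDef) (hD : D.PosSemidef)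
    (hCD : C * K + K * C.transpose = (2 : ℝ) • D) {t : ℝ} (ht : 0 < t) (f : H K) (θ : ℝ)
    (k : E d) :
    HasDerivAt (fun s => cosTransform (propagator K C s f) θ k)
      (∫ x, (propagator K C t f : E d → ℝ) x * trigAdjoint C D θ k x) t := by
  set m := act C.transpose k with hm
  set A := flow (-C.transpose) t with hA
  have hqt : ∀ y v : E d, HasFDerivAt (fun y : E d => inner ℝ y (act K y) / 2)
      (innerSL ℝ (act K y)) y := by
    intro y v
    have h1 := (hasFDerivAt_id (𝕜 := ℝ) y).inner ℝ ((act K).hasFDerivAt (x := y))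
    have h2 := h1.mul_const (1 / 2 : ℝ)
    refine (h2.congr_fderiv ?_).congr_of_eventuallyEq
      (Filter.Eventually.of_forall fun y => by simp [div_eq_mul_inv])
    ext v
    simp [inner_act_symm hK y v, real_inner_comm v]
    ring
  -- the derivative of the explicit formula in time
  have hs : HasDerivAt (fun s => cosTransform (propagator K C s f) θ k)
      (Real.exp (inner ℝ (A k) (act K (A k)) / 2 - inner ℝ k (act K k) / 2) *
        (-(inner ℝ (act K (A k)) (A m)) * cosTransform f θ (A k) -
          cosTransformDeriv f θ (A k) (A m))) t := by
    have ha : HasDerivAt (fun s => flow (-C.transpose) s k) (-(A m)) t := by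
      refine (hasDerivAt_flow (-C.transpose) k t).congr_deriv ?_
      rw [act_flow, ← map_neg]
      congr 1
      simp [hm, act]
    have h1 := ((hqt (A k) 0).comp_hasDerivAt t ha).sub_const (inner ℝ k (act K k) / 2)
    have h2 := (hasFDerivAt_cosTransform hK f θ (A k)).comp_hasDerivAt t ha
    have h3 := h1.exp.mul h2
    refine (h3.congr_deriv ?_).congr_of_eventuallyEq ?_
    · simp [← hA]
      ring
    · filter_upwards [lt_mem_nhds ht] with s hs
      exact cosTransform_propagator hK hD hCD hs.le f θ k
  -- the derivative of the same formula in the wave vector, in the direction `Cᵀ k`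
  have hk : cosTransformDeriv (propagator K C t f) θ k m =
      Real.exp (inner ℝ (A k) (act K (A k)) / 2 - inner ℝ k (act K k) / 2) *
        ((inner ℝ (act K (A k)) (A m) - inner ℝ (act K k) m) * cosTransform f θ (A k) +
          cosTransformDeriv f θ (A k) (A m)) := by
    have h1 := ((hqt (A k) 0).comp k (A.hasFDerivAt (x := k))).sub (hqt k 0)
    have h2 := (hasFDerivAt_cosTransform hK f θ (A k)).comp k (A.hasFDerivAt (x := k))
    have h3 := h1.exp.mul h2
    have h4 : HasFDerivAt (cosTransform (propagator K C t f) θ) _ k :=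
      h3.congr_of_eventuallyEq (Filter.Eventually.of_forall fun l =>
        cosTransform_propagator hK hD hCD ht.le f θ l)
    rw [(hasFDerivAt_cosTransform hK (propagator K C t f) θ k).unique h4]
    simp
    ring
  refine hs.congr_deriv ?_
  rw [integral_mul_trigAdjoint hK, ← hm, hk, cosTransform_propagator hK hD hCD ht.le, ← hA,
    ← inner_lyapunov hK hCD, ← hm, real_inner_comm m (act K k), ← inner_act_symm hK k m,
    real_inner_comm (act K m) k]
  ring

end

/-! ### The propagator solves the equation -/

section

variable {d : ℕ} {K C D : Mat d}

/-- The formal adjoint in terms of iterated directional derivatives. -/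
theorem fpAdjoint_eq {φ : E d → ℝ} (hφ : ContDiff ℝ 2 φ) (C D : Mat d) (x : E d) :
    fpAdjoint C D φ x =
      ∑ i, fderiv ℝ (fun y => fderiv ℝ φ y (act D.transpose (EuclideanSpace.single i 1))) x
        (EuclideanSpace.single i 1) - fderiv ℝ φ x (act C x) := by
  have hd : Differentiable ℝ (fderiv ℝ φ) :=
    (hφ.fderiv_right (m := 1) (by norm_num)).differentiable (by norm_num)
  have hg : Differentiable ℝ (gradient φ) :=
    ((InnerProductSpace.toDual ℝ (E d)).symm.toContinuousLinearEquiv.differentiable).comp hd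
  have hF : Differentiable ℝ (fun y => act D (gradient φ y)) := (act D).differentiable.comp hg
  have hin : ∀ y v : E d, inner ℝ v (gradient φ y) = fderiv ℝ φ y v := by
    intro y v
    rw [real_inner_comm, ← toDual_gradient]
    simp
  unfold fpAdjoint div
  rw [hin]
  congr 1
  refine Finset.sum_congr rfl fun i _ => ?_
  have h1 := ((EuclideanSpace.proj i : E d →L[ℝ] ℝ).hasFDerivAt (x := act D (gradient φ x))).comp x
    (hF x).hasFDerivAt
  have h2 : (fun y => fderiv ℝ φ y (act D.transpose (EuclideanSpace.single i 1))) =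
      (EuclideanSpace.proj i : E d →L[ℝ] ℝ) ∘ fun y => act D (gradient φ y) := by
    funext y
    rw [← hin, ← inner_act_right]
    simp [EuclideanSpace.inner_single_left]
  rw [h2, h1.fderiv]
  simp

theorem sum_inner_single_mul (D : Mat d) (k : E d) :
    ∑ i, inner ℝ k (EuclideanSpace.single i 1) *
      inner ℝ k (act D.transpose (EuclideanSpace.single i 1)) = inner ℝ k (act D k) := by
  simp only [← inner_act_left, EuclideanSpace.inner_single_right]
  rw [real_inner_comm, PiLp.inner_apply]
  refine Finset.sum_congr rfl fun i _ => ?_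
  simp

section FourierRepresentation

open FourierTransform LineDeriv

theorem SchwartzMap.integrable_cexp_mul_fourier (h : SchwartzMap (E d) ℂ) (x : E d) :
    Integrable fun ξ => Complex.exp ((2 * Real.pi * inner ℝ ξ x : ℝ) * Complex.I) * 𝓕 h ξ := by
  refine ((𝓕 h).integrable (μ := volume)).norm.mono' ?_ (Filter.Eventually.of_forall fun ξ => ?_)
  · have := (𝓕 h).continuous
    exact Continuous.aestronglyMeasurable (by fun_prop)
  · rw [norm_mul, Complex.norm_exp_ofReal_mul_I, one_mul]

theorem SchwartzMap.eq_integral_fourier (h : SchwartzMap (E d) ℂ) (x : E d) :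
    h x = ∫ ξ, Complex.exp ((2 * Real.pi * inner ℝ ξ x : ℝ) * Complex.I) * 𝓕 h ξ := by
  have h1 : 𝓕⁻ (𝓕 h) = h := fourierInv_fourier_eq h
  conv_lhs => rw [← h1, SchwartzMap.fourierInv_coe, Real.fourierInv_eq']
  simp

theorem SchwartzMap.fourier_lineDeriv_apply (h : SchwartzMap (E d) ℂ) (v ξ : E d) :
    𝓕 (∂_{v} h) ξ = ((2 * Real.pi * inner ℝ ξ v : ℝ) * Complex.I) * 𝓕 h ξ := by
  have ht : (inner ℝ · v : E d → ℝ).HasTemperateGrowth := by fun_prop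
  rw [SchwartzMap.fourier_lineDerivOp_eq]
  simp [ht]
  ring

theorem fderiv_ofReal_comp {G : E d → ℝ} {x : E d} (hG : DifferentiableAt ℝ G x) (u : E d) :
    fderiv ℝ (fun y => ((G y : ℝ) : ℂ)) x u = ((fderiv ℝ G x u : ℝ) : ℂ) := by
  have h := (Complex.ofRealCLM.hasFDerivAt (x := G x)).comp x hG.hasFDerivAt
  have h2 : (fun y => ((G y : ℝ) : ℂ)) = Complex.ofRealCLM ∘ G := rfl
  rw [h2, h.fderiv]
  simp

/-- A test function is a superposition of trigonometric functions, and the adjoint operator acts on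
the superposition termwise: this is Fourier inversion, with the Fourier transform in polar form. -/
theorem exists_trig_representation {φ : E d → ℝ} (hφ : ContDiff ℝ ∞ φ) (hc : HasCompactSupport φ)
    (C D : Mat d) :
    ∃ ρ θ : E d → ℝ, Measurable ρ ∧ Measurable θ ∧ (∀ ξ, 0 ≤ ρ ξ) ∧
      Integrable (fun ξ => (1 + ‖(2 * Real.pi) • ξ‖) ^ 2 * ρ ξ) ∧
      (∀ x, φ x = ∫ ξ, ρ ξ * trig ((2 * Real.pi) • ξ) (θ ξ) x) ∧
      ∀ x, fpAdjoint C D φ x = ∫ ξ, ρ ξ * trigAdjoint C D (θ ξ) ((2 * Real.pi) • ξ) x := by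
  have hsm : ContDiff ℝ ∞ fun y => ((φ y : ℝ) : ℂ) := Complex.ofRealCLM.contDiff.comp hφ
  have hcs : HasCompactSupport fun y => ((φ y : ℝ) : ℂ) :=
    hc.comp_left (g := ((↑) : ℝ → ℂ)) Complex.ofReal_zero
  let ψ : SchwartzMap (E d) ℂ := hcs.toSchwartzMap hsm
  have hψ : ∀ y, ψ y = ((φ y : ℝ) : ℂ) := fun y => rfl
  set g : SchwartzMap (E d) ℂ := 𝓕 ψ with hg
  have hφ2 : ContDiff ℝ 2 φ := hφ.of_le (by norm_cast)
  have hd1 : Differentiable ℝ φ := hφ2.differentiable (by norm_num)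
  have hd2 : ∀ v, Differentiable ℝ fun y => fderiv ℝ φ y v := fun v =>
    ((hφ2.fderiv_right (m := 1) (by norm_num)).differentiable (by norm_num)).clm_apply
      (differentiable_const v)
  have e1 : ∀ v y, (∂_{v} ψ) y = ((fderiv ℝ φ y v : ℝ) : ℂ) := by
    intro v y
    rw [SchwartzMap.lineDerivOp_apply_eq_fderiv]
    exact fderiv_ofReal_comp (hd1 y) v
  have e2 : ∀ u v x, (∂_{u} (∂_{v} ψ)) x =
      ((fderiv ℝ (fun y => fderiv ℝ φ y v) x u : ℝ) : ℂ) := by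
    intro u v x
    rw [SchwartzMap.lineDerivOp_apply_eq_fderiv, funext (e1 v)]
    exact fderiv_ofReal_comp (hd2 v x) u
  have hre : ∀ (h : SchwartzMap (E d) ℂ) (x : E d), (h x).re = ∫ ξ, (Complex.exp
      ((2 * Real.pi * inner ℝ ξ x : ℝ) * Complex.I) * 𝓕 h ξ).re := by
    intro h x
    rw [SchwartzMap.eq_integral_fourier h x]
    exact (integral_re (SchwartzMap.integrable_cexp_mul_fourier h x)).symm
  have hin : ∀ (h : SchwartzMap (E d) ℂ) (x : E d), Integrable fun ξ => (Complex.exp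
      ((2 * Real.pi * inner ℝ ξ x : ℝ) * Complex.I) * 𝓕 h ξ).re := fun h x =>
    (SchwartzMap.integrable_cexp_mul_fourier h x).re
  have hpolar : ∀ ξ x : E d, Complex.exp ((2 * Real.pi * inner ℝ ξ x : ℝ) * Complex.I) * g ξ =
      ((‖g ξ‖ : ℝ) : ℂ) *
        Complex.exp ((inner ℝ ((2 * Real.pi) • ξ) x - -(g ξ).arg : ℝ) * Complex.I) := by
    intro ξ x
    conv_lhs => rw [← Complex.norm_mul_exp_arg_mul_I (g ξ)]
    rw [mul_left_comm, ← Complex.exp_add, ← add_mul, ← Complex.ofReal_add,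
      real_inner_smul_left, sub_neg_eq_add]
  refine ⟨fun ξ => ‖g ξ‖, fun ξ => -(g ξ).arg, g.continuous.norm.measurable,
    (Complex.measurable_arg.comp g.continuous.measurable).neg, fun ξ => norm_nonneg _, ?_, ?_, ?_⟩
  · have hi := ((g.integrable_pow_mul volume 0).const_mul 2).add
      ((g.integrable_pow_mul volume 2).const_mul (2 * (2 * Real.pi) ^ 2))
    refine hi.mono' ?_ (Filter.Eventually.of_forall fun ξ => ?_)
    · have := g.continuous
      exact Continuous.aestronglyMeasurable (by fun_prop)
    · rw [Real.norm_of_nonneg (by positivity), norm_smul, Real.norm_of_nonneg (by positivity)]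
      simp only [pow_zero, one_mul, Pi.add_apply]
      have : (1 + 2 * Real.pi * ‖ξ‖) ^ 2 ≤ 2 + 2 * (2 * Real.pi) ^ 2 * ‖ξ‖ ^ 2 := by
        nlinarith [sq_nonneg (1 - 2 * Real.pi * ‖ξ‖)]
      calc _ ≤ (2 + 2 * (2 * Real.pi) ^ 2 * ‖ξ‖ ^ 2) * ‖g ξ‖ := by gcongr
        _ = _ := by ring
  · intro x
    have h := hre ψ x
    rw [hψ, Complex.ofReal_re] at h
    rw [h]
    refine integral_congr_ae (Filter.Eventually.of_forall fun ξ => ?_)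
    simp only [← hg, hpolar, Complex.re_ofReal_mul, Complex.exp_ofReal_mul_I_re, trig]
  · intro x
    rw [fpAdjoint_eq hφ2]
    have h1 : ∀ v, fderiv ℝ φ x v = ∫ ξ, (Complex.exp
        ((2 * Real.pi * inner ℝ ξ x : ℝ) * Complex.I) * 𝓕 (∂_{v} ψ) ξ).re := by
      intro v
      rw [← hre, e1, Complex.ofReal_re]
    have h2 : ∀ u v, fderiv ℝ (fun y => fderiv ℝ φ y v) x u = ∫ ξ, (Complex.exp
        ((2 * Real.pi * inner ℝ ξ x : ℝ) * Complex.I) * 𝓕 (∂_{u} (∂_{v} ψ)) ξ).re := by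
      intro u v
      rw [← hre, e2, Complex.ofReal_re]
    simp_rw [h1, h2]
    rw [← integral_finsetSum _ fun i _ => hin _ x, ← integral_sub
      (integrable_finsetSum _ fun i _ => hin _ x) (hin _ x)]
    refine integral_congr_ae (Filter.Eventually.of_forall fun ξ => ?_)
    simp only [SchwartzMap.fourier_lineDeriv_apply, ← hg]
    set c := Real.cos (inner ℝ ((2 * Real.pi) • ξ) x - -(g ξ).arg) with hc
    set s := Real.sin (inner ℝ ((2 * Real.pi) • ξ) x - -(g ξ).arg) with hs
    have t1 : ∀ a b : ℝ, (Complex.exp ((2 * Real.pi * inner ℝ ξ x : ℝ) * Complex.I) *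
        (a * Complex.I * (b * Complex.I * g ξ))).re = -(‖g ξ‖ * c) * (a * b) := by
      intro a b
      have : Complex.exp ((2 * Real.pi * inner ℝ ξ x : ℝ) * Complex.I) *
          (a * Complex.I * (b * Complex.I * g ξ)) = ((-(a * b) : ℝ) : ℂ) *
          (Complex.exp ((2 * Real.pi * inner ℝ ξ x : ℝ) * Complex.I) * g ξ) := by
        generalize Complex.exp ((2 * Real.pi * inner ℝ ξ x : ℝ) * Complex.I) = w
        push_cast
        linear_combination w * g ξ * a * b * Complex.I_sq
      rw [this, hpolar, Complex.re_ofReal_mul, Complex.re_ofReal_mul, Complex.exp_ofReal_mul_I_re,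
        ← hc]
      ring
    have t2 : ∀ a : ℝ, (Complex.exp ((2 * Real.pi * inner ℝ ξ x : ℝ) * Complex.I) *
        (a * Complex.I * g ξ)).re = -(‖g ξ‖ * s) * a := by
      intro a
      have : Complex.exp ((2 * Real.pi * inner ℝ ξ x : ℝ) * Complex.I) *
          (a * Complex.I * g ξ) = a * (Complex.I *
          (Complex.exp ((2 * Real.pi * inner ℝ ξ x : ℝ) * Complex.I) * g ξ)) := by ring
      rw [this, hpolar, Complex.re_ofReal_mul, Complex.I_mul_re, Complex.im_ofReal_mul,
        Complex.exp_ofReal_mul_I_im, ← hs]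
      ring
    simp_rw [t1, t2]
    rw [← Finset.mul_sum]
    have t3 : ∑ i, 2 * Real.pi * inner ℝ ξ (EuclideanSpace.single i 1) *
        (2 * Real.pi * inner ℝ ξ (act D.transpose (EuclideanSpace.single i 1))) =
        inner ℝ ((2 * Real.pi) • ξ) (act D ((2 * Real.pi) • ξ)) := by
      rw [← sum_inner_single_mul]
      simp only [real_inner_smul_left]
    rw [t3, trigAdjoint, ← inner_act_right, trig, ← hc, ← hs, real_inner_smul_left ξ (act C x)]
    ring

end FourierRepresentation

theorem aestronglyMeasurable_mul_superposition (hK : K.PosDef) (f : H K) {Ψ : E d → E d → ℝ}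
    (hΨ : Measurable fun p : E d × E d => Ψ p.1 p.2) :
    AEStronglyMeasurable (fun p : E d × E d => (f : E d → ℝ) p.2 * Ψ p.1 p.2)
      (volume.prod volume) := by
  have hf : AEStronglyMeasurable (f : E d → ℝ) volume :=
    (Lp.aestronglyMeasurable f).mono_ac (volume_absolutelyContinuous_weight hK)
  exact hf.comp_snd.mul hΨ.aestronglyMeasurable

theorem aestronglyMeasurable_integral_mul (hK : K.PosDef) (f : H K) {Ψ : E d → E d → ℝ}
    (hΨ : Measurable fun p : E d × E d => Ψ p.1 p.2) :
    AEStronglyMeasurable (fun ξ => ∫ x, (f : E d → ℝ) x * Ψ ξ x) volume :=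
  (aestronglyMeasurable_mul_superposition hK f hΨ).integral_prod_right'

/-- Fubini's theorem for superpositions of test functions of linear growth. -/
theorem integral_mul_integral (hK : K.PosDef) (f : H K) {Ψ : E d → E d → ℝ} {b : E d → ℝ}
    (hΨ : Measurable fun p : E d × E d => Ψ p.1 p.2) (hb : Integrable b)
    (h : ∀ ξ x, |Ψ ξ x| ≤ b ξ * (1 + ‖x‖)) :
    ∫ x, (f : E d → ℝ) x * ∫ ξ, Ψ ξ x = ∫ ξ, ∫ x, (f : E d → ℝ) x * Ψ ξ x := by
  simp_rw [← integral_const_mul]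
  symm
  refine integral_integral_swap ?_
  have hlin : LinearGrowth 1 fun x : E d => 1 + ‖x‖ := ⟨by fun_prop, fun x => by
    rw [abs_of_nonneg (by positivity), one_mul]⟩
  refine (hb.mul_prod (hlin.integrable hK f).norm).mono'
    (aestronglyMeasurable_mul_superposition hK f hΨ) (Filter.Eventually.of_forall fun p => ?_)
  simp only [Function.uncurry]
  have h1 := h p.1 p.2
  rw [norm_mul, norm_mul, mul_left_comm, Real.norm_eq_abs (Ψ _ _),
    Real.norm_of_nonneg (r := 1 + ‖p.2‖) (by positivity)]
  gcongr

theorem measurable_trig_superposition {ρ θ : E d → ℝ} (hρ : Measurable ρ)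
    (hθ : Measurable θ) (a : ℝ) :
    Measurable fun p : E d × E d => ρ p.1 * trig (a • p.1) (θ p.1) p.2 := by
  have h1 : Measurable fun p : E d × E d => inner ℝ (a • p.1) p.2 :=
    Continuous.measurable (by fun_prop)
  exact (hρ.comp measurable_fst).mul
    (Real.measurable_cos.comp (h1.sub (hθ.comp measurable_fst)))

theorem measurable_trigAdjoint_superposition (C D : Mat d) {ρ θ : E d → ℝ} (hρ : Measurable ρ)
    (hθ : Measurable θ) (a : ℝ) :
    Measurable fun p : E d × E d => ρ p.1 * trigAdjoint C D (θ p.1) (a • p.1) p.2 := by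
  have h1 : Measurable fun p : E d × E d => inner ℝ (a • p.1) p.2 :=
    Continuous.measurable (by fun_prop)
  have h2 : Measurable fun p : E d × E d => -inner ℝ (a • p.1) (act D (a • p.1)) :=
    Continuous.measurable (by fun_prop)
  have h3 : Measurable fun p : E d × E d => inner ℝ (act C.transpose (a • p.1)) p.2 :=
    Continuous.measurable (by fun_prop)
  have h4 := h1.sub (hθ.comp measurable_fst)
  exact (hρ.comp measurable_fst).mul
    ((h2.mul (Real.measurable_cos.comp h4)).add (h3.mul (Real.measurable_sin.comp h4)))

/-- Writing a test function as a superposition of trigonometric functions reduces the equation to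
`hasDerivAt_cosTransform_propagator`, by differentiation under the integral over wave vectors. -/
theorem isSolution_propagator (hK : K.PosDef) (hD : D.PosSemidef)
    (hCD : C * K + K * C.transpose = (2 : ℝ) • D) (f : H K) :
    IsSolution K C D f fun t => propagator K C t f := by
  refine ⟨continuousOn_propagator hK hD hCD f, propagator_zero hK C f, fun φ hφ hc t ht => ?_⟩
  obtain ⟨ρ, θ, hρm, hθm, hρ, hint, h1, h2⟩ := exists_trig_representation hφ hc C D
  have hone : ∀ ξ : E d, 1 ≤ (1 + ‖(2 * Real.pi) • ξ‖) ^ 2 := fun ξ => by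
    nlinarith [norm_nonneg ((2 * Real.pi) • ξ)]
  have hρi : Integrable ρ := hint.mono' hρm.aestronglyMeasurable
    (Filter.Eventually.of_forall fun ξ => by
      rw [Real.norm_of_nonneg (hρ ξ)]
      exact le_mul_of_one_le_left (hρ ξ) (hone ξ))
  set A := ‖act D‖ + ‖act C.transpose‖ with hA
  have hswap1 : ∀ s, ∫ x, (propagator K C s f : E d → ℝ) x * φ x =
      ∫ ξ, ρ ξ * cosTransform (propagator K C s f) (θ ξ) ((2 * Real.pi) • ξ) := by
    intro s
    simp_rw [h1]
    rw [integral_mul_integral hK _ (measurable_trig_superposition hρm hθm _) hρi fun ξ x => ?_]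
    · refine integral_congr_ae (Filter.Eventually.of_forall fun ξ => ?_)
      simp only [cosTransform, ← integral_const_mul]
      refine integral_congr_ae (Filter.Eventually.of_forall fun x => ?_)
      simp only []
      ring
    · rw [abs_mul, abs_of_nonneg (hρ ξ)]
      gcongr
      · exact hρ ξ
      · simpa using (linearGrowth_trig ((2 * Real.pi) • ξ) (θ ξ)).2 x
  have hswap2 : ∫ x, (propagator K C t f : E d → ℝ) x * fpAdjoint C D φ x =
      ∫ ξ, ρ ξ * ∫ x, (propagator K C t f : E d → ℝ) x *
        trigAdjoint C D (θ ξ) ((2 * Real.pi) • ξ) x := by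
    simp_rw [h2]
    rw [integral_mul_integral hK _ (measurable_trigAdjoint_superposition C D hρm hθm _)
      (hint.const_mul A) fun ξ x => ?_]
    · refine integral_congr_ae (Filter.Eventually.of_forall fun ξ => ?_)
      simp only [← integral_const_mul]
      refine integral_congr_ae (Filter.Eventually.of_forall fun x => ?_)
      simp only []
      ring
    · rw [abs_mul, abs_of_nonneg (hρ ξ)]
      calc _ ≤ ρ ξ * (A * (1 + ‖(2 * Real.pi) • ξ‖) ^ 2 * (1 + ‖x‖)) := by
            gcongr
            · exact hρ ξ
            · exact (linearGrowth_trigAdjoint C D (θ ξ) ((2 * Real.pi) • ξ)).2 x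
        _ = _ := by ring
  have hmeas : ∀ s, AEStronglyMeasurable (fun ξ => ρ ξ *
      cosTransform (propagator K C s f) (θ ξ) ((2 * Real.pi) • ξ)) volume := by
    intro s
    refine (aestronglyMeasurable_integral_mul hK (propagator K C s f)
      (Ψ := fun ξ x => ρ ξ * trig ((2 * Real.pi) • ξ) (θ ξ) x)
      (measurable_trig_superposition hρm hθm (2 * Real.pi))).congr
      (Filter.Eventually.of_forall fun ξ => ?_)
    simp only [cosTransform, ← integral_const_mul]
    refine integral_congr_ae (Filter.Eventually.of_forall fun x => ?_)
    simp only []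
    ring
  simp only [hswap1]
  rw [hswap2]
  refine (hasDerivAt_integral_of_dominated_loc_of_deriv_le (s := Set.Ioi 0)
    (F' := fun s ξ => ρ ξ * ∫ x, (propagator K C s f : E d → ℝ) x *
        trigAdjoint C D (θ ξ) ((2 * Real.pi) • ξ) x)
    (bound := fun ξ => A * momentConst K * ‖f‖ * ((1 + ‖(2 * Real.pi) • ξ‖) ^ 2 * ρ ξ))
    (Ioi_mem_nhds ht) (Filter.Eventually.of_forall hmeas) ?_ ?_ ?_
    (hint.const_mul _) ?_).2
  · refine (hρi.mul_const (1 * momentConst K * ‖propagator K C t f‖)).mono' (hmeas t)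
      (Filter.Eventually.of_forall fun ξ => ?_)
    rw [norm_mul, Real.norm_of_nonneg (hρ ξ)]
    gcongr
    · exact hρ ξ
    · exact (linearGrowth_trig _ _).abs_integral_le hK _
  · refine (aestronglyMeasurable_integral_mul hK (propagator K C t f)
      (Ψ := fun ξ x => ρ ξ * trigAdjoint C D (θ ξ) ((2 * Real.pi) • ξ) x)
      (measurable_trigAdjoint_superposition C D hρm hθm (2 * Real.pi))).congr
      (Filter.Eventually.of_forall fun ξ => ?_)
    simp only [← integral_const_mul]
    refine integral_congr_ae (Filter.Eventually.of_forall fun x => ?_)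
    simp only []
    ring
  · refine Filter.Eventually.of_forall fun ξ s hs => ?_
    rw [norm_mul, Real.norm_of_nonneg (hρ ξ)]
    have e1 := (linearGrowth_trigAdjoint C D (θ ξ) ((2 * Real.pi) • ξ)).abs_integral_le hK
      (propagator K C s f)
    have e2 : ‖propagator K C s f‖ ≤ ‖f‖ :=
      norm_secondQuant_le hK (inner_flow_le hK hD hCD (le_of_lt hs)) f
    have e3 := momentConst_nonneg K
    calc _ ≤ ρ ξ * (A * (1 + ‖(2 * Real.pi) • ξ‖) ^ 2 * momentConst K * ‖f‖) := by
          gcongr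
          · exact hρ ξ
          · exact e1.trans (by gcongr)
      _ = _ := by ring
  · refine Filter.Eventually.of_forall fun ξ s hs => ?_
    exact (hasDerivAt_cosTransform_propagator hK hD hCD hs f (θ ξ) _).const_mul _

end

/-! ### Uniqueness of solutions -/

section

open Filter Topology

variable {d : ℕ} {K C D : Mat d}

theorem LinearGrowth.norm_lift_sub_sq {M : ℝ} {ψ χ : E d → ℝ} (hK : K.PosDef)
    (hψ : LinearGrowth M ψ) (hχ : LinearGrowth M χ) :
    ‖lift K ψ - lift K χ‖ ^ 2 = ∫ x, (ψ x - χ x) ^ 2 * fInf K x := by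
  have hs : Integrable fun x => ψ x * ψ x * fInf K x - 2 * (ψ x * χ x * fInf K x) :=
    (hψ.integrable_mul hK hψ).sub ((hψ.integrable_mul hK hχ).const_mul 2)
  rw [norm_sub_sq_real, ← real_inner_self_eq_norm_sq, ← real_inner_self_eq_norm_sq,
    hψ.inner_lift_lift hK hψ, hψ.inner_lift_lift hK hχ, hχ.inner_lift_lift hK hχ,
    ← integral_const_mul, ← integral_sub (hψ.integrable_mul hK hψ)
      ((hψ.integrable_mul hK hχ).const_mul 2), ← integral_add hs
      (hχ.integrable_mul hK hχ)]
  refine integral_congr_ae (Eventually.of_forall fun x => ?_)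
  ring

/-- Pointwise convergence with a uniform linear bound implies convergence of the functionals
`f ↦ ∫ f ψ dx` in norm. -/
theorem tendsto_lift {ι : Type*} {l : Filter ι} [l.IsCountablyGenerated] {M : ℝ}
    {ψ : ι → E d → ℝ} {χ : E d → ℝ} (hK : K.PosDef) (hψ : ∀ᶠ n in l, LinearGrowth M (ψ n))
    (hχ : LinearGrowth M χ) (h : ∀ x, Tendsto (fun n => ψ n x) l (𝓝 (χ x))) :
    Tendsto (fun n => lift K (ψ n)) l (𝓝 (lift K χ)) := by
  rw [tendsto_iff_norm_sub_tendsto_zero]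
  have h1 : Tendsto (fun n => ∫ x, (ψ n x - χ x) ^ 2 * fInf K x) l (𝓝 (∫ _ : E d, (0 : ℝ))) := by
    refine tendsto_integral_filter_of_dominated_convergence
      (fun x => (2 * M) ^ 2 * ((1 + ‖x‖) ^ 2 * fInf K x)) ?_ ?_
      ((integrable_quadratic_mul_fInf hK).const_mul _) (Eventually.of_forall fun x => ?_)
    · filter_upwards [hψ] with n hn
      exact (((hn.1.sub hχ.1).pow 2).mul (continuous_fInf K)).aestronglyMeasurable
    · filter_upwards [hψ] with n hn
      refine Eventually.of_forall fun x => ?_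
      have hf := fInf_pos hK x
      rw [norm_mul, Real.norm_of_nonneg hf.le, Real.norm_of_nonneg (sq_nonneg _), ← mul_assoc,
        ← mul_pow, ← sq_abs]
      gcongr
      calc |ψ n x - χ x| ≤ |ψ n x| + |χ x| := abs_sub _ _
        _ ≤ M * (1 + ‖x‖) + M * (1 + ‖x‖) := add_le_add (hn.2 x) (hχ.2 x)
        _ = _ := by ring
    · have := (((h x).sub_const (χ x)).pow 2).mul_const (fInf K x)
      simpa using this
  rw [integral_zero] at h1
  have h2 := h1.sqrt
  rw [Real.sqrt_zero] at h2
  refine h2.congr' ?_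
  filter_upwards [hψ] with n hn
  rw [← hn.norm_lift_sub_sq hK hχ, Real.sqrt_sq (norm_nonneg _)]

theorem fderiv_trig (k : E d) (θ : ℝ) (x : E d) :
    HasFDerivAt (trig k θ) (-(Real.sin (inner ℝ k x - θ)) • innerSL ℝ k) x := by
  have h1 : HasFDerivAt (fun x : E d => inner ℝ k x - θ) (innerSL ℝ k) x :=
    ((innerSL ℝ k).hasFDerivAt (x := x)).sub_const θ
  exact h1.cos

theorem contDiff_trig (k : E d) (θ : ℝ) : ContDiff ℝ ∞ (trig k θ) := by
  unfold trig
  exact Real.contDiff_cos.comp ((contDiff_const.inner ℝ contDiff_id).sub contDiff_const)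

theorem hasFDerivAt_sin_inner (k : E d) (θ : ℝ) (x : E d) :
    HasFDerivAt (fun x => Real.sin (inner ℝ k x - θ)) (trig k θ x • innerSL ℝ k) x := by
  have h1 : HasFDerivAt (fun x : E d => inner ℝ k x - θ) (innerSL ℝ k) x :=
    ((innerSL ℝ k).hasFDerivAt (x := x)).sub_const θ
  exact h1.sin

theorem fpAdjoint_trig (C D : Mat d) (k : E d) (θ : ℝ) (x : E d) :
    fpAdjoint C D (trig k θ) x = trigAdjoint C D θ k x := by
  rw [fpAdjoint_eq ((contDiff_trig k θ).of_le (by norm_cast))]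
  have h1 : ∀ v y, fderiv ℝ (trig k θ) y v = -(Real.sin (inner ℝ k y - θ)) * inner ℝ k v := by
    intro v y
    rw [(fderiv_trig k θ y).fderiv]
    simp
  have h2 : ∀ u v, fderiv ℝ (fun y => fderiv ℝ (trig k θ) y v) x u =
      -trig k θ x * (inner ℝ k u * inner ℝ k v) := by
    intro u v
    have e : HasFDerivAt (fun y => -(Real.sin (inner ℝ k y - θ)) * inner ℝ k v) _ x :=
      (hasFDerivAt_sin_inner k θ x).neg.mul_const (inner ℝ k v)
    simp_rw [h1]
    rw [e.fderiv]
    simp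
    ring
  simp_rw [h2]
  rw [← Finset.mul_sum, sum_inner_single_mul, h1, trigAdjoint, ← inner_act_right]
  ring

theorem continuous_fpAdjoint {φ : E d → ℝ} (hφ : ContDiff ℝ ∞ φ) (C D : Mat d) :
    Continuous (fpAdjoint C D φ) := by
  have h1 : ContDiff ℝ 1 (fderiv ℝ φ) := hφ.fderiv_right (by norm_cast)
  have h2 : ∀ v : E d, Continuous fun x => fderiv ℝ (fun y => fderiv ℝ φ y v) x := fun v =>
    (h1.clm_apply contDiff_const).continuous_fderiv one_ne_zero
  rw [funext (fpAdjoint_eq (hφ.of_le (by norm_cast)) C D)]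
  refine (continuous_finsetSum _ fun i _ => ?_).sub ?_
  · exact (h2 _).clm_apply continuous_const
  · exact h1.continuous.clm_apply (act C).continuous

/-- The formal adjoint is a local operator. -/
theorem fpAdjoint_congr {φ ψ : E d → ℝ} {x : E d} (h : φ =ᶠ[𝓝 x] ψ) (hφ : ContDiff ℝ ∞ φ)
    (hψ : ContDiff ℝ ∞ ψ) (C D : Mat d) : fpAdjoint C D φ x = fpAdjoint C D ψ x := by
  rw [fpAdjoint_eq (hφ.of_le (by norm_cast)), fpAdjoint_eq (hψ.of_le (by norm_cast))]
  have h1 : ∀ v, (fun y => fderiv ℝ φ y v) =ᶠ[𝓝 x] fun y => fderiv ℝ ψ y v := by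
    intro v
    filter_upwards [h.fderiv (𝕜 := ℝ)] with y hy
    rw [hy]
  rw [h.fderiv_eq]
  congr 1
  refine Finset.sum_congr rfl fun i _ => ?_
  rw [(h1 _).fderiv_eq]

/-- A trigonometric function cut off at distance `1 / ε` from the origin. -/
noncomputable def cutoffTrig (χ : E d → ℝ) (k : E d) (θ ε : ℝ) (x : E d) : ℝ :=
  χ (ε • x) * trig k θ x

theorem contDiff_cutoffTrig {χ : E d → ℝ} (hχ : ContDiff ℝ ∞ χ) (k : E d) (θ ε : ℝ) :
    ContDiff ℝ ∞ (cutoffTrig χ k θ ε) :=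
  (hχ.comp (contDiff_const_smul ε)).mul (contDiff_trig k θ)

theorem hasCompactSupport_cutoffTrig {χ : E d → ℝ} (hc : HasCompactSupport χ) (k : E d) (θ : ℝ)
    {ε : ℝ} (hε : ε ≠ 0) : HasCompactSupport (cutoffTrig χ k θ ε) :=
  (hc.comp_smul hε).mul_right

/-- The adjoint operator applied to the cut-off trigonometric functions has linear growth, uniformly
in the cut-off parameter. -/
theorem exists_linearGrowth_cutoffTrig {χ : E d → ℝ} (hχ : ContDiff ℝ ∞ χ)
    (hc : HasCompactSupport χ) (C D : Mat d) (k : E d) (θ : ℝ) :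
    ∃ M, ∀ ε, 0 ≤ ε → ε ≤ 1 → LinearGrowth M (fpAdjoint C D (cutoffTrig χ k θ ε)) := by
  have hf1 : ContDiff ℝ 1 (fderiv ℝ χ) := hχ.fderiv_right (by norm_cast)
  have hχ1 : ContDiff ℝ 1 χ := hχ.of_le (by norm_cast)
  have hχd : Differentiable ℝ χ := hχ1.differentiable one_ne_zero
  have hfv : ∀ v : E d, ContDiff ℝ 1 fun y => fderiv ℝ χ y v := fun v =>
    hf1.clm_apply contDiff_const
  obtain ⟨M0, hM0⟩ := hχ.continuous.bounded_above_of_compact_support hc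
  obtain ⟨M1, hM1⟩ := hf1.continuous.bounded_above_of_compact_support (hc.fderiv ℝ)
  have hM2 : ∀ v : E d, ∃ M, ∀ y, ‖fderiv ℝ (fun y => fderiv ℝ χ y v) y‖ ≤ M := fun v =>
    ((hfv v).continuous_fderiv one_ne_zero).bounded_above_of_compact_support
      ((hc.fderiv_apply ℝ v).fderiv ℝ)
  choose M2 hM2 using hM2
  have b0 : 0 ≤ M0 := (norm_nonneg _).trans (hM0 0)
  have b1 : 0 ≤ M1 := (norm_nonneg _).trans (hM1 0)
  have b2 : ∀ v, 0 ≤ M2 v := fun v => (norm_nonneg _).trans (hM2 v 0)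
  have hsin : ∀ y : E d, |Real.sin (inner ℝ k y - θ)| ≤ 1 := fun y => Real.abs_sin_le_one _
  have htrig : ∀ y : E d, |trig k θ y| ≤ 1 := abs_trig_le_one k θ
  -- first derivatives of the cut-off function
  have hd1 : ∀ ε v y, fderiv ℝ (cutoffTrig χ k θ ε) y v =
      χ (ε • y) * (-(Real.sin (inner ℝ k y - θ)) * inner ℝ k v) +
        trig k θ y * (ε * fderiv ℝ χ (ε • y) v) := by
    intro ε v y
    have e1 : HasFDerivAt (fun y : E d => ε • y) (ε • ContinuousLinearMap.id ℝ (E d)) y :=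
      (hasFDerivAt_id y).const_smul ε
    have e2 := (hχd (ε • y)).hasFDerivAt.comp y e1
    have e3 := e2.mul (fderiv_trig k θ y)
    have e4 : cutoffTrig χ k θ ε = (χ ∘ fun y => ε • y) * trig k θ := rfl
    rw [e4, e3.fderiv]
    simp
  have hb1 : ∀ ε, 0 ≤ ε → ε ≤ 1 → ∀ v y, |fderiv ℝ (cutoffTrig χ k θ ε) y v| ≤
      (M0 * ‖k‖ + M1) * ‖v‖ := by
    intro ε h0 h1 v y
    rw [hd1]
    have e1 : |χ (ε • y)| ≤ M0 := hM0 _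
    have e2 : |fderiv ℝ χ (ε • y) v| ≤ M1 * ‖v‖ :=
      ((fderiv ℝ χ (ε • y)).le_opNorm v).trans (by gcongr; exact hM1 _)
    have e3 : |inner ℝ k v| ≤ ‖k‖ * ‖v‖ := abs_real_inner_le_norm _ _
    calc _ ≤ |χ (ε • y) * (-(Real.sin (inner ℝ k y - θ)) * inner ℝ k v)| +
          |trig k θ y * (ε * fderiv ℝ χ (ε • y) v)| := abs_add_le _ _
      _ ≤ M0 * (1 * (‖k‖ * ‖v‖)) + 1 * (1 * (M1 * ‖v‖)) := by
        rw [abs_mul, abs_mul, abs_mul, abs_mul, abs_neg, abs_of_nonneg h0]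
        gcongr
        · exact hsin y
        · exact htrig y
      _ = _ := by ring
  -- second derivatives
  have hb2 : ∀ ε, 0 ≤ ε → ε ≤ 1 → ∀ u v x,
      |fderiv ℝ (fun y => fderiv ℝ (cutoffTrig χ k θ ε) y v) x u| ≤
      (M1 * ‖k‖ * ‖v‖ + M0 * ‖k‖ * (‖k‖ * ‖v‖) + (M1 * ‖v‖) * ‖k‖ + M2 v) * ‖u‖ := by
    intro ε h0 h1 u v x
    have e0 : HasFDerivAt (fun y : E d => ε • y) (ε • ContinuousLinearMap.id ℝ (E d)) x :=
      (hasFDerivAt_id x).const_smul ε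
    have e1 := (hχd (ε • x)).hasFDerivAt.comp x e0
    have e2 := ((hasFDerivAt_sin_inner k θ x).neg).mul_const (inner ℝ k v)
    have e3 := (((hfv v).differentiable one_ne_zero (ε • x)).hasFDerivAt.comp x e0).const_mul ε
    have e4 : HasFDerivAt (((χ ∘ fun y => ε • y) *
        fun y => -(Real.sin (inner ℝ k y - θ)) * inner ℝ k v) +
        trig k θ * fun y => ε * ((fun y => fderiv ℝ χ y v) ∘ fun y => ε • y) y) _ x :=
      (e1.mul e2).add ((fderiv_trig k θ x).mul e3)
    have e5 : (fun y => fderiv ℝ (cutoffTrig χ k θ ε) y v) = ((χ ∘ fun y => ε • y) *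
        fun y => -(Real.sin (inner ℝ k y - θ)) * inner ℝ k v) +
        trig k θ * fun y => ε * ((fun y => fderiv ℝ χ y v) ∘ fun y => ε • y) y := by
      funext y
      rw [hd1]
      rfl
    have e6 := e4.fderiv
    have a1 : |χ (ε • x)| ≤ M0 := hM0 _
    have a2 : |fderiv ℝ χ (ε • x) u| ≤ M1 * ‖u‖ :=
      ((fderiv ℝ χ (ε • x)).le_opNorm u).trans (by gcongr; exact hM1 _)
    have a2' : |fderiv ℝ χ (ε • x) v| ≤ M1 * ‖v‖ :=
      ((fderiv ℝ χ (ε • x)).le_opNorm v).trans (by gcongr; exact hM1 _)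
    have a3 : |fderiv ℝ (fun y => fderiv ℝ χ y v) (ε • x) u| ≤ M2 v * ‖u‖ :=
      ((fderiv ℝ (fun y => fderiv ℝ χ y v) (ε • x)).le_opNorm u).trans (by gcongr; exact hM2 v _)
    have a4 : |inner ℝ k v| ≤ ‖k‖ * ‖v‖ := abs_real_inner_le_norm _ _
    have a5 : |inner ℝ k u| ≤ ‖k‖ * ‖u‖ := abs_real_inner_le_norm _ _
    have e7 : fderiv ℝ (fun y => fderiv ℝ (cutoffTrig χ k θ ε) y v) x u =
        (ε * fderiv ℝ χ (ε • x) u) * (-(Real.sin (inner ℝ k x - θ)) * inner ℝ k v) +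
        χ (ε • x) * (-(trig k θ x * inner ℝ k u) * inner ℝ k v) +
        (-(Real.sin (inner ℝ k x - θ)) * inner ℝ k u) * (ε * fderiv ℝ χ (ε • x) v) +
        trig k θ x * (ε * (ε * fderiv ℝ (fun y => fderiv ℝ χ y v) (ε • x) u)) := by
      rw [e5, e6]
      simp
      ring
    rw [e7]
    calc _ ≤ |(ε * fderiv ℝ χ (ε • x) u) * (-(Real.sin (inner ℝ k x - θ)) * inner ℝ k v)| +
          |χ (ε • x) * (-(trig k θ x * inner ℝ k u) * inner ℝ k v)| +
          |(-(Real.sin (inner ℝ k x - θ)) * inner ℝ k u) * (ε * fderiv ℝ χ (ε • x) v)| +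
          |trig k θ x * (ε * (ε * fderiv ℝ (fun y => fderiv ℝ χ y v) (ε • x) u))| :=
          (abs_add_le _ _).trans (add_le_add_left (abs_add_three _ _ _) _)
      _ ≤ (1 * (M1 * ‖u‖)) * (1 * (‖k‖ * ‖v‖)) + M0 * ((1 * (‖k‖ * ‖u‖)) * (‖k‖ * ‖v‖)) +
          (1 * (‖k‖ * ‖u‖)) * (1 * (M1 * ‖v‖)) + 1 * (1 * (1 * (M2 v * ‖u‖))) := by
        simp only [abs_mul, abs_neg, abs_of_nonneg h0]
        have := hsin x
        have := htrig x
        gcongr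
      _ = _ := by ring
  refine ⟨∑ i, (M1 * ‖k‖ * ‖act D.transpose (EuclideanSpace.single i 1)‖ +
    M0 * ‖k‖ * (‖k‖ * ‖act D.transpose (EuclideanSpace.single i 1)‖) +
    (M1 * ‖act D.transpose (EuclideanSpace.single i 1)‖) * ‖k‖ +
    M2 (act D.transpose (EuclideanSpace.single i 1))) + (M0 * ‖k‖ + M1) * ‖act C‖,
    fun ε h0 h1 => ⟨continuous_fpAdjoint (contDiff_cutoffTrig hχ k θ ε) C D, fun x => ?_⟩⟩
  rw [fpAdjoint_eq ((contDiff_cutoffTrig hχ k θ ε).of_le (by norm_cast)), add_mul]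
  refine (abs_sub _ _).trans (add_le_add ?_ ?_)
  · refine (Finset.abs_sum_le_sum_abs _ _).trans ?_
    rw [Finset.sum_mul]
    refine Finset.sum_le_sum fun i _ => ?_
    refine (hb2 ε h0 h1 _ _ x).trans ?_
    have : ‖(EuclideanSpace.single i 1 : E d)‖ ≤ 1 + ‖x‖ := by simp
    have := b2 (act D.transpose (EuclideanSpace.single i 1))
    gcongr
  · refine (hb1 ε h0 h1 _ x).trans ?_
    rw [mul_assoc _ ‖act C‖]
    gcongr
    refine ((act C).le_opNorm x).trans ?_
    gcongr
    linarith

/-- A solution also satisfies the equation tested against trigonometric functions. -/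
theorem IsSolution.hasDerivAt_cosTransform (hK : K.PosDef) {f₀ : H K} {g : ℝ → H K}
    (hg : IsSolution K C D f₀ g) (θ : ℝ) (k : E d) {t : ℝ} (ht : 0 < t) :
    HasDerivAt (fun s => cosTransform (g s) θ k)
      (∫ x, (g t : E d → ℝ) x * trigAdjoint C D θ k x) t := by
  let χ : ContDiffBump (0 : E d) := ⟨1, 2, one_pos, one_lt_two⟩
  have hχ : ContDiff ℝ ∞ (χ : E d → ℝ) := χ.contDiff
  have hc : HasCompactSupport (χ : E d → ℝ) := χ.hasCompactSupport
  let ε : ℕ → ℝ := fun n => 1 / ((n : ℝ) + 1)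
  have hε0 : ∀ n, 0 < ε n := fun n => Nat.one_div_pos_of_nat
  have hε1 : ∀ n, ε n ≤ 1 := fun n => by
    rw [div_le_one (by positivity)]
    linarith [(Nat.cast_nonneg n : (0 : ℝ) ≤ n)]
  have hεt : Tendsto ε atTop (𝓝 0) := tendsto_one_div_add_atTop_nhds_zero_nat
  obtain ⟨M, hM⟩ := exists_linearGrowth_cutoffTrig hχ hc C D k θ
  -- near every point the cut-off function eventually agrees with the trigonometric function
  have hloc : ∀ x : E d, ∀ᶠ n in atTop, cutoffTrig χ k θ (ε n) =ᶠ[𝓝 x] trig k θ := by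
    intro x
    have h1 : Tendsto (fun n => ε n * (‖x‖ + 1)) atTop (𝓝 0) := by
      simpa using hεt.mul_const (‖x‖ + 1)
    filter_upwards [h1.eventually (gt_mem_nhds one_pos)] with n hn
    filter_upwards [Metric.ball_mem_nhds x one_pos] with y hy
    have hy1 : ‖y‖ ≤ ‖x‖ + 1 := by
      have h := norm_le_norm_add_norm_sub' y x
      rw [Metric.mem_ball, dist_eq_norm] at hy
      linarith
    have : χ (ε n • y) = 1 := by
      refine χ.one_of_mem_closedBall ?_
      rw [mem_closedBall_zero_iff, norm_smul, Real.norm_of_nonneg (hε0 n).le]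
      exact (mul_le_mul_of_nonneg_left hy1 (hε0 n).le).trans hn.le
    rw [cutoffTrig, this, one_mul]
  have hφlin : ∀ n, LinearGrowth 1 (cutoffTrig χ k θ (ε n)) := fun n =>
    linearGrowth_of_bounded (contDiff_cutoffTrig hχ k θ (ε n)).continuous fun x => by
      rw [cutoffTrig, abs_mul, abs_of_nonneg χ.nonneg]
      exact mul_le_one₀ χ.le_one (abs_nonneg _) (abs_trig_le_one k θ x)
  have hlim0 : Tendsto (fun n => lift K (cutoffTrig χ k θ (ε n))) atTop (𝓝 (lift K (trig k θ))) :=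
    tendsto_lift hK (Eventually.of_forall hφlin) (linearGrowth_trig k θ) fun x =>
      tendsto_const_nhds.congr' (by
        filter_upwards [hloc x] with n hn
        exact hn.self_of_nhds.symm)
  have hlim1 : Tendsto (fun n => lift K (fpAdjoint C D (cutoffTrig χ k θ (ε n)))) atTop
      (𝓝 (lift K (trigAdjoint C D θ k))) := by
    refine tendsto_lift hK (M := max M _) (Eventually.of_forall fun n =>
      (hM _ (hε0 n).le (hε1 n)).mono (le_max_left _ _))
      ((linearGrowth_trigAdjoint C D θ k).mono (le_max_right _ _)) fun x =>
      tendsto_const_nhds.congr' ?_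
    filter_upwards [hloc x] with n hn
    rw [← fpAdjoint_trig]
    exact (fpAdjoint_congr hn (contDiff_cutoffTrig hχ k θ _) (contDiff_trig k θ) C D).symm
  obtain ⟨B, hB⟩ := (isCompact_Icc (a := t / 2) (b := 2 * t)).exists_bound_of_continuousOn
    (hg.continuousOn.mono fun s hs => (half_pos ht).le.trans hs.1)
  have hmem : t ∈ Set.Ioo (t / 2) (2 * t) := ⟨by linarith, by linarith⟩
  refine hasDerivAt_of_tendstoUniformlyOn (𝕜 := ℝ) (l := atTop) (s := Set.Ioo (t / 2) (2 * t))
    (f := fun n s => ∫ x, (g s : E d → ℝ) x * cutoffTrig χ k θ (ε n) x)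
    (f' := fun n s => ∫ x, (g s : E d → ℝ) x * fpAdjoint C D (cutoffTrig χ k θ (ε n)) x)
    (g' := fun s => ∫ x, (g s : E d → ℝ) x * trigAdjoint C D θ k x)
    isOpen_Ioo ?_ (Eventually.of_forall fun n s hs => ?_) (fun s hs => ?_) hmem
  · rw [Metric.tendstoUniformlyOn_iff]
    intro δ hδ
    have hB0 : 0 < |B| + 1 := by positivity
    filter_upwards [(tendsto_iff_norm_sub_tendsto_zero.mp hlim1).eventually
      (gt_mem_nhds (div_pos hδ hB0))] with n hn s hs
    rw [← (linearGrowth_trigAdjoint C D θ k).inner_lift hK,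
      ← (hM _ (hε0 n).le (hε1 n)).inner_lift hK, dist_comm, dist_eq_norm, ← inner_sub_left]
    calc _ ≤ ‖lift K (fpAdjoint C D (cutoffTrig χ k θ (ε n))) - lift K (trigAdjoint C D θ k)‖ *
          ‖g s‖ := norm_inner_le_norm _ _
      _ ≤ ‖lift K (fpAdjoint C D (cutoffTrig χ k θ (ε n))) - lift K (trigAdjoint C D θ k)‖ *
          (|B| + 1) := by
        gcongr
        have := hB s ⟨hs.1.le, hs.2.le⟩
        linarith [le_abs_self B]
      _ < δ / (|B| + 1) * (|B| + 1) := by gcongr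
      _ = δ := div_mul_cancel₀ _ hB0.ne'
  · exact hg.equation _ (contDiff_cutoffTrig hχ k θ _)
      (hasCompactSupport_cutoffTrig hc k θ (hε0 n).ne') s ((half_pos ht).trans hs.1)
  · have h1 : Tendsto (fun n => inner ℝ (lift K (cutoffTrig χ k θ (ε n))) (g s)) atTop
        (𝓝 (inner ℝ (lift K (trig k θ)) (g s))) := hlim0.inner tendsto_const_nhds
    rw [(linearGrowth_trig k θ).inner_lift hK] at h1
    exact h1.congr fun n => (hφlin n).inner_lift hK (g s)

/-- Chain rule along a curve for a function of two variables whose derivative in the first variable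
is continuous. -/
theorem hasDerivAt_along_curve {V : Type*} [NormedAddCommGroup V] {F F' : ℝ → V → ℝ} {κ : ℝ → V}
    {s c : ℝ} (hF : ∀ᶠ r in 𝓝 s, ∀ k, HasDerivAt (fun r => F r k) (F' r k) r)
    (hF' : ContinuousAt (Function.uncurry F') (s, κ s)) (hκ : ContinuousAt κ s)
    (h2 : HasDerivAt (fun r => F s (κ r)) c s) :
    HasDerivAt (fun r => F r (κ r)) (F' s (κ s) + c) s := by
  have h1 : HasDerivAt (fun r => F r (κ r) - F s (κ r)) (F' s (κ s)) s := by
    rw [hasDerivAt_iff_isLittleO, Asymptotics.isLittleO_iff]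
    intro δ hδ
    obtain ⟨η, hη, hηF⟩ := Metric.continuousAt_iff.mp hF' δ hδ
    obtain ⟨η', hη', hη'F⟩ := Metric.eventually_nhds_iff.mp hF
    filter_upwards [Metric.ball_mem_nhds s (lt_min hη hη'), hκ (Metric.ball_mem_nhds (κ s) hη)]
      with r hr hr2
    have hball : ∀ q ∈ Set.uIcc s r, dist q s < η ∧ dist q s < η' := by
      intro q hq
      have h := Set.abs_sub_left_of_mem_uIcc hq
      rw [Metric.mem_ball, Real.dist_eq] at hr
      rw [Real.dist_eq]
      exact ⟨h.trans_lt (hr.trans_le (min_le_left _ _)),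
        h.trans_lt (hr.trans_le (min_le_right _ _))⟩
    have hmv := (convex_uIcc s r).norm_image_sub_le_of_norm_hasDerivWithin_le
      (f := fun q => F q (κ r) - q * F' s (κ s))
      (f' := fun q => F' q (κ r) - 1 * F' s (κ s)) (C := δ)
      (fun q hq => ((hη'F (hball q hq).2 (κ r)).sub
        ((hasDerivAt_id q).mul_const _)).hasDerivWithinAt)
      (fun q hq => by
        have := hηF (x := (q, κ r)) (by
          rw [Prod.dist_eq]
          exact max_lt (hball q hq).1 hr2)
        rw [Real.dist_eq] at this
        rw [one_mul]
        exact this.le) Set.left_mem_uIcc Set.right_mem_uIcc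
    convert hmv using 2
    simp only [smul_eq_mul]
    ring
  refine (h1.add h2).congr_of_eventuallyEq (Eventually.of_forall fun r => ?_)
  simp

theorem continuousAt_integral_trigAdjoint (hK : K.PosDef) (C D : Mat d) (θ : ℝ) {g : ℝ → H K}
    {s : ℝ} (hg : ContinuousAt g s) (k : E d) :
    ContinuousAt (Function.uncurry fun r k => ∫ x, (g r : E d → ℝ) x * trigAdjoint C D θ k x)
      (s, k) := by
  have h1 : ContinuousAt (fun k => lift K (trigAdjoint C D θ k)) k := by
    refine tendsto_lift hK (M := (‖act D‖ + ‖act C.transpose‖) * (1 + (‖k‖ + 1)) ^ 2) ?_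
      ((linearGrowth_trigAdjoint C D θ k).mono (by gcongr; linarith)) fun x => ?_
    · filter_upwards [Metric.ball_mem_nhds k one_pos] with l hl
      refine (linearGrowth_trigAdjoint C D θ l).mono ?_
      have : ‖l‖ ≤ ‖k‖ + 1 := by
        have h := norm_le_norm_add_norm_sub' l k
        rw [Metric.mem_ball, dist_eq_norm] at hl
        linarith
      gcongr
    · have : Continuous fun k => trigAdjoint C D θ k x := by
        unfold trigAdjoint trig; fun_prop
      exact this.tendsto k
  have h2 : (Function.uncurry fun r k => ∫ x, (g r : E d → ℝ) x * trigAdjoint C D θ k x) =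
      fun p : ℝ × E d => inner ℝ (lift K (trigAdjoint C D θ p.2)) (g p.1) := by
    funext p
    rw [(linearGrowth_trigAdjoint C D θ p.2).inner_lift hK]
    rfl
  rw [h2]
  have h3 : ContinuousAt (fun p : ℝ × E d => lift K (trigAdjoint C D θ p.2)) (s, k) :=
    ContinuousAt.comp (f := Prod.snd) (x := (s, k)) h1 continuousAt_snd
  have h4 : ContinuousAt (fun p : ℝ × E d => g p.1) (s, k) :=
    ContinuousAt.comp (f := Prod.fst) (x := (s, k)) hg continuousAt_fst
  exact ContinuousAt.inner (𝕜 := ℝ) h3 h4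

/-- Along the characteristics `s ↦ e^{-(T-s)Cᵀ} k`, the pairing of a solution with the waves is
constant. -/
theorem IsSolution.inner_wave_eq (hK : K.PosDef)
    (hCD : C * K + K * C.transpose = (2 : ℝ) • D) {f₀ : H K} {g : ℝ → H K}
    (hg : IsSolution K C D f₀ g) {T : ℝ} (hT : 0 < T) (k : E d) (θ : ℝ) :
    inner ℝ (wave K k θ) (g T) = inner ℝ (wave K (flow (-C.transpose) T k) θ) f₀ := by
  let κ : ℝ → E d := fun s => flow (-C.transpose) (T - s) k
  have hκ : ∀ s, HasDerivAt κ (act C.transpose (κ s)) s := by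
    intro s
    have h := (hasDerivAt_flow (-C.transpose) k (T - s)).scomp s ((hasDerivAt_id s).const_sub T)
    refine h.congr_deriv ?_
    simp [act, κ]
  have hκc : Continuous κ := continuous_iff_continuousAt.mpr fun s => (hκ s).continuousAt
  have hv : ∀ s, 0 < s → HasDerivAt (fun s => inner ℝ (wave K (κ s) θ) (g s)) 0 s := by
    intro s hs
    have hw : HasDerivAt (fun r => cosTransform (g r) θ (κ r)) _ s :=
      hasDerivAt_along_curve (F := fun r k => cosTransform (g r) θ k)
      (F' := fun r k => ∫ x, (g r : E d → ℝ) x * trigAdjoint C D θ k x) (κ := κ)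
      (by
        filter_upwards [lt_mem_nhds hs] with r hr k
        exact hg.hasDerivAt_cosTransform hK θ k hr)
      (continuousAt_integral_trigAdjoint hK C D θ
        (hg.continuousOn.continuousAt (Ici_mem_nhds hs)) _)
      (hκ s).continuousAt
      ((hasFDerivAt_cosTransform hK (g s) θ (κ s)).comp_hasDerivAt s (hκ s))
    -- the normalisation of the waves compensates the diffusion term of the equation
    have hq : HasDerivAt (fun r => inner ℝ (κ r) (act K (κ r)) / 2)
        (inner ℝ (κ s) (act D (κ s))) s := by
      have h := ((hκ s).inner ℝ (((act K).hasFDerivAt (x := κ s)).comp_hasDerivAt s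
        (hκ s))).div_const 2
      refine h.congr_deriv ?_
      rw [← inner_lyapunov hK hCD]
      simp only [Function.comp_apply]
      rw [inner_act_symm hK (act C.transpose (κ s))]
      ring
    have h := hq.exp.mul hw
    simp only [integral_mul_trigAdjoint hK] at h
    refine (h.congr_deriv ?_).congr_of_eventuallyEq (Eventually.of_forall fun r => ?_)
    · ring
    · simp only [inner_wave hK]
      rfl
  have hcont : ContinuousOn (fun s => inner ℝ (wave K (κ s) θ) (g s)) (Set.Icc 0 T) :=
    ContinuousOn.inner (𝕜 := ℝ) ((continuous_wave hK θ).comp hκc).continuousOn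
      (hg.continuousOn.mono Set.Icc_subset_Ici_self)
  obtain ⟨c, hc, hc'⟩ := exists_hasDerivAt_eq_slope _ (fun _ => (0 : ℝ)) hT hcont
    fun s hs => hv s hs.1
  rw [eq_div_iff (by linarith : T - 0 ≠ 0), zero_mul] at hc'
  have h := (sub_eq_zero.mp hc'.symm)
  simp only [κ, sub_self, flow_zero, sub_zero, hg.initial] at h
  exact h

/-- Two solutions with the same initial value have the same pairings with all waves. -/
theorem isPropagator_propagator (hK : K.PosDef) (hD : D.PosSemidef)
    (hCD : C * K + K * C.transpose = (2 : ℝ) • D) : IsPropagator K C D (propagator K C) := by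
  refine fun f₀ => ⟨isSolution_propagator hK hD hCD f₀, fun g hg t ht => ?_⟩
  rcases ht.eq_or_lt with rfl | ht
  · rw [propagator_zero hK, hg.initial]
  · refine sub_eq_zero.mp (eq_zero_of_integral_trig_eq_zero hK fun k θ => ?_)
    have h1 := hg.inner_wave_eq hK hCD ht k θ
    have h2 := inner_secondQuant_wave hK (inner_flow_le hK hD hCD ht.le)
      (inner_flow_conj hK C t) f₀ k θ
    have h3 : inner ℝ (wave K k θ) (g t - propagator K C t f₀) = 0 := by
      rw [inner_sub_right, h1, propagator, h2, sub_self]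
    rw [inner_wave hK] at h3
    exact (mul_eq_zero.mp h3).resolve_left (Real.exp_pos _).ne'

end

/-! ### Admissible pairs and the bound on the spectral gap -/

section

variable {d : ℕ} {K C D : Mat d}

theorem hasGradientAt_fInf (hK : K.PosDef) (x : E d) :
    HasGradientAt (fInf K) (-(fInf K x) • act K⁻¹ x) x := by
  have h1 : HasFDerivAt (fun x : E d => (inner ℝ x (act K⁻¹ x) : ℝ)) _ x :=
    (hasFDerivAt_id x).inner ℝ (act K⁻¹).hasFDerivAt
  have h2 : HasFDerivAt (fInf K) _ x :=
    ((h1.neg.mul_const (2 : ℝ)⁻¹).exp.const_mul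
      (K.det ^ (-(1 / 2 : ℝ)) / (2 * Real.pi) ^ ((d : ℝ) / 2))).congr_of_eventuallyEq
      (Filter.Eventually.of_forall fun x => rfl)
  rw [hasGradientAt_iff_hasFDerivAt]
  refine h2.congr_fderiv ?_
  ext v
  have h3 : inner ℝ x (act K⁻¹ v) = inner ℝ (act K⁻¹ x) v := by
    rw [inner_act_right, transpose_eq_of_posDef hK.inv]
  simp [h3, fInf, real_inner_comm v, div_eq_mul_inv]
  ring

theorem sum_act_single (R : Mat d) :
    ∑ i, (act R (EuclideanSpace.single i 1)) i = R.trace := by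
  simp [act_apply, Matrix.trace]

/-- `L_{C,D} f_∞` is `-f_∞` times a polynomial of degree two; in particular its vanishing at the
origin determines the trace of `C`. -/
theorem fpOp_fInf (hK : K.PosDef) (C D : Mat d) (x : E d) :
    fpOp C D (fInf K) x = -(fInf K x * ((C - D * K⁻¹).trace -
      inner ℝ (act K⁻¹ x) (act (C - D * K⁻¹) x))) := by
  have h1 : (fun y => act D (gradient (fInf K) y) + fInf K y • act C y) =
      fun y => fInf K y • act (C - D * K⁻¹) y := by
    funext y
    rw [(hasGradientAt_fInf hK y).gradient, act_sub, act_mul, map_smul, neg_smul, smul_sub]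
    abel
  have h2 : HasFDerivAt (fun y => fInf K y • act (C - D * K⁻¹) y) _ x :=
    (hasGradientAt_fInf hK x).hasFDerivAt.smul (act (C - D * K⁻¹)).hasFDerivAt
  rw [fpOp, h1, div, h2.fderiv]
  simp only [_root_.add_apply, _root_.smul_apply,
    ContinuousLinearMap.smulRight_apply, InnerProductSpace.toDual_apply_apply, PiLp.add_apply,
    PiLp.smul_apply, smul_eq_mul, Finset.sum_add_distrib, ← Finset.mul_sum, sum_act_single]
  have h3 : ∑ i, inner ℝ (-(fInf K x) • act K⁻¹ x) (EuclideanSpace.single i (1 : ℝ)) *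
      (act (C - D * K⁻¹) x) i = -(fInf K x * inner ℝ (act K⁻¹ x) (act (C - D * K⁻¹) x)) := by
    rw [PiLp.inner_apply, Finset.mul_sum, ← Finset.sum_neg_distrib]
    refine Finset.sum_congr rfl fun i _ => ?_
    simp [EuclideanSpace.inner_single_right]
    ring
  rw [h3]
  ring

theorem trace_eq_of_mem_admissible (hK : K.PosDef) (h : (C, D) ∈ admissible K) :
    C.trace = (D * K⁻¹).trace := by
  have h0 := h.2.2 0
  rw [fpOp_fInf hK] at h0
  have := fInf_pos hK (0 : E d)
  simp only [map_zero, inner_zero_left, sub_zero, neg_eq_zero, mul_eq_zero, this.ne', false_or,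
    Matrix.trace_sub] at h0
  linarith

/-- The Lyapunov equation `C K + K Cᵀ = 2 D` is sufficient for `f_∞` to be a steady state. -/
theorem mem_admissible (hK : K.PosDef) (hD : D.PosSemidef) (ht : D.trace ≤ d)
    (hCD : C * K + K * C.transpose = (2 : ℝ) • D) : (C, D) ∈ admissible K := by
  have hdet := isUnit_det_of_posDef hK
  have hKt := transpose_eq_of_posDef hK
  -- `R = C - D K⁻¹` satisfies `R = -K Rᵀ K⁻¹`: its trace vanishes and `K⁻¹ R` is antisymmetric
  have hR : C - D * K⁻¹ = -(K * (C - D * K⁻¹).transpose * K⁻¹) := by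
    have h1 : (C - D * K⁻¹).transpose = C.transpose - K⁻¹ * D := by
      rw [Matrix.transpose_sub, Matrix.transpose_mul, Matrix.transpose_nonsing_inv, hKt,
        transpose_eq_of_posSemidef hD]
    have h2 : K * (C.transpose - K⁻¹ * D) = K * C.transpose - D := by
      rw [mul_sub, ← mul_assoc, Matrix.mul_nonsing_inv _ hdet, one_mul]
    have h3 : K * C.transpose = (2 : ℝ) • D - C * K := by rw [← hCD]; abel
    have h4 : K * C.transpose - D = D - C * K := by rw [h3, two_smul]; abel
    rw [h1, h2, h4, sub_mul, mul_assoc C, Matrix.mul_nonsing_inv _ hdet, mul_one]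
    abel
  refine ⟨hD, ht, fun x => ?_⟩
  have h1 : (C - D * K⁻¹).trace = 0 := by
    have h := congrArg Matrix.trace hR
    rw [Matrix.trace_neg, Matrix.trace_mul_cycle, Matrix.nonsing_inv_mul _ hdet, one_mul,
      Matrix.trace_transpose] at h
    linarith
  have h2 : inner ℝ (act K⁻¹ x) (act (C - D * K⁻¹) x) = 0 := by
    have h : inner ℝ (act K⁻¹ x) (act (C - D * K⁻¹) x) =
        -inner ℝ (act K⁻¹ x) (act (C - D * K⁻¹) x) := by
      conv_lhs => rw [hR]
      have e : ∀ A : Mat d, act (-A) x = -act A x := fun A => by simp [act]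
      rw [e, inner_neg_right, act_mul, act_mul, inner_act_right K, hKt, act_act_inv hdet,
        inner_act_right, Matrix.transpose_transpose, real_inner_comm]
    linarith
  rw [fpOp_fInf hK, h1, h2]
  simp

theorem exists_eigenvector_lamOpt (hK : K.PosDef) (hd : 0 < d) :
    ∃ u : E d, ‖u‖ = 1 ∧ act K⁻¹ u = lamOpt K • u := by
  have : Nonempty (Fin d) := ⟨⟨0, hd⟩⟩
  have hH := hK.inv.isHermitian
  have h : lamOpt K ∈ spectrum ℝ K⁻¹ := by
    refine Set.Nonempty.csSup_mem ?_ ?_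
    · rw [hH.spectrum_real_eq_range_eigenvalues]; exact Set.range_nonempty _
    · exact Matrix.finite_real_spectrum
  rw [hH.spectrum_real_eq_range_eigenvalues] at h
  obtain ⟨i, hi⟩ := h
  refine ⟨hH.eigenvectorBasis i, hH.eigenvectorBasis.orthonormal.1 i, ?_⟩
  ext j
  have := congrFun (hH.mulVec_eigenvectorBasis i) j
  rw [hi] at this
  simpa [act] using this

theorem lamOpt_pos (hK : K.PosDef) (hd : 0 < d) : 0 < lamOpt K := by
  obtain ⟨u, hu, h⟩ := exists_eigenvector_lamOpt hK hd
  obtain ⟨P, hP, hPu⟩ := exists_factor hK.inv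
  have h1 : lamOpt K = ‖act P.transpose u‖ ^ 2 := by
    rw [← inner_act_self_mul_transpose, ← hP, h, real_inner_smul_right,
      real_inner_self_eq_norm_sq, hu]
    simp
  rw [h1]
  refine pow_pos (norm_pos_iff.mpr fun h0 => ?_) 2
  have : u = 0 := by
    rw [← act_inv_act (P := P.transpose) (by rwa [Matrix.det_transpose]) u, h0, map_zero]
  simp [this] at hu

theorem posSemidef_lamOpt_sub (K : Mat d) (hK : K.PosDef) :
    ((lamOpt K • (1 : Mat d)) - K⁻¹).PosSemidef := by
  rw [Matrix.posSemidef_iff_isHermitian_and_spectrum_nonneg]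
  refine ⟨?_, ?_⟩
  · exact (Matrix.isHermitian_one.smul (IsSelfAdjoint.all _)).sub hK.inv.isHermitian
  · rw [← Algebra.algebraMap_eq_smul_one, ← spectrum.singleton_sub_eq]
    rintro _ ⟨_, rfl, b, hb, rfl⟩
    exact sub_nonneg.mpr (le_csSup (Matrix.finite_real_spectrum).bddAbove hb)

theorem trace_mul_inv_le (hK : K.PosDef) (hD : D.PosSemidef) :
    (D * K⁻¹).trace ≤ lamOpt K * D.trace := by
  obtain ⟨B, hB⟩ := exists_eq_transpose_mul_self hD
  rw [← Matrix.conjTranspose_eq_transpose_of_trivial] at hB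
  have h := ((posSemidef_lamOpt_sub K hK).mul_mul_conjTranspose_same B).trace_nonneg
  rw [Matrix.trace_mul_cycle, ← hB, mul_sub, Matrix.trace_sub, mul_smul_comm, mul_one,
    Matrix.trace_smul, smul_eq_mul] at h
  linarith

theorem mul_spectralGap_le_trace (C : Mat d) : d * spectralGap C ≤ C.trace := by
  have h1 : ((C.map Complex.ofReal).trace).re = C.trace := by
    simp [Matrix.trace]
  rw [← h1, Matrix.trace_eq_sum_roots_charpoly]
  have hmem : ∀ z ∈ (C.map Complex.ofReal).charpoly.roots, spectralGap C ≤ z.re := by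
    intro z hz
    refine csInf_le ((Matrix.finite_spectrum _).image _).bddBelow ⟨z, ?_, rfl⟩
    rw [Matrix.mem_spectrum_iff_isRoot_charpoly]
    exact (Polynomial.mem_roots'.mp hz).2
  have hcard : (C.map Complex.ofReal).charpoly.roots.card = d := by
    rw [IsAlgClosed.card_roots_eq_natDegree, Matrix.charpoly_natDegree_eq_dim, Fintype.card_fin]
  have h2 := Multiset.card_nsmul_le_sum (s := (C.map Complex.ofReal).charpoly.roots.map Complex.re)
    (a := spectralGap C) (by
      intro x hx
      obtain ⟨z, hz, rfl⟩ := Multiset.mem_map.mp hx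
      exact hmem z hz)
  rw [Multiset.card_map, hcard, nsmul_eq_mul] at h2
  refine h2.trans_eq ?_
  exact (map_multiset_sum Complex.reAddGroupHom _).symm

/-- The smallest real part of an eigenvalue is at most the mean `Tr C / d = Tr (D K⁻¹) / d`, and
`K⁻¹` is at most `λ_opt`. -/
theorem spectralGap_le_lamOpt (hK : K.PosDef) (hd : 0 < d) (h : (C, D) ∈ admissible K) :
    spectralGap C ≤ lamOpt K := by
  have h1 := mul_spectralGap_le_trace C
  rw [trace_eq_of_mem_admissible hK h] at h1
  have h2 := h1.trans ((trace_mul_inv_le hK h.1).trans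
    (mul_le_mul_of_nonneg_left h.2.1 (lamOpt_pos hK hd).le))
  rw [mul_comm] at h2
  exact le_of_mul_le_mul_right h2 (by exact_mod_cast hd)

/-- If a definite quadratic form satisfies `⟪A y, R y⟫ = μ ⟪y, R y⟫`, all complex eigenvalues of
`A` have real part `μ`. -/
theorem re_eq_of_mem_spectrum {A R : Mat d} {μ : ℝ} (hR : R.PosDef)
    (h : ∀ y, inner ℝ (act A y) (act R y) = μ * inner ℝ y (act R y)) {z : ℂ}
    (hz : z ∈ spectrum ℂ (A.map Complex.ofReal)) : z.re = μ := by
  rw [← Matrix.spectrum_toLin', ← Module.End.hasEigenvalue_iff_mem_spectrum] at hz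
  obtain ⟨v, hv⟩ := hz.exists_hasEigenvector
  have hAv : (A.map Complex.ofReal).mulVec v = z • v := by
    simpa using hv.apply_eq_smul
  -- with `v = x + i y`, adding the identities for `x` and `y` cancels the imaginary part of `z`
  let x : E d := WithLp.toLp 2 fun i => (v i).re
  let y : E d := WithLp.toLp 2 fun i => (v i).im
  have hx : act A x = z.re • x - z.im • y := by
    ext i
    have := congrArg Complex.re (congrFun hAv i)
    simpa [Matrix.mulVec, dotProduct, act_apply, x, y] using this
  have hy : act A y = z.im • x + z.re • y := by
    ext i
    have := congrArg Complex.im (congrFun hAv i)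
    simp [Matrix.mulVec, dotProduct] at this
    simp [act_apply, x, y, this]
    ring
  have hsymm : inner ℝ y (act R x) = inner ℝ x (act R y) := inner_act_symm hR y x
  have e1 := h x
  have e2 := h y
  rw [hx, inner_sub_left, real_inner_smul_left, real_inner_smul_left] at e1
  rw [hy, inner_add_left, real_inner_smul_left, real_inner_smul_left] at e2
  have hpos : ∀ w : E d, w ≠ 0 → 0 < inner ℝ w (act R w) := by
    intro w hw
    obtain ⟨P, hP, hPu⟩ := exists_factor hR
    rw [hP, inner_act_self_mul_transpose]
    refine pow_pos (norm_pos_iff.mpr fun h0 => hw ?_) 2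
    rw [← act_inv_act (P := P.transpose) (by rwa [Matrix.det_transpose]) w, h0, map_zero]
  have hq : 0 < inner ℝ x (act R x) + inner ℝ y (act R y) := by
    by_cases hx0 : x = 0
    · have hy0 : y ≠ 0 := by
        intro hy0
        refine hv.2 (funext fun i => Complex.ext ?_ ?_)
        · exact congrArg (fun w : E d => w i) hx0
        · exact congrArg (fun w : E d => w i) hy0
      exact add_pos_of_nonneg_of_pos (inner_act_nonneg hR.posSemidef x) (hpos y hy0)
    · exact add_pos_of_pos_of_nonneg (hpos x hx0) (inner_act_nonneg hR.posSemidef y)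
  have : (z.re - μ) * (inner ℝ x (act R x) + inner ℝ y (act R y)) = 0 := by
    rw [hsymm] at e1
    linarith
  have := (mul_eq_zero.mp this).resolve_right hq.ne'
  linarith

theorem spectralGap_eq {A R : Mat d} {μ : ℝ} (hd : 0 < d) (hR : R.PosDef)
    (h : ∀ y, inner ℝ (act A y) (act R y) = μ * inner ℝ y (act R y)) : spectralGap A = μ := by
  have : Nonempty (Fin d) := ⟨⟨0, hd⟩⟩
  have hne : (spectrum ℂ (A.map Complex.ofReal)).Nonempty :=
    spectrum.nonempty_of_isAlgClosed_of_finiteDimensional ℂ _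
  have : Complex.re '' spectrum ℂ (A.map Complex.ofReal) = {μ} := by
    refine Set.Subset.antisymm ?_ ?_
    · rintro _ ⟨z, hz, rfl⟩
      exact re_eq_of_mem_spectrum hR h hz
    · rintro _ rfl
      obtain ⟨z, hz⟩ := hne
      exact ⟨z, hz, re_eq_of_mem_spectrum hR h hz⟩
  rw [spectralGap, this, csInf_singleton]

end

/-! ### The Frobenius norm -/

section

variable {d : ℕ} {K C D : Mat d}

theorem frobNorm_sq (A : Mat d) :
    frobNorm A ^ 2 = ∑ j, ‖act A (EuclideanSpace.single j 1)‖ ^ 2 := by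
  have h : (A.transpose * A).trace = ∑ j, ‖act A (EuclideanSpace.single j 1)‖ ^ 2 := by
    simp [Matrix.trace, Matrix.mul_apply, EuclideanSpace.norm_sq_eq, act_apply, ← pow_two]
  rw [frobNorm, Real.sq_sqrt, h]
  rw [h]; positivity

theorem frobNorm_sq_eq_sum (A : Mat d) : frobNorm A ^ 2 = ∑ i, ∑ j, A i j ^ 2 := by
  rw [frobNorm_sq, Finset.sum_comm]
  simp [EuclideanSpace.norm_sq_eq, act_apply]

theorem frobNorm_nonneg (A : Mat d) : 0 ≤ frobNorm A := Real.sqrt_nonneg _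

open scoped Matrix.Norms.Frobenius in
theorem frobNorm_eq_norm (A : Mat d) : frobNorm A = ‖A‖ := by
  rw [Matrix.frobenius_norm_def, ← Real.sqrt_eq_rpow, ← Real.sqrt_sq (frobNorm_nonneg A),
    frobNorm_sq_eq_sum]
  simp

open scoped Matrix.Norms.Frobenius in
theorem frobNorm_add_le (A B : Mat d) : frobNorm (A + B) ≤ frobNorm A + frobNorm B := by
  simp only [frobNorm_eq_norm]
  exact norm_add_le A B

open scoped Matrix.Norms.Frobenius in
theorem frobNorm_smul (r : ℝ) (A : Mat d) : frobNorm (r • A) = |r| * frobNorm A := by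
  simp only [frobNorm_eq_norm]
  exact norm_smul r A

theorem frobNorm_transpose (A : Mat d) : frobNorm A.transpose = frobNorm A := by
  rw [← sq_eq_sq₀ (frobNorm_nonneg _) (frobNorm_nonneg _), frobNorm_sq_eq_sum, frobNorm_sq_eq_sum,
    Finset.sum_comm]
  rfl

theorem frobNorm_mul_le (A B : Mat d) : frobNorm (A * B) ≤ ‖act A‖ * frobNorm B := by
  refine le_of_sq_le_sq ?_ (mul_nonneg (norm_nonneg _) (frobNorm_nonneg _))
  rw [mul_pow, frobNorm_sq, frobNorm_sq, Finset.mul_sum]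
  refine Finset.sum_le_sum fun j _ => ?_
  rw [act_mul, ← mul_pow]
  gcongr
  exact (act A).le_opNorm _

theorem norm_act_transpose (A : Mat d) : ‖act A.transpose‖ = ‖act A‖ := by
  rw [← adjoint_act, LinearIsometryEquiv.norm_map]

theorem frobNorm_mul_le_right (A B : Mat d) : frobNorm (A * B) ≤ frobNorm A * ‖act B‖ := by
  rw [← frobNorm_transpose, Matrix.transpose_mul, mul_comm, ← norm_act_transpose,
    ← frobNorm_transpose A]
  exact frobNorm_mul_le _ _

theorem norm_act_mul_transpose (P : Mat d) : ‖act (P * P.transpose)‖ = ‖act P‖ ^ 2 := by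
  have h : act (P * P.transpose) =
      ContinuousLinearMap.adjoint (act P.transpose) ∘L act P.transpose := by
    ext1 x
    rw [adjoint_act, Matrix.transpose_transpose, act_mul]
    rfl
  rw [h, ContinuousLinearMap.norm_adjoint_comp_self, norm_act_transpose, sq]

/-- By the C⋆-identity, the condition number of `P Pᵀ` is the square of that of `P`. -/
theorem norm_act_mul_norm_act_inv {P : Mat d} (hKP : K = P * P.transpose) :
    ‖act P‖ * ‖act P⁻¹‖ = Real.sqrt (condNumber K) := by
  have h : K⁻¹ = P⁻¹.transpose * P⁻¹.transpose.transpose := by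
    rw [hKP, Matrix.mul_inv_rev, Matrix.transpose_transpose, Matrix.transpose_nonsing_inv]
  rw [condNumber, h, norm_act_mul_transpose, norm_act_transpose, hKP, norm_act_mul_transpose,
    ← mul_pow, Real.sqrt_sq (by positivity)]

/-! ### The optimal drift and diffusion matrices -/

/-- The vector `(1, …, 1)`. -/
noncomputable def oneVec (d : ℕ) : E d := WithLp.toLp 2 1

theorem norm_sq_oneVec : ‖oneVec d‖ ^ 2 = d := by
  simp [EuclideanSpace.norm_sq_eq, oneVec]

/-- An orthogonal matrix mapping `v` to `w`. -/
theorem exists_orthogonal_act_eq {v w : E d} (h : ‖v‖ = ‖w‖) :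
    ∃ W : Mat d, W * W.transpose = 1 ∧ act W v = w := by
  let T := (Submodule.span ℝ {v - w})ᗮ.reflection
  let W : Mat d := (Matrix.toEuclideanCLM (n := Fin d) (𝕜 := ℝ)).symm
    (T.toContinuousLinearEquiv : E d →L[ℝ] E d)
  have hW : ∀ x, act W x = T x := fun x => by simp [act, W]
  refine ⟨W, ?_, (hW v).trans (Submodule.reflection_sub h)⟩
  rw [mul_eq_one_comm]
  refine (Matrix.toEuclideanCLM (n := Fin d) (𝕜 := ℝ)).injective ?_
  ext1 x
  refine ext_inner_left ℝ fun y => ?_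
  change inner ℝ y (act (W.transpose * W) x) = inner ℝ y (act 1 x)
  rw [act_mul, act_one, inner_act_right, Matrix.transpose_transpose, hW, hW,
    LinearIsometryEquiv.inner_map_map]

/-- A factorisation `K = P Pᵀ` for which `P (1, …, 1)` is an eigenvector of `K⁻¹` with the largest
eigenvalue. -/
theorem exists_factor_oneVec (hK : K.PosDef) (hd : 0 < d) :
    ∃ P : Mat d, K = P * P.transpose ∧ IsUnit P.det ∧
      act K⁻¹ (act P (oneVec d)) = lamOpt K • act P (oneVec d) := by
  obtain ⟨u, hu, hKu⟩ := exists_eigenvector_lamOpt hK hd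
  obtain ⟨Q, hQ, hQu⟩ := exists_factor hK
  have hl := lamOpt_pos hK hd
  have h1 : ‖act Q⁻¹ u‖ ^ 2 = lamOpt K := by
    have h : K⁻¹ = Q⁻¹.transpose * Q⁻¹.transpose.transpose := by
      rw [hQ, Matrix.mul_inv_rev, Matrix.transpose_transpose, Matrix.transpose_nonsing_inv]
    have h2 := inner_act_self_mul_transpose Q⁻¹.transpose u
    rw [← h, hKu, Matrix.transpose_transpose, real_inner_smul_right, real_inner_self_eq_norm_sq,
      hu] at h2
    linarith
  -- the norm of `s u` is such that `Q⁻¹ (s u)` is as long as `(1, …, 1)`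
  let s : ℝ := Real.sqrt (d / lamOpt K)
  have h2 : ‖oneVec d‖ = ‖act Q⁻¹ (s • u)‖ := by
    rw [← sq_eq_sq₀ (norm_nonneg _) (norm_nonneg _), map_smul, norm_smul, mul_pow, h1,
      norm_sq_oneVec, Real.norm_eq_abs, sq_abs, Real.sq_sqrt (by positivity),
      div_mul_cancel₀ _ hl.ne']
  obtain ⟨W, hW, hWv⟩ := exists_orthogonal_act_eq h2
  have hP : act (Q * W) (oneVec d) = s • u := by rw [act_mul, hWv, act_act_inv hQu]
  refine ⟨Q * W, ?_, ?_, ?_⟩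
  · rw [Matrix.transpose_mul, mul_assoc, ← mul_assoc W, hW, one_mul, hQ]
  · rw [Matrix.det_mul]
    refine hQu.mul (isUnit_iff_ne_zero.mpr fun h0 => ?_)
    have := congrArg Matrix.det hW
    simp [h0] at this
  · rw [hP, map_smul, hKu, smul_comm]

/-- The matrix with all entries equal to `1`. -/
def ones (d : ℕ) : Mat d := Matrix.of fun _ _ => 1

/-- The skew-symmetric matrix with entries `(q_j + q_k) / (q_k - q_j)`; by the convention for
division by zero the diagonal vanishes. -/
noncomputable def skew (q : Fin d → ℝ) : Mat d :=
  Matrix.of fun j k => (q j + q k) / (q k - q j)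

theorem skew_transpose (q : Fin d → ℝ) : (skew q).transpose = -skew q := by
  ext j k
  simp only [skew, Matrix.transpose_apply, Matrix.of_apply, Matrix.neg_apply]
  rw [← neg_sub (q k) (q j), div_neg, add_comm]

theorem ones_transpose : (ones d).transpose = ones d := rfl

theorem ones_eq_vecMulVec : ones d = Matrix.vecMulVec (oneVec d).ofLp (oneVec d).ofLp := by
  ext i j
  simp [ones, oneVec, Matrix.vecMulVec_apply]

/-- The matrix `1 1ᵀ + J`, with `J` the matrix `skew q`, solves the Lyapunov equation
`Aᵀ Q + Q A = 2 Q` for the diagonal matrix `Q` with entries `q`. -/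
theorem inner_ones_add_skew {q : Fin d → ℝ} (hq : Function.Injective q) (w : E d) :
    inner ℝ (act (ones d + skew q) w) (act (Matrix.diagonal q) w) =
      inner ℝ w (act (Matrix.diagonal q) w) := by
  have h : (ones d + skew q).transpose * Matrix.diagonal q +
      Matrix.diagonal q * (ones d + skew q) = (2 : ℝ) • Matrix.diagonal q := by
    ext j k
    simp only [Matrix.add_apply, Matrix.mul_diagonal, Matrix.diagonal_mul, Matrix.transpose_apply,
      ones, skew, Matrix.of_apply, Matrix.smul_apply, smul_eq_mul]
    by_cases hjk : j = k
    · subst hjk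
      simp
      ring
    · have h1 : q k - q j ≠ 0 := sub_ne_zero.mpr fun h => hjk (hq h.symm)
      have h2 : q j - q k ≠ 0 := sub_ne_zero.mpr fun h => hjk (hq h)
      rw [Matrix.diagonal_apply_ne _ hjk]
      field_simp
      ring
  have h1 := congrArg (fun A : Mat d => inner ℝ w (act A w)) h
  simp only [act_add (_ * _), act_smul, act_mul, inner_add_right, real_inner_smul_right] at h1
  have h2 : inner ℝ w (act (Matrix.diagonal q) (act (ones d + skew q) w)) =
      inner ℝ (act (ones d + skew q) w) (act (Matrix.diagonal q) w) := by
    rw [inner_act_right, Matrix.diagonal_transpose, real_inner_comm]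
  rw [inner_act_right, Matrix.transpose_transpose, h2] at h1
  linarith

/-- The drift matrix `μ P (1 1ᵀ + J) P⁻¹`, with `J` the matrix `skew q`. -/
noncomputable def drift (P : Mat d) (μ : ℝ) (q : Fin d → ℝ) : Mat d :=
  P * (μ • (ones d + skew q)) * P⁻¹

/-- The rank-one diffusion matrix `μ P 1 1ᵀ Pᵀ`. -/
noncomputable def diffusion (P : Mat d) (μ : ℝ) : Mat d := P * (μ • ones d) * P.transpose

theorem diffusion_eq (P : Mat d) (μ : ℝ) : diffusion P μ =
    μ • Matrix.vecMulVec (act P (oneVec d)).ofLp (act P (oneVec d)).ofLp := by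
  have h : (act P (oneVec d)).ofLp = P.mulVec (oneVec d).ofLp := by simp [act]
  rw [diffusion, mul_smul_comm, smul_mul_assoc, ones_eq_vecMulVec, Matrix.mul_vecMulVec,
    Matrix.vecMulVec_mul, Matrix.vecMul_transpose, h]

theorem posSemidef_diffusion (P : Mat d) {μ : ℝ} (hμ : 0 ≤ μ) : (diffusion P μ).PosSemidef := by
  rw [diffusion_eq]
  have := Matrix.posSemidef_vecMulVec_self_star (act P (oneVec d)).ofLp
  rw [star_trivial] at this
  exact this.smul hμ

theorem drift_mul_add {P : Mat d} (hKP : K = P * P.transpose) (hP : IsUnit P.det) (μ : ℝ)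
    (q : Fin d → ℝ) :
    drift P μ q * K + K * (drift P μ q).transpose = (2 : ℝ) • diffusion P μ := by
  have h1 : drift P μ q * K = P * (μ • (ones d + skew q)) * P.transpose := by
    rw [drift, hKP, mul_assoc, ← mul_assoc P⁻¹, Matrix.nonsing_inv_mul _ hP, one_mul]
  have h2 : K * (drift P μ q).transpose = (drift P μ q * K).transpose := by
    rw [Matrix.transpose_mul, hKP, Matrix.transpose_mul, Matrix.transpose_transpose]
  rw [h2, h1, Matrix.transpose_mul, Matrix.transpose_mul, Matrix.transpose_transpose,
    ← mul_assoc, ← add_mul, ← mul_add, Matrix.transpose_smul, Matrix.transpose_add, skew_transpose,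
    ones_transpose, ← smul_add, diffusion]
  have h3 : ones d + skew q + (ones d + -skew q) = (2 : ℝ) • ones d := by
    rw [two_smul]; abel
  rw [h3, smul_comm, mul_smul_comm, smul_mul_assoc]

/-- The drift matrix satisfies a Lyapunov equation for the form `P⁻ᵀ Q P⁻¹`, so that all its
eigenvalues have real part `μ`. -/
theorem spectralGap_drift {P : Mat d} (hP : IsUnit P.det) (hd : 0 < d) (μ : ℝ) {q : Fin d → ℝ}
    (hq : Function.Injective q) (hq0 : ∀ j, 0 < q j) : spectralGap (drift P μ q) = μ := by
  refine spectralGap_eq hd (R := P⁻¹.transpose * Matrix.diagonal q * P⁻¹) ?_ fun y => ?_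
  · have h1 : (Matrix.diagonal q).PosDef := Matrix.posDef_diagonal_iff.mpr hq0
    have h2 := h1.conjTranspose_mul_mul_same (B := P⁻¹) (Matrix.mulVec_injective_of_isUnit
      ((Matrix.isUnit_nonsing_inv_iff).mpr ((Matrix.isUnit_iff_isUnit_det P).mpr hP)))
    rwa [Matrix.conjTranspose_eq_transpose_of_trivial] at h2
  · have h1 : ∀ x, inner ℝ x (act (P⁻¹.transpose * Matrix.diagonal q * P⁻¹) y) =
        inner ℝ (act P⁻¹ x) (act (Matrix.diagonal q) (act P⁻¹ y)) := fun x => by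
      rw [act_mul, act_mul, inner_act_right, Matrix.transpose_transpose]
    have h2 : act P⁻¹ (act (drift P μ q) y) = μ • act (ones d + skew q) (act P⁻¹ y) := by
      rw [drift, act_mul, act_mul, act_inv_act hP, act_smul]
    rw [h1, h1, h2, real_inner_smul_left, inner_ones_add_skew hq]

/-- The flow of `-K⁻¹ C K`, for the drift matrix `C`, contracts the quadratic form of `P Q Pᵀ`, with
`Q` the diagonal matrix with entries `q`, at the exact exponential rate. -/
theorem inner_flow_drift {P : Mat d} (hKP : K = P * P.transpose) (hP : IsUnit P.det) (μ : ℝ)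
    {q : Fin d → ℝ} (hq : Function.Injective q) (t : ℝ) (k : E d) :
    inner ℝ (act P.transpose (flow (-(K⁻¹ * drift P μ q * K)) t k))
      (act (Matrix.diagonal q) (act P.transpose (flow (-(K⁻¹ * drift P μ q * K)) t k))) =
    Real.exp (-2 * μ * t) *
      inner ℝ (act P.transpose k) (act (Matrix.diagonal q) (act P.transpose k)) := by
  have h1 : ∀ x y, inner ℝ x (act (P * Matrix.diagonal q * P.transpose) y) =
      inner ℝ (act P.transpose x) (act (Matrix.diagonal q) (act P.transpose y)) := fun x y => by
    rw [act_mul, act_mul, inner_act_right]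
  have h2 : ∀ y, act P.transpose (act (-(K⁻¹ * drift P μ q * K)) y) =
      -(μ • act (ones d + skew q) (act P.transpose y)) := fun y => by
    have e1 : P.transpose * (K⁻¹ * drift P μ q * K) =
        μ • (ones d + skew q) * P.transpose := by
      have hPt : IsUnit P.transpose.det := by rwa [Matrix.det_transpose]
      rw [hKP, Matrix.mul_inv_rev, drift]
      simp only [← mul_assoc]
      rw [Matrix.mul_nonsing_inv _ hPt, one_mul, Matrix.nonsing_inv_mul _ hP, one_mul,
        mul_assoc _ P⁻¹ P, Matrix.nonsing_inv_mul _ hP, mul_one]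
    rw [← act_mul, mul_neg, e1, ← act_smul, ← act_mul]
    simp [act]
  have h3 := inner_flow_eq (R := P * Matrix.diagonal q * P.transpose)
    (N := -(K⁻¹ * drift P μ q * K)) (μ := μ) (by
      rw [Matrix.transpose_mul, Matrix.transpose_mul, Matrix.transpose_transpose,
        Matrix.diagonal_transpose, mul_assoc])
    (fun y => by
      rw [h1, h1, h2, inner_neg_left, real_inner_smul_left, inner_ones_add_skew hq, neg_mul]) t k
  rwa [h1, h1] at h3

theorem inner_act_diagonal (q : Fin d → ℝ) (w : E d) :
    inner ℝ w (act (Matrix.diagonal q) w) = ∑ j, q j * w j ^ 2 := by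
  simp only [act, PiLp.inner_apply, Matrix.ofLp_toEuclideanCLM, Matrix.mulVec_diagonal]
  refine Finset.sum_congr rfl fun j _ => ?_
  simp
  ring

/-- If the entries of `q` lie between `1` and `c²`, the flow of `-K⁻¹ C K` contracts the quadratic
form of `K` exponentially, with the multiplicative constant `c²`. -/
theorem inner_flow_drift_le {P : Mat d} (hKP : K = P * P.transpose) (hP : IsUnit P.det) {μ c : ℝ}
    {q : Fin d → ℝ} (hq : Function.Injective q) (h1 : ∀ j, 1 ≤ q j) (h2 : ∀ j, q j ≤ c ^ 2)
    (t : ℝ) (k : E d) :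
    inner ℝ (flow (-(K⁻¹ * drift P μ q * K)) t k)
      (act K (flow (-(K⁻¹ * drift P μ q * K)) t k)) ≤
    (c * Real.exp (-μ * t)) ^ 2 * inner ℝ k (act K k) := by
  have hlow : ∀ x, inner ℝ x (act K x) ≤
      inner ℝ (act P.transpose x) (act (Matrix.diagonal q) (act P.transpose x)) := fun x => by
    rw [inner_act_diagonal]
    conv_lhs => rw [hKP, inner_act_self_mul_transpose, EuclideanSpace.real_norm_sq_eq]
    exact Finset.sum_le_sum fun j _ => le_mul_of_one_le_left (sq_nonneg _) (h1 j)
  have hupp : ∀ x, inner ℝ (act P.transpose x) (act (Matrix.diagonal q) (act P.transpose x)) ≤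
      c ^ 2 * inner ℝ x (act K x) := fun x => by
    rw [inner_act_diagonal]
    conv_rhs => rw [hKP, inner_act_self_mul_transpose, EuclideanSpace.real_norm_sq_eq,
      Finset.mul_sum]
    exact Finset.sum_le_sum fun j _ => mul_le_mul_of_nonneg_right (h2 j) (sq_nonneg _)
  refine (hlow _).trans ?_
  rw [inner_flow_drift hKP hP μ hq]
  have he : (c * Real.exp (-μ * t)) ^ 2 = Real.exp (-2 * μ * t) * c ^ 2 := by
    rw [mul_pow, ← Real.exp_nat_mul, mul_comm]
    congr 2
    push_cast
    ring
  rw [he, mul_assoc (Real.exp _)]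
  exact mul_le_mul_of_nonneg_left (hupp k) (Real.exp_pos _).le

theorem frobNorm_vecMulVec (p : E d) : frobNorm (Matrix.vecMulVec p.ofLp p.ofLp) = ‖p‖ ^ 2 := by
  rw [← sq_eq_sq₀ (frobNorm_nonneg _) (by positivity), frobNorm_sq_eq_sum,
    EuclideanSpace.norm_sq_eq, sq (∑ i, _), Finset.sum_mul_sum]
  simp [Matrix.vecMulVec_apply, mul_pow]

theorem norm_sq_act_oneVec {P : Mat d} {μ : ℝ} (hμ : 0 < μ) (hKP : K = P * P.transpose)
    (hP : IsUnit P.det) (h : act K⁻¹ (act P (oneVec d)) = μ • act P (oneVec d)) :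
    ‖act P (oneVec d)‖ ^ 2 = d / μ := by
  have h1 : K⁻¹ = P⁻¹.transpose * P⁻¹.transpose.transpose := by
    rw [hKP, Matrix.mul_inv_rev, Matrix.transpose_transpose, Matrix.transpose_nonsing_inv]
  have h2 := inner_act_self_mul_transpose P⁻¹.transpose (act P (oneVec d))
  rw [← h1, h, Matrix.transpose_transpose, act_inv_act hP, norm_sq_oneVec, real_inner_smul_right,
    real_inner_self_eq_norm_sq] at h2
  rw [eq_div_iff hμ.ne', mul_comm, h2]

theorem trace_diffusion (P : Mat d) (μ : ℝ) :
    (diffusion P μ).trace = μ * ‖act P (oneVec d)‖ ^ 2 := by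
  rw [diffusion_eq, Matrix.trace_smul, EuclideanSpace.real_norm_sq_eq]
  simp [Matrix.trace, Matrix.vecMulVec_apply, ← pow_two]

theorem frobNorm_diffusion (P : Mat d) {μ : ℝ} (hμ : 0 ≤ μ) :
    frobNorm (diffusion P μ) = μ * ‖act P (oneVec d)‖ ^ 2 := by
  rw [diffusion_eq, frobNorm_smul, frobNorm_vecMulVec, abs_of_nonneg hμ]

theorem rank_diffusion {P : Mat d} {μ : ℝ} (hμ : μ ≠ 0) (h : act P (oneVec d) ≠ 0) :
    (diffusion P μ).rank = 1 := by
  have h0 : diffusion P μ ≠ 0 := fun h0 => by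
    have := trace_diffusion P μ
    rw [h0, Matrix.trace_zero] at this
    simp [hμ, h] at this
  refine le_antisymm ?_ ?_
  · rw [diffusion_eq, ← Matrix.smul_vecMulVec]
    exact Matrix.rank_vecMulVec_le _ _
  · rw [Nat.one_le_iff_ne_zero]
    intro hr
    rw [Matrix.rank, Submodule.finrank_eq_zero, LinearMap.range_eq_bot,
      ← Matrix.toLin'_apply'] at hr
    exact h0 ((LinearEquiv.map_eq_zero_iff Matrix.toLin').mp hr)

/-- The drift matrix is the sum of `D K⁻¹ = μ D` and a part that is conjugate to a skew-symmetric
matrix. -/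
theorem drift_eq {P : Mat d} {μ : ℝ} (hKP : K = P * P.transpose) (hP : IsUnit P.det)
    (h : act K⁻¹ (act P (oneVec d)) = μ • act P (oneVec d)) (q : Fin d → ℝ) :
    drift P μ q = μ • diffusion P μ + P * (μ • skew q) * P⁻¹ := by
  have h1 : P * (μ • ones d) * P⁻¹ = diffusion P μ * K⁻¹ := by
    have hPt : IsUnit P.transpose.det := by rwa [Matrix.det_transpose]
    rw [diffusion, hKP, Matrix.mul_inv_rev, mul_assoc _ P.transpose, ← mul_assoc P.transpose,
      Matrix.mul_nonsing_inv _ hPt, one_mul]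
  have h2 : diffusion P μ * K⁻¹ = μ • diffusion P μ := by
    have hKt : K⁻¹.transpose = K⁻¹ := by
      rw [Matrix.transpose_nonsing_inv, hKP, Matrix.transpose_mul, Matrix.transpose_transpose]
    have h3 : Matrix.vecMul (act P (oneVec d)).ofLp K⁻¹ = μ • (act P (oneVec d)).ofLp := by
      rw [← hKt, Matrix.vecMul_transpose, ← WithLp.ofLp_smul, ← h]
      simp [act]
    rw [diffusion_eq, smul_mul_assoc, Matrix.vecMulVec_mul, h3, Matrix.vecMulVec_smul]
  rw [drift, smul_add, mul_add, add_mul, h1, h2]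

/-! ### The Frobenius norm of the drift matrix -/

theorem hasSum_int_one_div_sq : HasSum (fun n : ℤ => 1 / (n : ℝ) ^ 2) (Real.pi ^ 2 / 3) := by
  have h := HasSum.of_nat_of_neg (f := fun n : ℤ => 1 / (n : ℝ) ^ 2)
    (by simpa using hasSum_zeta_two) (by simpa using hasSum_zeta_two)
  have e : Real.pi ^ 2 / 3 = Real.pi ^ 2 / 6 + Real.pi ^ 2 / 6 - 1 / ((0 : ℤ) : ℝ) ^ 2 := by
    simp
    ring
  rwa [e]

theorem sum_one_div_sub_sq_le (j : Fin d) :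
    ∑ k : Fin d, 1 / ((k : ℝ) - (j : ℝ)) ^ 2 ≤ Real.pi ^ 2 / 3 := by
  let e : Fin d ↪ ℤ := ⟨fun k => (k : ℤ) - (j : ℤ), fun k l h => by
    have : (k : ℤ) = l := by simpa using h
    exact Fin.ext (by exact_mod_cast this)⟩
  have h := sum_le_hasSum (Finset.univ.map e) (fun n _ => by positivity) hasSum_int_one_div_sq
  rw [Finset.sum_map] at h
  have he : ∀ k, ((e k : ℤ) : ℝ) = (k : ℝ) - j := fun k => by
    change (((k : ℤ) - (j : ℤ) : ℤ) : ℝ) = _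
    push_cast
    rfl
  simpa only [he] using h

/-- Equidistant points from `1` to `c²`, so that the form with these entries is equivalent to the
standard one with constant `c²` and their mutual distances are as large as possible. -/
noncomputable def nodes (d : ℕ) (c : ℝ) (j : Fin d) : ℝ :=
  1 + (c ^ 2 - 1) / ((d : ℝ) - 1) * j

theorem nodes_injective (hd : 2 ≤ d) {c : ℝ} (hc : 1 < c) : Function.Injective (nodes d c) := by
  intro j k h
  have h1 : (0 : ℝ) < d - 1 := by
    have : (2 : ℝ) ≤ d := by exact_mod_cast hd
    linarith
  have h2 : 0 < c ^ 2 - 1 := by nlinarith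
  have h3 : (c ^ 2 - 1) / ((d : ℝ) - 1) ≠ 0 := (div_pos h2 h1).ne'
  have h4 := mul_left_cancel₀ h3 (add_left_cancel h)
  exact Fin.ext (by exact_mod_cast h4)

theorem one_le_nodes (hd : 2 ≤ d) {c : ℝ} (hc : 1 < c) (j : Fin d) : 1 ≤ nodes d c j := by
  have h1 : (0 : ℝ) < d - 1 := by
    have : (2 : ℝ) ≤ d := by exact_mod_cast hd
    linarith
  have h2 : 0 < c ^ 2 - 1 := by nlinarith
  have : 0 ≤ (c ^ 2 - 1) / ((d : ℝ) - 1) * j := by positivity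
  rw [nodes]
  linarith

theorem nodes_le (hd : 2 ≤ d) {c : ℝ} (hc : 1 < c) (j : Fin d) : nodes d c j ≤ c ^ 2 := by
  have h1 : (0 : ℝ) < d - 1 := by
    have : (2 : ℝ) ≤ d := by exact_mod_cast hd
    linarith
  have h2 : 0 < c ^ 2 - 1 := by nlinarith
  have h3 : (j : ℝ) ≤ d - 1 := by
    have : (j : ℝ) + 1 ≤ d := by exact_mod_cast j.2
    linarith
  have : (c ^ 2 - 1) / ((d : ℝ) - 1) * j ≤ (c ^ 2 - 1) / ((d : ℝ) - 1) * (d - 1) := by gcongr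
  rw [div_mul_cancel₀ _ h1.ne'] at this
  rw [nodes]
  linarith

/-- The entries of the skew-symmetric matrix are at most
`2 c² (d - 1) / ((c² - 1) |j - k|)`; the sum of their squares is bounded by `ζ(2)`. -/
theorem frobNorm_skew_nodes_le (hd : 2 ≤ d) {c : ℝ} (hc : 1 < c) :
    frobNorm (skew (nodes d c)) ≤
      2 * Real.pi * c ^ 2 / (Real.sqrt 3 * (c ^ 2 - 1)) * Real.sqrt d * ((d : ℝ) - 1) := by
  have h1 : (0 : ℝ) < d - 1 := by
    have : (2 : ℝ) ≤ d := by exact_mod_cast hd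
    linarith
  have h2 : 0 < c ^ 2 - 1 := by nlinarith
  refine le_of_sq_le_sq ?_ (by positivity)
  have hentry : ∀ j k : Fin d, skew (nodes d c) j k ^ 2 ≤
      (2 * c ^ 2 * (d - 1) / (c ^ 2 - 1)) ^ 2 * (1 / ((k : ℝ) - (j : ℝ)) ^ 2) := by
    intro j k
    have e1 : nodes d c k - nodes d c j = (c ^ 2 - 1) / (d - 1) * ((k : ℝ) - j) := by
      rw [nodes, nodes]; ring
    have e2 : nodes d c j + nodes d c k ≤ 2 * c ^ 2 := by
      linarith [nodes_le hd hc j, nodes_le hd hc k]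
    have e3 : 0 ≤ nodes d c j + nodes d c k := by
      linarith [one_le_nodes hd hc j, one_le_nodes hd hc k]
    have e4 : (2 * c ^ 2 * (d - 1) / (c ^ 2 - 1)) ^ 2 * (1 / ((k : ℝ) - (j : ℝ)) ^ 2) =
        (2 * c ^ 2) ^ 2 / ((c ^ 2 - 1) / (d - 1) * ((k : ℝ) - j)) ^ 2 := by
      rw [mul_pow ((c ^ 2 - 1) / ((d : ℝ) - 1)), div_pow, div_pow, mul_pow (2 * c ^ 2),
        div_mul_div_comm, mul_one, div_mul_eq_mul_div, div_div_eq_mul_div]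
    rw [skew, Matrix.of_apply, div_pow, e1, e4]
    gcongr
  rw [frobNorm_sq_eq_sum]
  calc _ ≤ ∑ j : Fin d, ∑ k : Fin d,
        (2 * c ^ 2 * (d - 1) / (c ^ 2 - 1)) ^ 2 * (1 / ((k : ℝ) - (j : ℝ)) ^ 2) :=
        Finset.sum_le_sum fun j _ => Finset.sum_le_sum fun k _ => hentry j k
    _ ≤ ∑ _j : Fin d, (2 * c ^ 2 * (d - 1) / (c ^ 2 - 1)) ^ 2 * (Real.pi ^ 2 / 3) := by
        refine Finset.sum_le_sum fun j _ => ?_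
        rw [← Finset.mul_sum]
        exact mul_le_mul_of_nonneg_left (sum_one_div_sub_sq_le j) (sq_nonneg _)
    _ = _ := by
        have h3 : Real.sqrt 3 ^ 2 = 3 := Real.sq_sqrt (by norm_num)
        have h4 : Real.sqrt d ^ 2 = d := Real.sq_sqrt (Nat.cast_nonneg d)
        rw [Finset.sum_const, Finset.card_univ, Fintype.card_fin, nsmul_eq_mul, mul_pow, mul_pow,
          div_pow, div_pow, mul_pow (Real.sqrt 3), h3, h4]
        field_simp

theorem frobNorm_drift_le {P : Mat d} {μ : ℝ} (hμ : 0 < μ) (hKP : K = P * P.transpose)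
    (hP : IsUnit P.det) (h : act K⁻¹ (act P (oneVec d)) = μ • act P (oneVec d)) (q : Fin d → ℝ) :
    frobNorm (drift P μ q) ≤ μ * (d + Real.sqrt (condNumber K) * frobNorm (skew q)) := by
  rw [drift_eq hKP hP h, mul_add]
  refine (frobNorm_add_le _ _).trans (add_le_add ?_ ?_)
  · rw [frobNorm_smul, frobNorm_diffusion P hμ.le, norm_sq_act_oneVec hμ hKP hP h,
      mul_div_cancel₀ _ hμ.ne', abs_of_pos hμ]
  · calc _ ≤ ‖act P‖ * (μ * frobNorm (skew q)) * ‖act P⁻¹‖ := by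
          refine (frobNorm_mul_le_right _ _).trans ?_
          gcongr
          refine (frobNorm_mul_le _ _).trans_eq ?_
          rw [frobNorm_smul, abs_of_pos hμ]
      _ = μ * (‖act P‖ * ‖act P⁻¹‖ * frobNorm (skew q)) := by ring
      _ = _ := by rw [norm_act_mul_norm_act_inv hKP]

end

/-! ### Decay on the orthogonal complement of the steady state -/

section

variable {d : ℕ} {K C D : Mat d}

theorem V0_eq_span (hK : K.PosDef) : V0 K = Submodule.span ℝ {wave K 0 0} := by
  have hw : ((wave K 0 0 : H K) : E d → ℝ) =ᵐ[weight K] fInf K := by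
    have h : wave K 0 0 = lift K (trig 0 0) := by simp [wave]
    rw [h]
    filter_upwards [(linearGrowth_trig (0 : E d) 0).coeFn_lift hK] with x hx
    rw [hx]
    simp [trig]
  have h : {g : H K | (g : E d → ℝ) =ᵐ[weight K] fInf K} = {wave K 0 0} := by
    ext g
    rw [Set.mem_ofPred_eq, Set.mem_singleton_iff]
    exact ⟨fun hg => Lp.ext (hg.trans hw.symm), fun hg => hg ▸ hw⟩
  rw [V0, h]

theorem mem_V0_orthogonal (hK : K.PosDef) {f : H K} :
    f ∈ (V0 K)ᗮ ↔ inner ℝ (wave K 0 0) f = 0 := by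
  rw [V0_eq_span hK, Submodule.mem_orthogonal_singleton_iff_inner_right]

theorem propagator_mem_V0_orthogonal (hK : K.PosDef) (hD : D.PosSemidef)
    (hCD : C * K + K * C.transpose = (2 : ℝ) • D) {t : ℝ} (ht : 0 ≤ t) {f : H K}
    (hf : f ∈ (V0 K)ᗮ) : propagator K C t f ∈ (V0 K)ᗮ := by
  rw [mem_V0_orthogonal hK] at hf ⊢
  rw [propagator, inner_secondQuant_wave hK (inner_flow_le hK hD hCD ht) (inner_flow_conj hK C t),
    map_zero, hf]

/-- For `r ≥ 1` the bound is the contraction property; for `r ≤ 1` it is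
`norm_sq_secondQuant_le`. -/
theorem norm_propagator_comp_le (hK : K.PosDef) (hD : D.PosSemidef)
    (hCD : C * K + K * C.transpose = (2 : ℝ) • D) {t r : ℝ} (ht : 0 ≤ t) (hr : 0 ≤ r)
    (h : ∀ k, inner ℝ (flow (-(K⁻¹ * C * K)) t k) (act K (flow (-(K⁻¹ * C * K)) t k)) ≤
      r ^ 2 * inner ℝ k (act K k)) :
    ‖(propagator K C t).comp (V0 K)ᗮ.subtypeL‖ ≤ r := by
  refine ContinuousLinearMap.opNorm_le_bound _ hr fun f => ?_
  change ‖propagator K C t (f : H K)‖ ≤ r * ‖(f : H K)‖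
  rcases le_total r 1 with h1 | h1
  · have h2 := norm_sq_secondQuant_le hK hr h1 h (f : H K)
    rw [(mem_V0_orthogonal hK).mp f.2] at h2
    refine le_of_sq_le_sq ?_ (by positivity)
    rw [mul_pow]
    rwa [zero_pow two_ne_zero, mul_zero, add_zero] at h2
  · exact (norm_secondQuant_le hK (inner_flow_le hK hD hCD ht) _).trans
      (le_mul_of_one_le_left (norm_nonneg _) h1)

end

end FokkerPlanck

theorem mainTheorem1 (d : ℕ) (hd : 2 ≤ d) (K : FokkerPlanck.Mat d) (hK : K.PosDef) :
    IsGreatest {r : ℝ | ∃ p ∈ FokkerPlanck.admissible K, r = FokkerPlanck.spectralGap p.1}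
      (FokkerPlanck.lamOpt K) ∧
    ∀ c : ℝ, 1 < c →
      ∃ C D : FokkerPlanck.Mat d,
        (C, D) ∈ FokkerPlanck.admissible K ∧
        D.rank = 1 ∧
        (∃ S : ℝ → FokkerPlanck.H K →L[ℝ] FokkerPlanck.H K,
          FokkerPlanck.IsPropagator K C D S ∧
          ∀ t : ℝ, 0 ≤ t →
            (∀ f ∈ (FokkerPlanck.V0 K)ᗮ, S t f ∈ (FokkerPlanck.V0 K)ᗮ) ∧
            ‖(S t).comp (FokkerPlanck.V0 K)ᗮ.subtypeL‖ ≤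
              c * Real.exp (-(FokkerPlanck.lamOpt K) * t)) ∧
        FokkerPlanck.frobNorm D = d ∧
        FokkerPlanck.frobNorm C ≤
          FokkerPlanck.lamOpt K *
            (d + Real.sqrt (FokkerPlanck.condNumber K) *
              (2 * Real.pi * c ^ 2 / (Real.sqrt 3 * (c ^ 2 - 1))) *
                Real.sqrt d * ((d : ℝ) - 1)) := by
  have hd0 : 0 < d := by omega
  have hl := FokkerPlanck.lamOpt_pos hK hd0
  obtain ⟨P, hKP, hP, hPu⟩ := FokkerPlanck.exists_factor_oneVec hK hd0
  have hnorm := FokkerPlanck.norm_sq_act_oneVec hl hKP hP hPu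
  have hD := FokkerPlanck.posSemidef_diffusion P hl.le
  have htr : (FokkerPlanck.diffusion P (FokkerPlanck.lamOpt K)).trace = d := by
    rw [FokkerPlanck.trace_diffusion, hnorm, mul_div_cancel₀ _ hl.ne']
  have hCD := fun q => FokkerPlanck.drift_mul_add hKP hP (FokkerPlanck.lamOpt K) q
  have hadm : ∀ q, (FokkerPlanck.drift P (FokkerPlanck.lamOpt K) q,
      FokkerPlanck.diffusion P (FokkerPlanck.lamOpt K)) ∈ FokkerPlanck.admissible K := fun q =>
    FokkerPlanck.mem_admissible hK hD htr.le (hCD q)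
  -- the spectral gap is attained for any choice of the constant `c > 1`, for instance `c = 2`
  refine ⟨⟨⟨_, hadm (FokkerPlanck.nodes d 2), ?_⟩, ?_⟩, fun c hc => ?_⟩
  · exact (FokkerPlanck.spectralGap_drift hP hd0 _ (FokkerPlanck.nodes_injective hd one_lt_two)
      fun j => one_pos.trans_le (FokkerPlanck.one_le_nodes hd one_lt_two j)).symm
  · rintro _ ⟨⟨C, D⟩, hp, rfl⟩
    exact FokkerPlanck.spectralGap_le_lamOpt hK hd0 hp
  · refine ⟨_, _, hadm (FokkerPlanck.nodes d c), ?_, ⟨_,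
      FokkerPlanck.isPropagator_propagator hK hD (hCD _), fun t ht => ⟨fun f hf =>
        FokkerPlanck.propagator_mem_V0_orthogonal hK hD (hCD _) ht hf, ?_⟩⟩, ?_, ?_⟩
    · refine FokkerPlanck.rank_diffusion hl.ne' fun h0 => ?_
      rw [h0, norm_zero, eq_div_iff hl.ne'] at hnorm
      have : (0 : ℝ) < d := by exact_mod_cast hd0
      linarith
    · exact FokkerPlanck.norm_propagator_comp_le hK hD (hCD _) ht
        (mul_nonneg (by linarith) (Real.exp_pos _).le)
        (FokkerPlanck.inner_flow_drift_le hKP hP (FokkerPlanck.nodes_injective hd hc)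
          (FokkerPlanck.one_le_nodes hd hc) (FokkerPlanck.nodes_le hd hc) t)
    · rw [FokkerPlanck.frobNorm_diffusion P hl.le, hnorm, mul_div_cancel₀ _ hl.ne']
    · refine (FokkerPlanck.frobNorm_drift_le hl hKP hP hPu _).trans ?_
      rw [mul_assoc (Real.sqrt (FokkerPlanck.condNumber K)),
        mul_assoc (Real.sqrt (FokkerPlanck.condNumber K))]
      have := FokkerPlanck.frobNorm_skew_nodes_le hd hc
      gcongr
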